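/- Let $\mathbb K$ be $\mathbb R$ or $\mathbb C$. Consider 3D second-order Lagrangian densities $f(u_{xy},u_{xt},u_{yt})$, written as functions of $v_1=u_{yt}$, $v_2=u_{xt}$, $v_3=u_{xy}$; indices $(i,j,k)$ are cyclic permutations of $(1,2,3)$, and $f_{ij}=\partial^2 f/\partial v_i\partial v_j$, $F=(f_{ij})$. *Integrability.* A 2D density $g(a,b,c)$, $a=v_{xx}$, $b=v_{xy}$, $c=v_{yy}$, is called integrable if $$\begin{array}{c}(g_{ab}g_{cc}-g_{ac}g_{bc})_a=(g_{bc}g_{aa}-g_{ab}g_{ac})_c,\quad (g_{aa}g_{cc}-g_{ac}^2)_a=(g_{aa}g_{bb}-g_{ab}^2)_c,\quad (g_{aa}g_{cc}-g_{ac}^2)_c=(g_{cc}g_{bb}-g_{bc}^2)_a,\\ (g_{bb}g_{cc}-g_{bc}^2)_b=2(g_{ab}g_{cc}-g_{ac}g_{bc})_c,\quad (g_{bb}g_{aa}-g_{ab}^2)_b=2(g_{bc}g_{aa}-g_{ac}g_{ab})_a .\end{array}$$ A 3D density, a function of the Hessian matrix of $u(x_1,x_2,x_3)$ with $(x_1,x_2,x_3)=(x,y,t)$,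 is called integrable if for all constants $s_1,s_2,s_3$ and all quadratic forms $q$ the 2D density obtained by setting $u=v(s_1x_1+s_3x_3,\ s_2x_2+s_3x_3)+q(x_1,x_2,x_3)$ is integrable. Let $f$ be of class $C^3$ over $\mathbb K$ (holomorphic if $\mathbb K=\mathbb C$) on $D=I_1\times I_2\times I_3$, where $I_i\subseteq\mathbb K$ are open and connected. 1. $f$ is integrable on $D$ if and only if there are constants $a_i$ and functions $p_i$ of one variable such that on $D$, for all $i$, $$f_{jj}f_{kk}-f_{jk}^2=a_i,\qquad f_{ij}f_{ik}-f_{ii}f_{jk}=p_i(v_i).$$ 2. Let $f$ be integrable with $\det F\neq0$ everywhere on $D$, and suppose that no two of $f_{11},f_{22},f_{33}$ both vanish identically on $D$. Then there is a constant $c$ such that $p_i'=c\,(p_i^2-a_ja_k)$ on $I_i$ for all $i$. 3. Let $f$ be integrable with $\det F\neq 0$ everywhere on $D$, suppose that none of $f_{11},f_{22},f_{33}$ vanishes identically on $D$, and that $F$ is not constant on $D$ ($f$ is not a quadratic polynomial). Then near every point of $D$ the density $f$ is, up to equivalence, a local holomorphic branch of the following function of complex $w_1,w_2,w_3$. Here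 equivalence means $f(v)=\kappa\,\Phi(\mu_1v_1+\nu_1,\mu_2v_2+\nu_2,\mu_3v_3+\nu_3)+\sum\beta_iv_i+\kappa_0$ with complex constants, $\kappa\mu_1\mu_2\mu_3\ne0$. * All $a_i=0$: $\Phi=\sqrt{w_1w_2w_3}$. * $a_i\neq0$, $a_j=a_k=0$: $\Phi=\sqrt{w_jw_k(2w_i-w_jw_k)}-2w_i\arctan\sqrt{\frac{2w_i}{w_jw_k}-1}$. * $a_i=0$, $a_j,a_k\neq0$: $\Phi=(w_j-w_k)\arctan\frac{S}{w_j-w_k}-(w_j+w_k)\arctan\frac{S}{w_j+w_k}$ with $S=\sqrt{2w_jw_k\coth w_i-w_j^2-w_k^2}$. * All $a_i\ne0$: $$\Phi=\tfrac\pi2(w_1+w_2+w_3)-(A_1w_1+A_2w_2+A_3w_3)-L\left(\tfrac{2\pi-A_1-A_2-A_3}2\right)-L\left(\tfrac{A_1+A_2-A_3}2\right)-L\left(\tfrac{A_1+A_3-A_2}2\right)-L\left(\tfrac{A_2+A_3-A_1}2\right),$$ where $L(s)=-\int_0^s\ln\cos\xi\,d\xi$ is the Lobachevsky function and $A_1,A_2,A_3$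 are the angles of the spherical triangle whose opposite sides have cosines $\tanh w_1,\tanh w_2,\tanh w_3$, i.e. $\cos A_i=\cosh w_j\cosh w_k\tanh w_i-\sinh w_j\sinh w_k$, with $\sin A_i=R\cosh w_j\cosh w_k$ for a common root $R$ of $R^2=1-\sum\tanh^2w_i+2\prod\tanh w_i\neq 0$. (Roots and other expressions that occur more than once are taken with the same branch, wherever the radicand is nonzero and the $\arctan$s are regular, their value at infinity being admitted; in the last case the branches of $\ln\cos$ are chosen so that $\ln\cos\frac{2\pi-A_1-A_2-A_3}2+\ln\cos\frac{A_j+A_k-A_i}2-\ln\cos\frac{A_i+A_k-A_j}2-\ln\cos\frac{A_i+A_j-A_k}2=-2w_i$.) 4. Conversely, every such holomorphic branch $\Phi$ on an open subset of $\mathbb C^3$ is an integrable density with $\det F\ne0$ and all $f_{ii}\neq0$; its $(a_1,a_2,a_3)$ and $p_i$ are, respectively: $a=0$, $p_i=\frac1{8w_i}$; $a_i=1$, $a_j=a_k=0$, $p_l=\frac1{w_l}$; $a_i=0$, $a_j=a_k=1$, $p_i=\coth w_i$, $p_j=\frac1{w_j}$, $p_k=\frac1{w_k}$; all $a_i=1$,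 $p_i=\tanh w_i$. The same holds for the real densities (with principal values of $\sqrt{\ }$, $\arctan$, $\arccos$) * $\sqrt{u_{xy}u_{xt}u_{yt}}$ for $u_{xy}u_{xt}u_{yt}>0$; * $\sqrt{u_{xy}u_{xt}(2u_{yt}-u_{xy}u_{xt})}-2u_{yt}\arctan\sqrt{\frac{2u_{yt}}{u_{xy}u_{xt}}-1}$ for $0<u_{xy}u_{xt}<2u_{yt}$; * $(u_{xt}-u_{xy})\arctan\frac{S}{u_{xt}-u_{xy}}-(u_{xt}+u_{xy})\arctan\frac{S}{u_{xt}+u_{xy}}$, $S=\sqrt{2u_{xt}u_{xy}\coth u_{yt}-u_{xt}^2-u_{xy}^2}$, where $u_{yt}\ne0$, $u_{xt}\neq\pm u_{xy}$ and the radicand is positive; * the last function $\Phi$ of part 3 with $w=v$ real, $A_i=\arccos(\cosh v_j\cosh v_k\tanh v_i-\sinh v_j\sinh v_k)$, where $1-\sum\tanh^2v_i+2\prod\tanh v_i>0$. -/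

import Mathlib

open Topology Filter

noncomputable section

namespace Lagr

section Field

variable {𝕜 : Type*} [RCLike 𝕜]

/-- The partial derivative `∂f/∂v_i`. -/
def pd (i : Fin 3) (f : (Fin 3 → 𝕜) → 𝕜) (v : Fin 3 → 𝕜) : 𝕜 :=
  fderiv 𝕜 f v (Pi.single i 1)

/-- The Hessian matrix of a function of three variables. -/
def hess (f : (Fin 3 → 𝕜) → 𝕜) (v : Fin 3 → 𝕜) : Matrix (Fin 3) (Fin 3) 𝕜 :=
  Matrix.of fun i j => pd i (pd j f) v

/-- The integrability conditions of the 2D density `g(a, b, c) = g(v_xx, v_xy, v_yy)` at the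
point `w = (a, b, c)`: the conditions into which the vanishing of the Haantjes tensor of the
Euler-Lagrange system is rewritten. -/
structure Integrable2DAt (g : (Fin 3 → 𝕜) → 𝕜) (w : Fin 3 → 𝕜) : Prop where
  eq1 : pd 0 (fun x => hess g x 0 1 * hess g x 2 2 - hess g x 0 2 * hess g x 1 2) w =
    pd 2 (fun x => hess g x 1 2 * hess g x 0 0 - hess g x 0 1 * hess g x 0 2) w
  eq2 : pd 0 (fun x => hess g x 0 0 * hess g x 2 2 - hess g x 0 2 ^ 2) w =
    pd 2 (fun x => hess g x 0 0 * hess g x 1 1 - hess g x 0 1 ^ 2) w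
  eq3 : pd 2 (fun x => hess g x 0 0 * hess g x 2 2 - hess g x 0 2 ^ 2) w =
    pd 0 (fun x => hess g x 2 2 * hess g x 1 1 - hess g x 1 2 ^ 2) w
  eq4 : pd 1 (fun x => hess g x 1 1 * hess g x 2 2 - hess g x 1 2 ^ 2) w =
    2 * pd 2 (fun x => hess g x 0 1 * hess g x 2 2 - hess g x 0 2 * hess g x 1 2) w
  eq5 : pd 1 (fun x => hess g x 1 1 * hess g x 0 0 - hess g x 0 1 ^ 2) w =
    2 * pd 0 (fun x => hess g x 1 2 * hess g x 0 0 - hess g x 0 2 * hess g x 0 1) w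

/-- The Hessian matrix of `u(x₁, x₂, x₃) = v(s₁x₁ + s₃x₃, s₂x₂ + s₃x₃) + q(x₁, x₂, x₃)`, where `q`
is the quadratic form with (constant) Hessian matrix `Q`, in terms of
`w = (v_xx, v_xy, v_yy)`. -/
def waveHessian (s : Fin 3 → 𝕜) (Q : Matrix (Fin 3) (Fin 3) 𝕜) (w : Fin 3 → 𝕜) :
    Matrix (Fin 3) (Fin 3) 𝕜 :=
  (!![s 0, 0, s 2; 0, s 1, s 2] : Matrix (Fin 2) (Fin 3) 𝕜).transpose *
    !![w 0, w 1; w 1, w 2] * !![s 0, 0, s 2; 0, s 1, s 2] + Q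

/-- A 3D density `F`, a function of the Hessian matrix of `u(x₁, x₂, x₃)` defined on the set `𝒟` of
matrices, is integrable if all its travelling wave reductions to two dimensions are. -/
def Integrable3D (𝒟 : Set (Matrix (Fin 3) (Fin 3) 𝕜)) (F : Matrix (Fin 3) (Fin 3) 𝕜 → 𝕜) : Prop :=
  ∀ (s : Fin 3 → 𝕜) (Q : Matrix (Fin 3) (Fin 3) 𝕜), Q.IsSymm →
    ∀ w : Fin 3 → 𝕜, waveHessian s Q w ∈ 𝒟 → Integrable2DAt (fun x => F (waveHessian s Q x)) w

/-- The arguments `(v₁, v₂, v₃) = (u_yt, u_xt, u_xy)`, where `(x₁, x₂, x₃) = (x, y, t)`. -/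
def offDiag (U : Matrix (Fin 3) (Fin 3) 𝕜) : Fin 3 → 𝕜 := ![U 1 2, U 0 2, U 0 1]

/-- Integrability of the 3D density `f(u_xy, u_xt, u_yt)`, written as a function of
`(v₁, v₂, v₃) = (u_yt, u_xt, u_xy)` in the set `D`. -/
def IsIntegrable (D : Set (Fin 3 → 𝕜)) (f : (Fin 3 → 𝕜) → 𝕜) : Prop :=
  Integrable3D {U | offDiag U ∈ D} (fun U => f (offDiag U))

/-- The minor `f_jj f_kk - f_jk²`, where `(i, j, k)` is a cyclic permutation of the indices. -/
def diagMinor (f : (Fin 3 → 𝕜) → 𝕜) (i : Fin 3) (v : Fin 3 → 𝕜) : 𝕜 :=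
  hess f v (i + 1) (i + 1) * hess f v (i + 2) (i + 2) - hess f v (i + 1) (i + 2) ^ 2

/-- The minor `f_ij f_ik - f_ii f_jk`, where `(i, j, k)` is a cyclic permutation of the indices. -/
def offMinor (f : (Fin 3 → 𝕜) → 𝕜) (i : Fin 3) (v : Fin 3 → 𝕜) : 𝕜 :=
  hess f v i (i + 1) * hess f v i (i + 2) - hess f v i i * hess f v (i + 1) (i + 2)

/-- On `D` the diagonal minors are the constants `a i`, and the `i`-th off-diagonal minor is the
function `p i` of the single variable `v i`. -/
def HasMinors (D : Set (Fin 3 → 𝕜)) (f : (Fin 3 → 𝕜) → 𝕜) (a : Fin 3 → 𝕜) (p : Fin 3 → 𝕜 → 𝕜) :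
    Prop :=
  ∀ v ∈ D, ∀ i, diagMinor f i v = a i ∧ offMinor f i v = p i (v i)

/-- `f` is an integrable density on `D` with minors `a`, `p`, and it is nondegenerate. -/
structure Realizes (D : Set (Fin 3 → 𝕜)) (f : (Fin 3 → 𝕜) → 𝕜) (a : Fin 3 → 𝕜)
    (p : Fin 3 → 𝕜 → 𝕜) : Prop where
  smooth : ContDiffOn 𝕜 3 f D
  integrable : IsIntegrable D f
  minors : HasMinors D f a p
  det_ne : ∀ v ∈ D, (hess f v).det ≠ 0
  diag_ne : ∀ v ∈ D, ∀ i, hess f v i i ≠ 0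

/-- Near `v₀` the density `f` is, up to the equivalence transformations (rescaling and shift of the
`v_i`, rescaling of `f`, addition of an affine function), and with complex coefficients, one of the
densities `Φ` on open sets `V` of `ℂ³` that are selected by the predicate `P`. -/
def EquivNear [NormedAlgebra 𝕜 ℂ] (f : (Fin 3 → 𝕜) → 𝕜) (v₀ : Fin 3 → 𝕜)
    (P : Set (Fin 3 → ℂ) → ((Fin 3 → ℂ) → ℂ) → Prop) : Prop :=
  ∃ (V : Set (Fin 3 → ℂ)) (Φ : (Fin 3 → ℂ) → ℂ), IsOpen V ∧ P V Φ ∧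
    ∃ (κ κ₀ : ℂ) (μ ν β : Fin 3 → ℂ), κ ≠ 0 ∧ (∀ i, μ i ≠ 0) ∧
      ∀ᶠ v in 𝓝 v₀, (fun i => μ i * algebraMap 𝕜 ℂ (v i) + ν i) ∈ V ∧
        algebraMap 𝕜 ℂ (f v) = κ * Φ (fun i => μ i * algebraMap 𝕜 ℂ (v i) + ν i) +
          ∑ i, β i * algebraMap 𝕜 ℂ (v i) + κ₀

end Field

/-! ### The complex densities: holomorphic branches of the multivalued expressions -/

/-- `Φ` is a branch of `√(w₁ w₂ w₃)`. -/
structure SqrtDensity (V : Set (Fin 3 → ℂ)) (Φ : (Fin 3 → ℂ) → ℂ) : Prop where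
  holo : DifferentiableOn ℂ Φ V
  sq : ∀ w ∈ V, Φ w ^ 2 = w 0 * w 1 * w 2
  ne : ∀ w ∈ V, Φ w ≠ 0

/-- `T` is a branch of `arctan (Y / X)`, the points with `X = 0` (where `Y / X = ∞`) included. -/
structure ArctanBranch (V : Set (Fin 3 → ℂ)) (X Y T : (Fin 3 → ℂ) → ℂ) : Prop where
  holo : DifferentiableOn ℂ T V
  ne : ∀ w ∈ V, X w ^ 2 + Y w ^ 2 ≠ 0
  tan_eq : ∀ w ∈ V, X w * Complex.sin (T w) = Y w * Complex.cos (T w)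

/-- `Φ` is a branch of `√(w_j w_k (2 w_i - w_j w_k)) - 2 w_i arctan √(2 w_i / (w_j w_k) - 1)`, where
`(i, j, k)` is a cyclic permutation of the indices; the second root is the first one divided
by `w_j w_k`. -/
def ArctanDensityA (i : Fin 3) (V : Set (Fin 3 → ℂ)) (Φ : (Fin 3 → ℂ) → ℂ) : Prop :=
  ∃ R T : (Fin 3 → ℂ) → ℂ, DifferentiableOn ℂ R V ∧
    (∀ w ∈ V, R w ^ 2 = w (i + 1) * w (i + 2) * (2 * w i - w (i + 1) * w (i + 2)) ∧ R w ≠ 0) ∧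
    ArctanBranch V (fun w => w (i + 1) * w (i + 2)) R T ∧
    ∀ w ∈ V, Φ w = R w - 2 * w i * T w

/-- `Φ` is a branch of `(w_j - w_k) arctan (S / (w_j - w_k)) - (w_j + w_k) arctan (S / (w_j + w_k))`
with `S = √(2 w_j w_k coth w_i - w_j² - w_k²)`, where `(i, j, k)` is a cyclic permutation of the
indices. -/
def ArctanDensityB (i : Fin 3) (V : Set (Fin 3 → ℂ)) (Φ : (Fin 3 → ℂ) → ℂ) : Prop :=
  ∃ S T₁ T₂ : (Fin 3 → ℂ) → ℂ, DifferentiableOn ℂ S V ∧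
    (∀ w ∈ V, Complex.sinh (w i) ≠ 0 ∧
      S w ^ 2 = 2 * w (i + 1) * w (i + 2) * (Complex.cosh (w i) / Complex.sinh (w i))
        - w (i + 1) ^ 2 - w (i + 2) ^ 2 ∧ S w ≠ 0) ∧
    ArctanBranch V (fun w => w (i + 1) - w (i + 2)) S T₁ ∧
    ArctanBranch V (fun w => w (i + 1) + w (i + 2)) S T₂ ∧
    ∀ w ∈ V, Φ w = (w (i + 1) - w (i + 2)) * T₁ w - (w (i + 1) + w (i + 2)) * T₂ w

/-- `A 0, A 1, A 2` are holomorphic branches of the angles of the spherical triangle whose sides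
have the cosines `tanh w_i`: the first spherical cosine law gives `cos (A i)`, and
`R² = 1 - ∑ tanh² w_i + 2 ∏ tanh w_i` is the determinant that gives `sin (A i)`. The common
sign of the sines makes the second spherical cosine law hold. -/
structure SphericalAngles (V : Set (Fin 3 → ℂ)) (A : Fin 3 → (Fin 3 → ℂ) → ℂ) : Prop where
  holo : ∀ i, DifferentiableOn ℂ (A i) V
  cosh_ne : ∀ w ∈ V, ∀ i, Complex.cosh (w i) ≠ 0
  cos_eq : ∀ w ∈ V, ∀ i, Complex.cos (A i w) =
    Complex.cosh (w (i + 1)) * Complex.cosh (w (i + 2)) * Complex.tanh (w i)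
      - Complex.sinh (w (i + 1)) * Complex.sinh (w (i + 2))
  sin_eq : ∀ w ∈ V, ∃ R : ℂ, R ≠ 0 ∧
    R ^ 2 = 1 - ∑ i, Complex.tanh (w i) ^ 2 + 2 * ∏ i, Complex.tanh (w i) ∧
    ∀ i, Complex.sin (A i w) = R * Complex.cosh (w (i + 1)) * Complex.cosh (w (i + 2))

/-- `ℓ` is a branch of `ln cos σ`, and `M` is the corresponding branch of `L(σ)`, where
`L(s) = -∫₀ˢ ln cos ξ dξ` is the Lobachevsky function, up to a constant: `dM = -ℓ dσ`. -/
structure LobachevskyBranch (V : Set (Fin 3 → ℂ)) (σ ℓ M : (Fin 3 → ℂ) → ℂ) : Prop where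
  holo_log : DifferentiableOn ℂ ℓ V
  exp_eq : ∀ w ∈ V, Complex.exp (ℓ w) = Complex.cos (σ w)
  holo : DifferentiableOn ℂ M V
  fderiv_eq : ∀ w ∈ V, fderiv ℂ M w = -(ℓ w) • fderiv ℂ σ w

/-- `Φ` is a branch of `(π/2) ∑ w_i - ∑ A_i w_i - L((2π - A₁ - A₂ - A₃)/2) - L((A₁ + A₂ - A₃)/2)
- L((A₁ + A₃ - A₂)/2) - L((A₂ + A₃ - A₁)/2)`. The branches of the logarithms are those for which
the logarithm of `cos σ₀ cos σ_i / (cos σ_j cos σ_k) = (1 - tanh w_i) / (1 + tanh w_i)`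
is `-2 w_i`. -/
def LobachevskyDensity (V : Set (Fin 3 → ℂ)) (Φ : (Fin 3 → ℂ) → ℂ) : Prop :=
  ∃ (A : Fin 3 → (Fin 3 → ℂ) → ℂ) (ℓ₀ M₀ : (Fin 3 → ℂ) → ℂ) (ℓ M : Fin 3 → (Fin 3 → ℂ) → ℂ),
    SphericalAngles V A ∧
    LobachevskyBranch V (fun w => (2 * Real.pi - A 0 w - A 1 w - A 2 w) / 2) ℓ₀ M₀ ∧
    (∀ i, LobachevskyBranch V (fun w => (A (i + 1) w + A (i + 2) w - A i w) / 2) (ℓ i) (M i)) ∧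
    (∀ w ∈ V, ∀ i, ℓ₀ w + ℓ i w - ℓ (i + 1) w - ℓ (i + 2) w = -2 * w i) ∧
    ∀ w ∈ V, Φ w = Real.pi / 2 * ∑ i, w i - ∑ i, A i w * w i - M₀ w - ∑ i, M i w

/-! ### The real densities -/

/-- `√(u_xy u_xt u_yt)` -/
def sqrtReal (v : Fin 3 → ℝ) : ℝ := Real.sqrt (v 0 * v 1 * v 2)

/-- `√(u_xy u_xt (2 u_yt - u_xy u_xt)) - 2 u_yt arctan √(2 u_yt / (u_xy u_xt) - 1)` -/
def arctanRealA (v : Fin 3 → ℝ) : ℝ :=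
  Real.sqrt (v 2 * v 1 * (2 * v 0 - v 2 * v 1))
    - 2 * v 0 * Real.arctan (Real.sqrt (2 * v 0 / (v 2 * v 1) - 1))

/-- `2 u_xt u_xy coth u_yt - u_xt² - u_xy²` -/
def radicandB (v : Fin 3 → ℝ) : ℝ :=
  2 * v 1 * v 2 * (Real.cosh (v 0) / Real.sinh (v 0)) - v 1 ^ 2 - v 2 ^ 2

/-- `(u_xt - u_xy) arctan (S / (u_xt - u_xy)) - (u_xt + u_xy) arctan (S / (u_xt + u_xy))`,
where `S = √(2 u_xt u_xy coth u_yt - u_xt² - u_xy²)`. -/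
def arctanRealB (v : Fin 3 → ℝ) : ℝ :=
  (v 1 - v 2) * Real.arctan (Real.sqrt (radicandB v) / (v 1 - v 2))
    - (v 1 + v 2) * Real.arctan (Real.sqrt (radicandB v) / (v 1 + v 2))

/-- The Lobachevsky function `L(s) = -∫₀ˢ ln cos ξ dξ`. -/
def lobachevsky (s : ℝ) : ℝ := -∫ ξ in (0 : ℝ)..s, Real.log (Real.cos ξ)

/-- The set of `v` for which a nondegenerate spherical triangle exists whose sides have the cosines
`tanh v_i`. -/
def triangleDomain : Set (Fin 3 → ℝ) :=
  {v | 0 < 1 - ∑ i, Real.tanh (v i) ^ 2 + 2 * ∏ i, Real.tanh (v i)}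

/-- The angle, opposite to the `i`-th side, of the spherical triangle whose sides have the cosines
`tanh v_i`. -/
def sphericalAngle (i : Fin 3) (v : Fin 3 → ℝ) : ℝ :=
  Real.arccos (Real.cosh (v (i + 1)) * Real.cosh (v (i + 2)) * Real.tanh (v i)
    - Real.sinh (v (i + 1)) * Real.sinh (v (i + 2)))

/-- The generic density. -/
def lobachevskyReal (v : Fin 3 → ℝ) : ℝ :=
  Real.pi / 2 * ∑ i, v i - ∑ i, sphericalAngle i v * v i
    - lobachevsky ((2 * Real.pi - sphericalAngle 0 v - sphericalAngle 1 v - sphericalAngle 2 v) / 2)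
    - ∑ i, lobachevsky
        ((sphericalAngle (i + 1) v + sphericalAngle (i + 2) v - sphericalAngle i v) / 2)

end Lagr

end

namespace Lagr

/-! ### Partial derivatives of functions of three variables. -/

section Calculus

variable {𝕜 : Type*} [RCLike 𝕜] {f g : (Fin 3 → 𝕜) → 𝕜} {v : Fin 3 → 𝕜}

/-! Everything is expressed through the adjugate of the Hessian `F`, whose entries are the minors.

Integrability. A travelling wave reduction is the composition of `f` with an affine map, so by
Cauchy–Binet the 2×2 minors of the reduced Hessian are linear combinations of the minors of `F`. The
2D conditions thus become linear relations between first derivatives of the minors, with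
coefficients polynomial in the wave parameters `s`. As `s` is arbitrary, the coefficients vanish one
by one (`isIntegrable_iff_pd`). The two derivatives not reached in this way vanish because the rows
of the cofactor matrix of a Hessian are divergence free (`piola`). On a connected product this says
that the diagonal minors are constants `a i` and that the `i`-th off-diagonal minor depends on `v i`
alone.

Riccati equations. Differentiate `det F • F = adj (adj F)`. Equality of third derivatives of `f`
then gives `f_ii p_j' = f_jj p_i'` (`HasMinors.pd_pd_mul_pd_offMinor`). Since `det F * f_ii = a_j
a_k - p_i ^ 2`, the variables separate, and `p_i' / (p_i ^ 2 - a_j a_k)` is one constant `c` for all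
`i`.

Classification. A nonsingular symmetric 3×3 matrix is determined by its adjugate up to sign, because
`det F ^ 2 = det (adj F)`. Locally the sign is constant by continuity, so two densities with the
same minors differ, up to sign, by an affine function (`equivNear_of_minors_eq`). Under rescaling,
`a` and `p` are multiplied by explicit monomials in the scale factors. Both the given `p` and those
of the normal form solve Riccati equations, so once the scales make the equations agree it remains
to match values at a single point (`equivNear_of_riccati`), which can be done by algebra over `ℂ`
and a choice of shift. That `c ≠ 0` follows from `F` not being constant; that `p_i ^ 2 - a_j a_k`
has no zeros follows from uniqueness for linear equations.

Normal forms. For each explicit density the gradient is simple: a multiple of the density itself,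
arctangents and a root, or the spherical angles. The Hessian is then algebraic in the variables, the
root and the functions `coth` or `tanh`, and its minors are evaluated by the equation for the square
of the root. In the generic case the derivatives of the Lobachevsky terms cancel those of the angles
by half-angle formulas of spherical trigonometry (`cos_half_angle`). -/

theorem pd_congr (h : f =ᶠ[𝓝 v] g) (i : Fin 3) : pd i f v = pd i g v := by
  simp only [pd, h.fderiv_eq]

theorem pd_const (c : 𝕜) (i : Fin 3) : pd i (fun _ => c) v = 0 := by
  simp [pd]

theorem pd_coord (i j : Fin 3) : pd i (fun w : Fin 3 → 𝕜 => w j) v = if j = i then 1 else 0 := by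
  have : fderiv 𝕜 (fun w : Fin 3 → 𝕜 => w j) v = ContinuousLinearMap.proj j :=
    (ContinuousLinearMap.proj (R := 𝕜) (φ := fun _ : Fin 3 => 𝕜) j).hasFDerivAt.fderiv
  simp [pd, this, Pi.single_apply]

theorem pd_add (hf : DifferentiableAt 𝕜 f v) (hg : DifferentiableAt 𝕜 g v) (i : Fin 3) :
    pd i (fun w => f w + g w) v = pd i f v + pd i g v := by
  simp [pd, fderiv_fun_add hf hg]

theorem pd_sub (hf : DifferentiableAt 𝕜 f v) (hg : DifferentiableAt 𝕜 g v) (i : Fin 3) :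
    pd i (fun w => f w - g w) v = pd i f v - pd i g v := by
  simp [pd, fderiv_fun_sub hf hg]

theorem pd_mul (hf : DifferentiableAt 𝕜 f v) (hg : DifferentiableAt 𝕜 g v) (i : Fin 3) :
    pd i (fun w => f w * g w) v = f v * pd i g v + g v * pd i f v := by
  simp [pd, fderiv_fun_mul hf hg]

theorem pd_const_mul (c : 𝕜) (hf : DifferentiableAt 𝕜 f v) (i : Fin 3) :
    pd i (fun w => c * f w) v = c * pd i f v := by
  simp [pd_mul (differentiableAt_const c) hf, pd_const]

theorem pd_sq (hf : DifferentiableAt 𝕜 f v) (i : Fin 3) :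
    pd i (fun w => f w ^ 2) v = 2 * f v * pd i f v := by
  simp only [sq, pd_mul hf hf]
  ring

theorem pd_scomp {φ : 𝕜 → 𝕜} {φ' : 𝕜} (hφ : HasDerivAt φ φ' (f v)) (hf : DifferentiableAt 𝕜 f v)
    (i : Fin 3) : pd i (fun w => φ (f w)) v = φ' * pd i f v := by
  have := (hφ.comp_hasFDerivAt v hf.hasFDerivAt).fderiv
  simp only [Function.comp_def] at this
  simp [pd, this]

theorem pd_div (hf : DifferentiableAt 𝕜 f v) (hg : DifferentiableAt 𝕜 g v) (h : g v ≠ 0)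
    (i : Fin 3) :
    pd i (fun w => f w / g w) v = (pd i f v * g v - f v * pd i g v) / g v ^ 2 := by
  have := pd_scomp (f := g) (hasDerivAt_inv h) hg i
  simp only [div_eq_mul_inv]
  have hi : DifferentiableAt 𝕜 (fun w => (g w)⁻¹) v := hg.inv h
  rw [pd_mul hf hi, this]
  field_simp
  ring

theorem fderiv_apply_eq_sum_pd (f : (Fin 3 → 𝕜) → 𝕜) (v x : Fin 3 → 𝕜) :
    fderiv 𝕜 f v x = ∑ i, pd i f v * x i := by
  conv_lhs => rw [← Finset.univ_sum_single x]
  rw [map_sum]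
  refine Finset.sum_congr rfl fun i _ => ?_
  have : (Pi.single i (x i) : Fin 3 → 𝕜) = x i • Pi.single i (1 : 𝕜) := by
    ext j; simp [Pi.single_apply]
  rw [pd, this, map_smul, smul_eq_mul, mul_comm]

theorem fderiv_eq_sum_pd (f : (Fin 3 → 𝕜) → 𝕜) (v : Fin 3 → 𝕜) :
    fderiv 𝕜 f v = ∑ i, pd i f v • ContinuousLinearMap.proj (R := 𝕜) i := by
  ext1 x
  simp [fderiv_apply_eq_sum_pd]

theorem pd_comp {ℓ : (Fin 3 → 𝕜) → Fin 3 → 𝕜} (hℓ : ∀ i, DifferentiableAt 𝕜 (fun w => ℓ w i) v)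
    (hf : DifferentiableAt 𝕜 f (ℓ v)) (k : Fin 3) :
    pd k (fun w => f (ℓ w)) v = ∑ i, pd i f (ℓ v) * pd k (fun w => ℓ w i) v := by
  have h1 : HasFDerivAt ℓ (ContinuousLinearMap.pi fun i => fderiv 𝕜 (fun w => ℓ w i) v) v :=
    hasFDerivAt_pi.2 fun i => (hℓ i).hasFDerivAt
  have := (hf.hasFDerivAt.comp v h1).fderiv
  simp only [Function.comp_def] at this
  rw [pd, this, ContinuousLinearMap.comp_apply, fderiv_apply_eq_sum_pd]
  rfl

theorem _root_.ContDiffAt.pd {n m : WithTop ℕ∞} (hf : ContDiffAt 𝕜 n f v) (h : m + 1 ≤ n)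
    (i : Fin 3) : ContDiffAt 𝕜 m (pd i f) v :=
  (hf.fderiv_right h).clm_apply contDiffAt_const

theorem _root_.ContDiffAt.pd_pd {n m : WithTop ℕ∞} (hf : ContDiffAt 𝕜 n f v) (h : m + 1 + 1 ≤ n)
    (i j : Fin 3) : ContDiffAt 𝕜 m (Lagr.pd i (Lagr.pd j f)) v :=
  (hf.pd h j).pd le_rfl i

theorem hess_apply (f : (Fin 3 → 𝕜) → 𝕜) (v : Fin 3 → 𝕜) (i j : Fin 3) :
    hess f v i j = pd i (pd j f) v := rfl

theorem pd_pd_comm (hf : ContDiffAt 𝕜 2 f v) (i j : Fin 3) :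
    pd i (pd j f) v = pd j (pd i f) v := by
  have h := hf.isSymmSndFDerivAt (by simp)
  have hd : DifferentiableAt 𝕜 (fderiv 𝕜 f) v :=
    (hf.fderiv_right (m := 1) (by norm_num)).differentiableAt one_ne_zero
  have key : ∀ i j, pd i (pd j f) v =
      fderiv 𝕜 (fderiv 𝕜 f) v (Pi.single i 1) (Pi.single j 1) := fun i j => by
    unfold pd
    rw [fderiv_clm_apply hd (differentiableAt_const _)]
    simp
  rw [key, key]
  exact h _ _

theorem pd_pd_pd_symm (hf : ContDiffAt 𝕜 3 f v) (k i j : Fin 3) :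
    pd k (pd i (pd j f)) v = pd k (pd j (pd i f)) v := by
  refine pd_congr ?_ k
  filter_upwards [hf.eventually (by simp)] with w hw
  exact pd_pd_comm (hw.of_le (by norm_num)) i j

theorem pd_pd_pd_comm (hf : ContDiffAt 𝕜 3 f v) (k i j : Fin 3) :
    pd k (pd i (pd j f)) v = pd i (pd k (pd j f)) v :=
  pd_pd_comm (hf.pd (by norm_num) j) k i

end Calculus


/-! ### Travelling wave reductions and derivatives of the minors. -/

section Reduction

variable {𝕜 : Type*} [RCLike 𝕜]

/-- The map of the Hessian `(v_xx, v_xy, v_yy)` of a travelling wave reduction to the arguments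
of the 3D density. -/
noncomputable def reductionMap (α β γ : 𝕜) (c w : Fin 3 → 𝕜) : Fin 3 → 𝕜 :=
  ![α * (w 1 + w 2) + c 0, β * (w 0 + w 1) + c 1, γ * w 1 + c 2]

/-- The matrix of the linear part of `reductionMap`. -/
noncomputable def reductionMatrix (α β γ : 𝕜) : Fin 3 → Fin 3 → 𝕜 := ![![0, β, 0], ![α, β, γ], ![α, 0, 0]]

theorem offDiag_waveHessian (s : Fin 3 → 𝕜) (Q : Matrix (Fin 3) (Fin 3) 𝕜) (w : Fin 3 → 𝕜) :
    offDiag (waveHessian s Q w) =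
      reductionMap (s 1 * s 2) (s 0 * s 2) (s 0 * s 1) (offDiag Q) w := by
  ext i
  fin_cases i <;>
    simp [offDiag, waveHessian, reductionMap, Matrix.mul_apply, Fin.sum_univ_succ] <;> ring

variable {α β γ : 𝕜} {c w : Fin 3 → 𝕜}

theorem continuous_reductionMap : Continuous (reductionMap α β γ c) := by
  refine continuous_pi fun i => ?_
  fin_cases i <;> simp [reductionMap] <;> fun_prop

theorem pd_comp_reductionMap {φ : (Fin 3 → 𝕜) → 𝕜}
    (hφ : DifferentiableAt 𝕜 φ (reductionMap α β γ c w)) (k : Fin 3) :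
    pd k (fun x => φ (reductionMap α β γ c x)) w =
      ∑ i, reductionMatrix α β γ k i * pd i φ (reductionMap α β γ c w) := by
  have hc : ∀ j, DifferentiableAt 𝕜 (fun x : Fin 3 → 𝕜 => x j) w := fun j => by fun_prop
  have h0 : pd k (fun x => reductionMap α β γ c x 0) w = reductionMatrix α β γ k 0 := by
    have : (fun x => reductionMap α β γ c x 0) = fun x => α * (x 1 + x 2) + c 0 := rfl
    rw [this, pd_add (by fun_prop) (by fun_prop), pd_const_mul _ (by fun_prop),
      pd_add (hc 1) (hc 2), pd_const, pd_coord, pd_coord]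
    fin_cases k <;> simp [reductionMatrix]
  have h1 : pd k (fun x => reductionMap α β γ c x 1) w = reductionMatrix α β γ k 1 := by
    have : (fun x => reductionMap α β γ c x 1) = fun x => β * (x 0 + x 1) + c 1 := rfl
    rw [this, pd_add (by fun_prop) (by fun_prop), pd_const_mul _ (by fun_prop),
      pd_add (hc 0) (hc 1), pd_const, pd_coord, pd_coord]
    fin_cases k <;> simp [reductionMatrix]
  have h2 : pd k (fun x => reductionMap α β γ c x 2) w = reductionMatrix α β γ k 2 := by
    have : (fun x => reductionMap α β γ c x 2) = fun x => γ * x 1 + c 2 := rfl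
    rw [this, pd_add (by fun_prop) (by fun_prop), pd_const_mul _ (hc 1), pd_const, pd_coord]
    fin_cases k <;> simp [reductionMatrix]
  have hd : ∀ i, DifferentiableAt 𝕜 (fun x => reductionMap α β γ c x i) w := fun i => by
    fin_cases i <;> simp [reductionMap] <;> fun_prop
  rw [pd_comp hd hφ, Fin.sum_univ_three, Fin.sum_univ_three, h0, h1, h2]
  ring

theorem hess_comp_reductionMap {f : (Fin 3 → 𝕜) → 𝕜}
    (hf : ContDiffAt 𝕜 2 f (reductionMap α β γ c w)) (k l : Fin 3) :
    hess (fun x => f (reductionMap α β γ c x)) w k l =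
      ∑ i, ∑ j, reductionMatrix α β γ k i * reductionMatrix α β γ l j *
        pd i (pd j f) (reductionMap α β γ c w) := by
  have h1 : pd l (fun x => f (reductionMap α β γ c x)) =ᶠ[𝓝 w] fun x =>
      (fun v => ∑ j, reductionMatrix α β γ l j * pd j f v) (reductionMap α β γ c x) := by
    filter_upwards [continuous_reductionMap.continuousAt.eventually (hf.eventually (by simp))]
      with x hx
    exact pd_comp_reductionMap (hx.differentiableAt (by simp)) l
  have hd : ∀ j, DifferentiableAt 𝕜 (pd j f) (reductionMap α β γ c w) := fun j =>
    (hf.pd (m := 1) (by norm_num) j).differentiableAt one_ne_zero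
  have h2 : ∀ i, pd i (fun v => ∑ j, reductionMatrix α β γ l j * pd j f v)
      (reductionMap α β γ c w) =
      ∑ j, reductionMatrix α β γ l j * pd i (pd j f) (reductionMap α β γ c w) := fun i => by
    simp only [Fin.sum_univ_three]
    have := hd 0; have := hd 1; have := hd 2
    rw [pd_add (by fun_prop) (by fun_prop), pd_add (by fun_prop) (by fun_prop),
      pd_const_mul _ (hd 0), pd_const_mul _ (hd 1), pd_const_mul _ (hd 2)]
  have := hd 0; have := hd 1; have := hd 2
  rw [hess_apply, pd_congr h1, pd_comp_reductionMap
    (φ := fun v => ∑ j, reductionMatrix α β γ l j * pd j f v)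
    (by simp only [Fin.sum_univ_three]; fun_prop)]
  simp only [h2, Finset.mul_sum, mul_assoc]

variable {f : (Fin 3 → 𝕜) → 𝕜} {v : Fin 3 → 𝕜}

theorem differentiableAt_pd_pd (hf : ContDiffAt 𝕜 3 f v) (i j : Fin 3) :
    DifferentiableAt 𝕜 (pd i (pd j f)) v :=
  (hf.pd_pd (m := 1) (by norm_num) i j).differentiableAt one_ne_zero

theorem diagMinor_eq (f : (Fin 3 → 𝕜) → 𝕜) (i : Fin 3) : diagMinor f i = fun v =>
    pd (i + 1) (pd (i + 1) f) v * pd (i + 2) (pd (i + 2) f) v -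
      pd (i + 1) (pd (i + 2) f) v ^ 2 := rfl

theorem offMinor_eq (f : (Fin 3 → 𝕜) → 𝕜) (i : Fin 3) : offMinor f i = fun v =>
    pd i (pd (i + 1) f) v * pd i (pd (i + 2) f) v -
      pd i (pd i f) v * pd (i + 1) (pd (i + 2) f) v := rfl

theorem contDiffAt_diagMinor (hf : ContDiffAt 𝕜 3 f v) (i : Fin 3) :
    ContDiffAt 𝕜 1 (diagMinor f i) v := by
  have := fun i j => hf.pd_pd (m := 1) (by norm_num) i j
  exact ((this _ _).mul (this _ _)).sub ((this _ _).pow 2)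

theorem contDiffAt_offMinor (hf : ContDiffAt 𝕜 3 f v) (i : Fin 3) :
    ContDiffAt 𝕜 1 (offMinor f i) v := by
  have := fun i j => hf.pd_pd (m := 1) (by norm_num) i j
  exact ((this _ _).mul (this _ _)).sub ((this _ _).mul (this _ _))

theorem pd_diagMinor (hf : ContDiffAt 𝕜 3 f v) (i l : Fin 3) :
    pd l (diagMinor f i) v =
      pd (i + 1) (pd (i + 1) f) v * pd l (pd (i + 2) (pd (i + 2) f)) v +
      pd (i + 2) (pd (i + 2) f) v * pd l (pd (i + 1) (pd (i + 1) f)) v -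
      2 * pd (i + 1) (pd (i + 2) f) v * pd l (pd (i + 1) (pd (i + 2) f)) v := by
  have h := fun i j => differentiableAt_pd_pd hf i j
  rw [diagMinor_eq, pd_sub ((h _ _).fun_mul (h _ _)) ((h _ _).fun_pow 2),
    pd_mul (h _ _) (h _ _), pd_sq (h _ _)]

theorem pd_offMinor (hf : ContDiffAt 𝕜 3 f v) (i l : Fin 3) :
    pd l (offMinor f i) v =
      pd i (pd (i + 1) f) v * pd l (pd i (pd (i + 2) f)) v +
      pd i (pd (i + 2) f) v * pd l (pd i (pd (i + 1) f)) v -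
      (pd i (pd i f) v * pd l (pd (i + 1) (pd (i + 2) f)) v +
      pd (i + 1) (pd (i + 2) f) v * pd l (pd i (pd i f)) v) := by
  have h := fun i j => differentiableAt_pd_pd hf i j
  rw [offMinor_eq, pd_sub ((h _ _).fun_mul (h _ _)) ((h _ _).fun_mul (h _ _)),
    pd_mul (h _ _) (h _ _), pd_mul (h _ _) (h _ _)]

/-- The divergence of a row of the cofactor matrix of a Hessian matrix vanishes. -/
theorem piola (hf : ContDiffAt 𝕜 3 f v) :
    pd 0 (diagMinor f 0) v + pd 1 (offMinor f 2) v + pd 2 (offMinor f 1) v = 0 ∧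
    pd 0 (offMinor f 2) v + pd 1 (diagMinor f 1) v + pd 2 (offMinor f 0) v = 0 := by
  have hs := pd_pd_comm (hf.of_le (by norm_num : (2 : WithTop ℕ∞) ≤ 3))
  have ts := pd_pd_pd_symm hf
  have tc := pd_pd_pd_comm hf
  simp only [pd_diagMinor hf, pd_offMinor hf, Fin.isValue, Fin.reduceAdd, zero_add]
  simp only [hs 1 0, hs 2 0, hs 2 1, ts _ 1 0, ts _ 2 0, ts _ 2 1]
  -- Swapping the two outer indices of a third derivative can unsort the two inner ones, so both
  -- symmetries are applied together until all indices are in increasing order.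
  simp only [tc 1 0, tc 2 0, tc 2 1, ts _ 1 0, ts _ 2 0, ts _ 2 1]
  constructor <;> ring

end Reduction


/-! ### The 2D conditions expressed by the minors of the 3D Hessian. -/

section Integrability

variable {𝕜 : Type*} [RCLike 𝕜] {α β γ : 𝕜} {c w : Fin 3 → 𝕜} {f : (Fin 3 → 𝕜) → 𝕜}
  {v : Fin 3 → 𝕜}

/-- A linear combination of the minors of the Hessian matrix of `f`. -/
noncomputable def minorComb (f : (Fin 3 → 𝕜) → 𝕜) (a b : Fin 3 → 𝕜) (v : Fin 3 → 𝕜) : 𝕜 :=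
  (a 0 * diagMinor f 0 v + a 1 * diagMinor f 1 v + a 2 * diagMinor f 2 v) +
    (b 0 * offMinor f 0 v + b 1 * offMinor f 1 v + b 2 * offMinor f 2 v)

theorem pd_minorComb (hf : ContDiffAt 𝕜 3 f v) (a b : Fin 3 → 𝕜) (l : Fin 3) :
    pd l (minorComb f a b) v =
      (a 0 * pd l (diagMinor f 0) v + a 1 * pd l (diagMinor f 1) v +
        a 2 * pd l (diagMinor f 2) v) +
      (b 0 * pd l (offMinor f 0) v + b 1 * pd l (offMinor f 1) v + b 2 * pd l (offMinor f 2) v) := by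
  have hm := fun i => (contDiffAt_diagMinor hf i).differentiableAt one_ne_zero
  have hn := fun i => (contDiffAt_offMinor hf i).differentiableAt one_ne_zero
  have := hm 0; have := hm 1; have := hm 2; have := hn 0; have := hn 1; have := hn 2
  unfold minorComb
  rw [pd_add (by fun_prop) (by fun_prop), pd_add (by fun_prop) (by fun_prop),
    pd_add (by fun_prop) (by fun_prop), pd_add (by fun_prop) (by fun_prop),
    pd_add (by fun_prop) (by fun_prop)]
  simp only [pd_const_mul _ (hm _), pd_const_mul _ (hn _)]

theorem differentiableAt_minorComb (hf : ContDiffAt 𝕜 3 f v) (a b : Fin 3 → 𝕜) :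
    DifferentiableAt 𝕜 (minorComb f a b) v := by
  have hm := fun i => (contDiffAt_diagMinor hf i).differentiableAt one_ne_zero
  have hn := fun i => (contDiffAt_offMinor hf i).differentiableAt one_ne_zero
  have := hm 0; have := hm 1; have := hm 2; have := hn 0; have := hn 1; have := hn 2
  unfold minorComb
  fun_prop

theorem pd_comp_minorComb (hf : ContDiffAt 𝕜 3 f (reductionMap α β γ c w)) {a b : Fin 3 → 𝕜}
    {G : (Fin 3 → 𝕜) → 𝕜} (hG : ∀ᶠ x in 𝓝 w, G x = minorComb f a b (reductionMap α β γ c x))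
    (k : Fin 3) :
    pd k G w = ∑ l, reductionMatrix α β γ k l *
      ((a 0 * pd l (diagMinor f 0) (reductionMap α β γ c w) +
        a 1 * pd l (diagMinor f 1) (reductionMap α β γ c w) +
        a 2 * pd l (diagMinor f 2) (reductionMap α β γ c w)) +
      (b 0 * pd l (offMinor f 0) (reductionMap α β γ c w) +
        b 1 * pd l (offMinor f 1) (reductionMap α β γ c w) +
        b 2 * pd l (offMinor f 2) (reductionMap α β γ c w))) := by
  rw [pd_congr hG, pd_comp_reductionMap (differentiableAt_minorComb hf a b)]
  simp only [pd_minorComb hf]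

/-- The integrability conditions of a two-dimensional reduction in terms of the derivatives of the
minors of the three-dimensional density. -/
theorem integrable2DAt_comp_reductionMap_iff
    (hf : ContDiffAt 𝕜 3 f (reductionMap α β γ c w)) {m n : Fin 3 → Fin 3 → 𝕜}
    (hm : ∀ i l, m i l = pd l (diagMinor f i) (reductionMap α β γ c w))
    (hn : ∀ i l, n i l = pd l (offMinor f i) (reductionMap α β γ c w)) :
    Integrable2DAt (fun x => f (reductionMap α β γ c x)) w ↔
      (α ^ 2 * β ^ 2 * (β * m 2 1 - γ * n 0 1) = α ^ 2 * β ^ 2 * (α * m 2 0 - γ * n 1 0) ∧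
      α ^ 2 * β ^ 3 * m 2 1 =
        α * β ^ 2 * (α ^ 2 * m 2 0 + γ ^ 2 * m 0 0 - 2 * α * γ * n 1 0) ∧
      α ^ 3 * β ^ 2 * m 2 0 =
        α ^ 2 * β * (β ^ 2 * m 2 1 + γ ^ 2 * m 1 1 - 2 * β * γ * n 0 1) ∧
      α ^ 2 * (β ^ 2 * (α * m 2 0 + β * m 2 1 + γ * m 2 2) +
        γ ^ 2 * (α * m 1 0 + β * m 1 1 + γ * m 1 2) -
        2 * β * γ * (α * n 0 0 + β * n 0 1 + γ * n 0 2)) =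
        2 * α ^ 3 * β * (β * m 2 0 - γ * n 0 0) ∧
      β ^ 2 * (α ^ 2 * (α * m 2 0 + β * m 2 1 + γ * m 2 2) +
        γ ^ 2 * (α * m 0 0 + β * m 0 1 + γ * m 0 2) -
        2 * α * γ * (α * n 1 0 + β * n 1 1 + γ * n 1 2)) =
        2 * β ^ 3 * α * (α * m 2 1 - γ * n 1 1)) := by
  have hev : ∀ᶠ x in 𝓝 w, ContDiffAt 𝕜 2 f (reductionMap α β γ c x) := by
    filter_upwards [continuous_reductionMap.continuousAt.eventually (hf.eventually (by simp))]
      with x hx using hx.of_le (by norm_num)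
  have aux : ∀ {G : (Fin 3 → 𝕜) → 𝕜} {a b : Fin 3 → 𝕜} (_ : ∀ x,
      ContDiffAt 𝕜 2 f (reductionMap α β γ c x) →
      (∀ k l, hess (fun x => f (reductionMap α β γ c x)) x k l = ∑ i, ∑ j,
        reductionMatrix α β γ k i * reductionMatrix α β γ l j *
        pd i (pd j f) (reductionMap α β γ c x)) →
      (pd 1 (pd 0 f) (reductionMap α β γ c x) = pd 0 (pd 1 f) (reductionMap α β γ c x)) →
      (pd 2 (pd 0 f) (reductionMap α β γ c x) = pd 0 (pd 2 f) (reductionMap α β γ c x)) →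
      (pd 2 (pd 1 f) (reductionMap α β γ c x) = pd 1 (pd 2 f) (reductionMap α β γ c x)) →
      G x = minorComb f a b (reductionMap α β γ c x)),
      ∀ᶠ x in 𝓝 w, G x = minorComb f a b (reductionMap α β γ c x) := fun h => by
    filter_upwards [hev] with x hx
    exact h x hx (hess_comp_reductionMap hx) (pd_pd_comm hx _ _) (pd_pd_comm hx _ _)
      (pd_pd_comm hx _ _)
  -- By Cauchy–Binet the coefficients in `a`, `b` here and below are, up to sign, products of 2×2
  -- minors of `reductionMatrix`, collected over equal minors of `F`.
  have E1 := aux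
    (G := fun x => hess (fun x => f (reductionMap α β γ c x)) x 0 1 *
        hess (fun x => f (reductionMap α β γ c x)) x 2 2 -
      hess (fun x => f (reductionMap α β γ c x)) x 0 2 *
        hess (fun x => f (reductionMap α β γ c x)) x 1 2)
    (a := ![0, 0, α ^ 2 * β ^ 2]) (b := ![-(α ^ 2 * β * γ), 0, 0])
    fun x _ hh h1 h2 h3 => by
      simp only [hh, Fin.sum_univ_three, h1, h2, h3, reductionMatrix, minorComb, diagMinor_eq,
        offMinor_eq]
      simp [h1, h2, h3]
      ring
  have E2 := aux
    (G := fun x => hess (fun x => f (reductionMap α β γ c x)) x 1 2 *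
        hess (fun x => f (reductionMap α β γ c x)) x 0 0 -
      hess (fun x => f (reductionMap α β γ c x)) x 0 1 *
        hess (fun x => f (reductionMap α β γ c x)) x 0 2)
    (a := ![0, 0, α ^ 2 * β ^ 2]) (b := ![0, -(α * β ^ 2 * γ), 0])
    fun x _ hh h1 h2 h3 => by
      simp only [hh, Fin.sum_univ_three, h1, h2, h3, reductionMatrix, minorComb, diagMinor_eq,
        offMinor_eq]
      simp [h1, h2, h3]
      ring
  have E3 := aux
    (G := fun x => hess (fun x => f (reductionMap α β γ c x)) x 0 0 *
        hess (fun x => f (reductionMap α β γ c x)) x 2 2 -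
      hess (fun x => f (reductionMap α β γ c x)) x 0 2 ^ 2)
    (a := ![0, 0, α ^ 2 * β ^ 2]) (b := ![0, 0, 0])
    fun x _ hh h1 h2 h3 => by
      simp only [hh, Fin.sum_univ_three, h1, h2, h3, reductionMatrix, minorComb, diagMinor_eq,
        offMinor_eq]
      simp [h1, h2, h3]
      ring
  have E4 := aux
    (G := fun x => hess (fun x => f (reductionMap α β γ c x)) x 0 0 *
        hess (fun x => f (reductionMap α β γ c x)) x 1 1 -
      hess (fun x => f (reductionMap α β γ c x)) x 0 1 ^ 2)
    (a := ![β ^ 2 * γ ^ 2, 0, α ^ 2 * β ^ 2]) (b := ![0, -(2 * α * β ^ 2 * γ), 0])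
    fun x _ hh h1 h2 h3 => by
      simp only [hh, Fin.sum_univ_three, h1, h2, h3, reductionMatrix, minorComb, diagMinor_eq,
        offMinor_eq]
      simp [h1, h2, h3]
      ring
  have E5 := aux
    (G := fun x => hess (fun x => f (reductionMap α β γ c x)) x 2 2 *
        hess (fun x => f (reductionMap α β γ c x)) x 1 1 -
      hess (fun x => f (reductionMap α β γ c x)) x 1 2 ^ 2)
    (a := ![0, α ^ 2 * γ ^ 2, α ^ 2 * β ^ 2]) (b := ![-(2 * α ^ 2 * β * γ), 0, 0])
    fun x _ hh h1 h2 h3 => by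
      simp only [hh, Fin.sum_univ_three, h1, h2, h3, reductionMatrix, minorComb, diagMinor_eq,
        offMinor_eq]
      simp [h1, h2, h3]
      ring
  have E4' := E4
  have E5' := E5
  simp only [mul_comm (hess (fun x => f (reductionMap α β γ c x)) _ 0 0)] at E4'
  simp only [mul_comm (hess (fun x => f (reductionMap α β γ c x)) _ 2 2)] at E5'
  have e1 := pd_comp_minorComb hf E1 0
  have e2 := pd_comp_minorComb hf E2 2
  have e3 := pd_comp_minorComb hf E3 0
  have e4 := pd_comp_minorComb hf E4 2
  have e5 := pd_comp_minorComb hf E3 2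
  have e6 := pd_comp_minorComb hf E5 0
  have e7 := pd_comp_minorComb hf E5' 1
  have e8 := pd_comp_minorComb hf E1 2
  have e9 := pd_comp_minorComb hf E4' 1
  have e10 := pd_comp_minorComb hf E2 0
  have e10' : pd 0 (fun x => hess (fun x => f (reductionMap α β γ c x)) x 1 2 *
        hess (fun x => f (reductionMap α β γ c x)) x 0 0 -
      hess (fun x => f (reductionMap α β γ c x)) x 0 2 *
        hess (fun x => f (reductionMap α β γ c x)) x 0 1) w = _ :=
    (pd_congr (Eventually.of_forall fun x => by ring) 0).trans e10
  simp only [← hm, ← hn, Fin.sum_univ_three, reductionMatrix, Matrix.cons_val] at e1 e2 e3 e4 e5 e6 e7 e8 e9 e10'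
  constructor
  · rintro ⟨h1, h2, h3, h4, h5⟩
    rw [e1, e2] at h1
    rw [e3, e4] at h2
    rw [e5, e6] at h3
    rw [e7, e8] at h4
    rw [e9, e10'] at h5
    refine ⟨?_, ?_, ?_, ?_, ?_⟩
    · linear_combination h1
    · linear_combination h2
    · linear_combination h3
    · linear_combination h4
    · linear_combination h5
  · rintro ⟨h1, h2, h3, h4, h5⟩
    refine ⟨?_, ?_, ?_, ?_, ?_⟩
    · rw [e1, e2]; linear_combination h1
    · rw [e3, e4]; linear_combination h2
    · rw [e5, e6]; linear_combination h3
    · rw [e7, e8]; linear_combination h4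
    · rw [e9, e10']; linear_combination h5

end Integrability


/-! ### Integrability is equivalent to constancy properties of the minors. -/

section Integrability

variable {𝕜 : Type*} [RCLike 𝕜] {f : (Fin 3 → 𝕜) → 𝕜} {D : Set (Fin 3 → 𝕜)}

/-- The four terms are distinct monomials in `x`, `y`; four sample points already separate them.
This is the shape of the second 2D condition for `s = (x, 1, y)` and of the third for `s = (1, x,
y)`. -/
theorem coeffs_eq_zero_of_forall {X Y Z U : 𝕜}
    (h : ∀ x y : 𝕜, x ^ 3 * y ^ 5 * X = x ^ 2 * y ^ 3 * (y ^ 2 * Y + x ^ 2 * Z - 2 * x * y * U)) :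
    X = 0 ∧ Y = 0 ∧ Z = 0 ∧ U = 0 := by
  have h1 := h 1 1
  have h2 := h (-1) 1
  have h3 := h 2 1
  have h4 := h 1 2
  norm_num at h1 h2 h3 h4
  have hYZ : Y + Z = 0 := by linear_combination (-1 / 2 : 𝕜) * h1 + (-1 / 2 : 𝕜) * h2
  have hXU : X + 2 * U = 0 := by linear_combination (1 / 2 : 𝕜) * h1 + (-1 / 2 : 𝕜) * h2
  have hZ : Z = 0 := by
    linear_combination (-1 / 3 : 𝕜) * ((1 / 4 : 𝕜) * h3 - 2 * hXU + hYZ)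
  have hY : Y = 0 := by linear_combination hYZ - hZ
  have hU : U = 0 := by
    linear_combination (-1 / 4 : 𝕜) * ((1 / 8 : 𝕜) * h4 - 4 * hXU + 4 * hY + hZ)
  exact ⟨by linear_combination hXU - 2 * hU, hY, hZ, hU⟩

/-- Again distinct monomials. This is what remains of the fourth and fifth 2D conditions after the
derivatives already known to vanish are removed. -/
theorem coeffs_eq_zero_of_forall' {A B C E : 𝕜}
    (h : ∀ x y : 𝕜, y ^ 2 * (x ^ 3 * y ^ 2 * A + x ^ 2 * y * B + x ^ 3 * C -
      2 * x ^ 3 * y * E) = 0) :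
    A = 0 ∧ B = 0 ∧ C = 0 ∧ E = 0 := by
  have h1 := h 1 1
  have h2 := h 2 1
  have h3 := h 1 (-1)
  have h4 := h 1 2
  norm_num at h1 h2 h3 h4
  have hB : B = 0 := by linear_combination 2 * h1 - (1 / 4 : 𝕜) * h2
  have hE : E = 0 := by linear_combination (1 / 4 : 𝕜) * (h3 - h1 + 2 * hB)
  have hAC : A + C = 0 := by linear_combination h1 - hB + 2 * hE
  have hA : A = 0 := by linear_combination (1 / 3 : 𝕜) * (h4 - 2 * hB + 4 * hE - hAC)
  exact ⟨hA, hB, by linear_combination hAC - hA, hE⟩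

theorem isIntegrable_iff_pd (hD : IsOpen D) (hf : ContDiffOn 𝕜 3 f D) :
    IsIntegrable D f ↔ ∀ v ∈ D, (∀ i l, pd l (diagMinor f i) v = 0) ∧
      ∀ i l, l ≠ i → pd l (offMinor f i) v = 0 := by
  constructor
  · intro h v hv
    have hfv : ContDiffAt 𝕜 3 f v := hf.contDiffAt (hD.mem_nhds hv)
    have key : ∀ s : Fin 3 → 𝕜,
        Integrable2DAt (fun x => f (reductionMap (s 1 * s 2) (s 0 * s 2) (s 0 * s 1) v x)) 0 := by
      intro s
      -- The quadratic form alone puts the arguments at `v`, with the wave part `w = 0`; hence all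
      -- `s` are available at the same point.
      have hQ : offDiag !![0, v 2, v 1; v 2, 0, v 0; v 1, v 0, 0] = v := by
        ext i; fin_cases i <;> rfl
      have := h s !![0, v 2, v 1; v 2, 0, v 0; v 1, v 0, 0]
        (by ext i j; fin_cases i <;> fin_cases j <;> rfl) 0
        (by
          change offDiag _ ∈ D
          rw [offDiag_waveHessian, hQ]
          convert hv using 1
          ext i; fin_cases i <;> simp [reductionMap])
      simpa only [offDiag_waveHessian, hQ] using this
    have h0 : ∀ α β γ : 𝕜, reductionMap α β γ v 0 = v := fun α β γ => by
      ext i; fin_cases i <;> simp [reductionMap]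
    have key2 := fun s => (integrable2DAt_comp_reductionMap_iff (by rw [h0]; exact hfv)
      (m := fun i l => pd l (diagMinor f i) v) (n := fun i l => pd l (offMinor f i) v)
      (by simp only [h0, implies_true]) (by simp only [h0, implies_true])).1 (key s)
    obtain ⟨a1, a2, a3, a4⟩ := coeffs_eq_zero_of_forall (X := pd 1 (diagMinor f 2) v)
      (Y := pd 0 (diagMinor f 2) v) (Z := pd 0 (diagMinor f 0) v) (U := pd 0 (offMinor f 1) v)
      fun x y => by
        have := (key2 ![x, 1, y]).2.1
        simp at this
        linear_combination this
    obtain ⟨b1, b2, b3, b4⟩ := coeffs_eq_zero_of_forall (X := pd 0 (diagMinor f 2) v)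
      (Y := pd 1 (diagMinor f 2) v) (Z := pd 1 (diagMinor f 1) v) (U := pd 1 (offMinor f 0) v)
      fun x y => by
        have := (key2 ![1, x, y]).2.2.1
        simp at this
        linear_combination this
    obtain ⟨c1, c2, c3, c4⟩ := coeffs_eq_zero_of_forall' (A := pd 2 (diagMinor f 2) v)
      -- The term with `pd 0 (offMinor f 0) v` is the same on both sides of the condition and
      -- cancels: integrability does not restrict `p 0'`. The next use of the lemma is the same with
      -- `x` and `y` interchanged.
      (B := pd 0 (diagMinor f 1) v) (C := pd 2 (diagMinor f 1) v) (E := pd 2 (offMinor f 0) v)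
      fun x y => by
        have := (key2 ![x, 1, y]).2.2.2.1
        simp [a1, a2, b3, b4] at this
        linear_combination this
    obtain ⟨d1, d2, d3, d4⟩ := coeffs_eq_zero_of_forall' (A := pd 2 (diagMinor f 2) v)
      (B := pd 1 (diagMinor f 0) v) (C := pd 2 (diagMinor f 0) v) (E := pd 2 (offMinor f 1) v)
      fun x y => by
        have := (key2 ![1, x, y]).2.2.2.2
        simp [a1, a2, a3, a4] at this
        linear_combination this
    -- The derivatives of `offMinor f 2` do not occur in the reduced conditions at all; the
    -- divergence identities supply them.
    obtain ⟨p1, p2⟩ := piola hfv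
    have e1 : pd 1 (offMinor f 2) v = 0 := by linear_combination p1 - a3 - d4
    have e2 : pd 0 (offMinor f 2) v = 0 := by linear_combination p2 - b3 - c4
    constructor
    · intro i l
      fin_cases i <;> fin_cases l <;> assumption
    · intro i l hl
      fin_cases i <;> fin_cases l <;> first | assumption | exact absurd rfl hl
  · intro h s Q _ w hw
    have hw' : reductionMap (s 1 * s 2) (s 0 * s 2) (s 0 * s 1) (offDiag Q) w ∈ D := by
      rw [← offDiag_waveHessian]; exact hw
    simp only [offDiag_waveHessian]
    obtain ⟨hm, hn⟩ := h _ hw'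
    rw [integrable2DAt_comp_reductionMap_iff (hf.contDiffAt (hD.mem_nhds hw'))
      (fun i l => rfl) (fun i l => rfl)]
    simp only [hm, hn 0 1 (by decide), hn 0 2 (by decide), hn 1 0 (by decide), hn 1 2 (by decide)]
    refine ⟨?_, ?_, ?_, ?_, ?_⟩ <;> ring

/-- `D` need only be open here: moving along the `l`-th axis does not change `v i`, so `offMinor f
i` is locally constant along that line. -/
theorem HasMinors.pd_eq_zero {a : Fin 3 → 𝕜} {p : Fin 3 → 𝕜 → 𝕜} (h : HasMinors D f a p)
    (hD : IsOpen D) (hf : ContDiffOn 𝕜 3 f D) {v : Fin 3 → 𝕜} (hv : v ∈ D) :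
    (∀ i l, pd l (diagMinor f i) v = 0) ∧ ∀ i l, l ≠ i → pd l (offMinor f i) v = 0 := by
  have hfv := hf.contDiffAt (hD.mem_nhds hv)
  refine ⟨fun i l => ?_, fun i l hl => ?_⟩
  · have : diagMinor f i =ᶠ[𝓝 v] fun _ => a i := by
      filter_upwards [hD.mem_nhds hv] with x hx using (h x hx i).1
    rw [pd_congr this, pd_const]
  · have hd := (contDiffAt_offMinor hfv i).differentiableAt one_ne_zero
    have h1 : HasDerivAt (fun t : 𝕜 => v + t • Pi.single l (1 : 𝕜)) (Pi.single l 1) 0 := by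
      simpa using ((hasDerivAt_id (0 : 𝕜)).smul_const (Pi.single l (1 : 𝕜))).const_add v
    have hd' : HasFDerivAt (offMinor f i) (fderiv 𝕜 (offMinor f i) v)
        (v + (0 : 𝕜) • Pi.single l (1 : 𝕜)) := by simpa using hd.hasFDerivAt
    have h2 := hd'.comp_hasDerivAt 0 h1
    have h3 : (offMinor f i ∘ fun t : 𝕜 => v + t • Pi.single l (1 : 𝕜)) =ᶠ[𝓝 0]
        fun _ => p i (v i) := by
      have hc : ContinuousAt (fun t : 𝕜 => v + t • Pi.single l (1 : 𝕜)) 0 := h1.continuousAt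
      have : ∀ᶠ t in 𝓝 (0 : 𝕜), v + t • Pi.single l (1 : 𝕜) ∈ D :=
        hc.eventually (hD.mem_nhds (by simpa using hv))
      filter_upwards [this] with t ht
      have := (h _ ht i).2
      simpa [hl.symm] using this
    exact h2.unique ((hasDerivAt_const (0 : 𝕜) (p i (v i))).congr_of_eventuallyEq h3)

theorem eq_update_of_pd_eq_zero {I : Fin 3 → Set 𝕜} (hI : ∀ i, IsOpen (I i))
    (hI' : ∀ i, IsPreconnected (I i)) {g : (Fin 3 → 𝕜) → 𝕜}
    (hg : ∀ v ∈ Set.univ.pi I, DifferentiableAt 𝕜 g v) {j : Fin 3}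
    (h : ∀ v ∈ Set.univ.pi I, pd j g v = 0) {v : Fin 3 → 𝕜} (hv : v ∈ Set.univ.pi I) {t : 𝕜}
    (ht : t ∈ I j) : g v = g (Function.update v j t) := by
  have hmem : ∀ s ∈ I j, Function.update v j s ∈ Set.univ.pi I := fun s hs => by
    rw [Set.mem_univ_pi] at hv ⊢
    intro i
    by_cases hi : i = j
    · subst hi; simpa using hs
    · simpa [hi] using hv i
  have hd : ∀ s ∈ I j, HasDerivAt (fun s => g (Function.update v j s)) 0 s := fun s hs => by
    have := (hg _ (hmem s hs)).hasFDerivAt.comp_hasDerivAt s (hasDerivAt_update v j s)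
    rwa [show fderiv 𝕜 g (Function.update v j s) (Pi.single j 1) = 0 from h _ (hmem s hs)] at this
  have := (hI j).is_const_of_deriv_eq_zero (hI' j)
    (fun s hs => (hd s hs).differentiableAt.differentiableWithinAt)
    (fun s hs => (hd s hs).deriv) (hv j trivial) ht
  simpa using this

theorem isIntegrable_iff_hasMinors {I : Fin 3 → Set 𝕜} (hI : ∀ i, IsOpen (I i))
    (hI' : ∀ i, IsPreconnected (I i)) (hf : ContDiffOn 𝕜 3 f (Set.univ.pi I)) :
    IsIntegrable (Set.univ.pi I) f ↔
      ∃ (a : Fin 3 → 𝕜) (p : Fin 3 → 𝕜 → 𝕜), HasMinors (Set.univ.pi I) f a p := by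
  have hD : IsOpen (Set.univ.pi I) := isOpen_set_pi Set.finite_univ fun i _ => hI i
  rw [isIntegrable_iff_pd hD hf]
  refine ⟨fun h => ?_, fun ⟨a, p, h⟩ v hv => h.pd_eq_zero hD hf hv⟩
  rcases (Set.univ.pi I).eq_empty_or_nonempty with he | ⟨b, hb⟩
  · exact ⟨0, 0, by simp [he, HasMinors]⟩
  have hfa := fun v hv => hf.contDiffAt (hD.mem_nhds (x := v) hv)
  have hdm := fun i v hv => (contDiffAt_diagMinor (hfa v hv) i).differentiableAt one_ne_zero
  have hdn := fun i v hv => (contDiffAt_offMinor (hfa v hv) i).differentiableAt one_ne_zero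
  -- The constants are values at a base point `b`, and `p i` is read off on the coordinate line
  -- through `b`. A general point is brought to that line by resetting its two other coordinates in
  -- turn.
  refine ⟨fun i => diagMinor f i b, fun i t => offMinor f i (Function.update b i t),
    fun v hv i => ⟨?_, ?_⟩⟩
  · refine hD.is_const_of_fderiv_eq_zero (isPreconnected_univ_pi hI')
      (fun x hx => (hdm i x hx).differentiableWithinAt) (fun x hx => ?_) hv hb
    ext1 y
    simp [fderiv_apply_eq_sum_pd, (h x hx).1]
  · have hu : ∀ u ∈ Set.univ.pi I, ∀ j, Function.update u j (b j) ∈ Set.univ.pi I :=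
      fun u hu j => by
        rw [Set.mem_univ_pi] at hu ⊢
        intro k
        by_cases hk : k = j
        · subst hk; simpa using hb k trivial
        · simpa [hk] using hu k
    have h1 : i + 1 ≠ i := by revert i; decide
    have h2 : i + 2 ≠ i := by revert i; decide
    rw [eq_update_of_pd_eq_zero hI hI' (hdn i) (fun x hx => (h x hx).2 i (i + 1) h1) hv
        (hb (i + 1) trivial),
      eq_update_of_pd_eq_zero hI hI' (hdn i) (fun x hx => (h x hx).2 i (i + 2) h2) (hu v hv _)
        (hb (i + 2) trivial)]
    congr 1
    ext k
    have : k = i ∨ k = i + 1 ∨ k = i + 2 := by revert i k; decide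
    have h3 : i + 1 ≠ i + 2 := (by decide : ∀ i : Fin 3, i + 1 ≠ i + 2) i
    rcases this with rfl | rfl | rfl <;> simp [*, h1.symm, h2.symm]

end Integrability


/-- Differentiation of `det F • F = adj (adj F)` for a symmetric matrix `F` all of whose diagonal
minors have derivative zero. -/
theorem adjugate_adjugate_deriv {K : Type*} [Field K] [CharZero K]
    {x y z p q r x' y' z' p' q' r' e₁ e₂ e₃ δ : K}
    (hδ : δ = x * y * z + 2 * p * q * r - x * p ^ 2 - y * q ^ 2 - z * r ^ 2) (h0 : δ ≠ 0)
    (m₁ : y * z' + z * y' - 2 * p * p' = 0) (m₂ : z * x' + x * z' - 2 * q * q' = 0)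
    (m₃ : x * y' + y * x' - 2 * r * r' = 0)
    (n₁ : r * q' + q * r' - (x * p' + p * x') = e₁) (n₂ : p * r' + r * p' - (y * q' + q * y') = e₂)
    (n₃ : q * p' + p * q' - (z * r' + r * z') = e₃) :
    (p * e₁ + q * e₂ + r * e₃) * x + δ * x' = -2 * (q * r - x * p) * e₁ ∧
    (p * e₁ + q * e₂ + r * e₃) * r + δ * r' =
      e₁ * (p * r - y * q) + (q * r - x * p) * e₂ - (x * y - r ^ 2) * e₃ := by
  set δ' := x' * y * z + x * y' * z + x * y * z' + 2 * (p' * q * r + p * q' * r + p * q * r') -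
    (x' * p ^ 2 + 2 * x * p * p') - (y' * q ^ 2 + 2 * y * q * q') -
    (z' * r ^ 2 + 2 * z * r * r') with hδ'
  have hd : δ' = p * e₁ + q * e₂ + r * e₃ := by
    -- `hd` is the derivative of `δ ^ 2 = det (adj F)`, divided by `2 * δ`; the derivatives of the
    -- diagonal entries of `adj F` drop out by `m₁`, `m₂`, `m₃`.
    apply mul_left_cancel₀ (mul_ne_zero two_ne_zero h0)
    rw [← n₁, ← n₂, ← n₃, hδ', hδ]
    linear_combination ((z * x - q ^ 2) * (x * y - r ^ 2) - (q * r - x * p) ^ 2) * m₁ +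
      ((x * y - r ^ 2) * (y * z - p ^ 2) - (p * r - y * q) ^ 2) * m₂ +
      ((y * z - p ^ 2) * (z * x - q ^ 2) - (p * q - z * r) ^ 2) * m₃
  rw [← hd, ← n₁, ← n₂, ← n₃, hδ', hδ]
  constructor
  · linear_combination (z * x - q ^ 2) * m₃ + (x * y - r ^ 2) * m₂
  · linear_combination -(p * q - z * r) * m₃

/-! ### The Riccati equations for the functions `p i`. -/

section Riccati

variable {𝕜 : Type*} [RCLike 𝕜] {f : (Fin 3 → 𝕜) → 𝕜} {D : Set (Fin 3 → 𝕜)} {v : Fin 3 → 𝕜}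
  {a : Fin 3 → 𝕜} {p : Fin 3 → 𝕜 → 𝕜}

theorem det_hess (hf : ContDiffAt 𝕜 2 f v) (i : Fin 3) :
    (hess f v).det = pd i (pd i f) v * pd (i + 1) (pd (i + 1) f) v * pd (i + 2) (pd (i + 2) f) v +
      2 * pd (i + 1) (pd (i + 2) f) v * pd i (pd (i + 2) f) v * pd i (pd (i + 1) f) v -
      pd i (pd i f) v * pd (i + 1) (pd (i + 2) f) v ^ 2 -
      pd (i + 1) (pd (i + 1) f) v * pd i (pd (i + 2) f) v ^ 2 -
      pd (i + 2) (pd (i + 2) f) v * pd i (pd (i + 1) f) v ^ 2 := by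
  rw [Matrix.det_fin_three]
  simp only [hess_apply, pd_pd_comm hf 1 0, pd_pd_comm hf 2 0, pd_pd_comm hf 2 1]
  fin_cases i <;> simp [pd_pd_comm hf 1 0, pd_pd_comm hf 2 0, pd_pd_comm hf 2 1] <;> ring

/-- A diagonal entry of `det F • F = adj (adj F)`. -/
theorem det_mul_pd_pd (hf : ContDiffAt 𝕜 2 f v) (i : Fin 3) :
    (hess f v).det * pd i (pd i f) v =
      diagMinor f (i + 1) v * diagMinor f (i + 2) v - offMinor f i v ^ 2 := by
  have h1 : i + 1 + 1 = i + 2 := by revert i; decide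
  have h2 : i + 1 + 2 = i := by revert i; decide
  have h3 : i + 2 + 1 = i := by revert i; decide
  have h4 : i + 2 + 2 = i + 1 := by revert i; decide
  rw [det_hess hf i, diagMinor_eq, diagMinor_eq, offMinor_eq]
  simp only [h1, h2, h3, h4, pd_pd_comm hf (i + 2) i]
  ring

theorem HasMinors.hasDerivAt (h : HasMinors D f a p) (hD : IsOpen D) (hf : ContDiffOn 𝕜 3 f D)
    (hv : v ∈ D) (i : Fin 3) : HasDerivAt (p i) (pd i (offMinor f i) v) (v i) := by
  have hfv := hf.contDiffAt (hD.mem_nhds hv)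
  have hd := (contDiffAt_offMinor hfv i).differentiableAt one_ne_zero
  have hd' : HasFDerivAt (offMinor f i) (fderiv 𝕜 (offMinor f i) v)
      (Function.update v i (v i)) := by simpa using hd.hasFDerivAt
  have h2 := hd'.comp_hasDerivAt (v i) (hasDerivAt_update v i (v i))
  refine h2.congr_of_eventuallyEq ?_
  have hc : ContinuousAt (fun t => Function.update v i t) (v i) :=
    (hasDerivAt_update v i (v i)).continuousAt
  filter_upwards [hc.eventually (hD.mem_nhds (by simpa using hv))] with t ht
  simpa using ((h _ ht i).2).symm

/-- With `j = i + 1`, `k = i + 2`: the differentiated adjugate identity gives `det F * ∂_j f_ii =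
-f_ii f_ik p_j'` and `det F * ∂_i f_ij = -f_jj f_ik p_i'`. These third derivatives are equal, so the
claim holds after multiplication by `f_ik`; comparing `∂_i f_jj` with `∂_j f_ij` gives it multiplied
by `f_jk`. Where both factors vanish on an open set, `p_i` and `p_j` are locally zero. -/
theorem HasMinors.pd_pd_mul_pd_offMinor (h : HasMinors D f a p) (hD : IsOpen D)
    (hf : ContDiffOn 𝕜 3 f D) (hdet : ∀ v ∈ D, (hess f v).det ≠ 0) (hv : v ∈ D) (i : Fin 3) :
    pd i (pd i f) v * pd (i + 1) (offMinor f (i + 1)) v =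
      pd (i + 1) (pd (i + 1) f) v * pd i (offMinor f i) v := by
  have h1 : i + 1 + 1 = i + 2 := by revert i; decide
  have h2 : i + 1 + 2 = i := by revert i; decide
  have h3 : i + 2 + 1 = i := by revert i; decide
  have h4 : i + 2 + 2 = i + 1 := by revert i; decide
  have n1 : i + 1 ≠ i := by revert i; decide
  have n2 : i + 2 ≠ i := by revert i; decide
  have n3 : i + 1 ≠ i + 2 := by revert i; decide
  have key : ∀ w ∈ D, pd i (pd (i + 2) f) w * (pd i (pd i f) w *
      pd (i + 1) (offMinor f (i + 1)) w - pd (i + 1) (pd (i + 1) f) w * pd i (offMinor f i) w) = 0 ∧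
      pd (i + 1) (pd (i + 2) f) w * (pd i (pd i f) w *
      pd (i + 1) (offMinor f (i + 1)) w -
        pd (i + 1) (pd (i + 1) f) w * pd i (offMinor f i) w) = 0 := by
    intro w hw
    have hfw := hf.contDiffAt (hD.mem_nhds hw)
    have hfw2 : ContDiffAt 𝕜 2 f w := hfw.of_le (by norm_num)
    obtain ⟨zm, zn⟩ := h.pd_eq_zero hD hf hw
    have em := fun j l => (pd_diagMinor hfw j l).symm.trans (zm j l)
    have en := fun j l => (pd_offMinor hfw j l).symm
    have hc := pd_pd_comm hfw2
    have ht := pd_pd_pd_symm hfw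
    have m1 := fun l => em i l
    have m2 := fun l => em (i + 1) l
    have m3 := fun l => em (i + 2) l
    have o1 := fun l => en i l
    have o2 := fun l => en (i + 1) l
    have o3 := fun l => en (i + 2) l
    simp only [h1, h2, h3, h4, hc (i + 1) i, hc (i + 2) i, hc (i + 2) (i + 1), ht _ (i + 1) i,
      ht _ (i + 2) i, ht _ (i + 2) (i + 1)] at m1 m2 m3 o1 o2 o3
    have hδ := det_hess hfw2 i
    have c1 := adjugate_adjugate_deriv (x := pd i (pd i f) w)
      (y := pd (i + 1) (pd (i + 1) f) w) (z := pd (i + 2) (pd (i + 2) f) w)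
      (p := pd (i + 1) (pd (i + 2) f) w) (q := pd i (pd (i + 2) f) w) (r := pd i (pd (i + 1) f) w)
      hδ (hdet w hw) (m1 i) (m2 i) (m3 i) (o1 i) (o2 i) (o3 i)
    have c2 := adjugate_adjugate_deriv (x := pd i (pd i f) w)
      (y := pd (i + 1) (pd (i + 1) f) w) (z := pd (i + 2) (pd (i + 2) f) w)
      (p := pd (i + 1) (pd (i + 2) f) w) (q := pd i (pd (i + 2) f) w) (r := pd i (pd (i + 1) f) w)
      hδ (hdet w hw) (m1 (i + 1)) (m2 (i + 1)) (m3 (i + 1)) (o1 (i + 1)) (o2 (i + 1)) (o3 (i + 1))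
    -- The lemma treats its first index specially, so the derivative of `f_jj` is obtained by
    -- applying it with `i` and `i + 1` interchanged.
    have c3 := adjugate_adjugate_deriv (x := pd (i + 1) (pd (i + 1) f) w)
      (y := pd i (pd i f) w) (z := pd (i + 2) (pd (i + 2) f) w)
      (p := pd i (pd (i + 2) f) w) (q := pd (i + 1) (pd (i + 2) f) w) (r := pd i (pd (i + 1) f) w)
      (x' := pd i (pd (i + 1) (pd (i + 1) f)) w) (y' := pd i (pd i (pd i f)) w)
      (z' := pd i (pd (i + 2) (pd (i + 2) f)) w) (p' := pd i (pd i (pd (i + 2) f)) w)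
      (q' := pd i (pd (i + 1) (pd (i + 2) f)) w) (r' := pd i (pd i (pd (i + 1) f)) w)
      (δ := (hess f w).det) (by rw [hδ]; ring) (hdet w hw) (e₁ := pd i (offMinor f (i + 1)) w)
      (e₂ := pd i (offMinor f i) w) (e₃ := pd i (offMinor f (i + 2)) w)
      (by linear_combination m2 i) (by linear_combination m1 i) (by linear_combination m3 i)
      (by linear_combination o2 i) (by linear_combination o1 i) (by linear_combination o3 i)
    rw [zn _ _ n1.symm, zn _ _ n2.symm] at c1 c3
    rw [zn _ _ n1, zn _ _ n3] at c2
    have t1 := pd_pd_pd_comm hfw (i + 1) i i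
    have t2 := pd_pd_pd_comm hfw i (i + 1) (i + 1)
    rw [ht i (i + 1) i] at t1
    rw [ht (i + 1) i (i + 1)] at t2
    constructor
    · have := c2.1
      rw [ht (i + 1) i i, t1] at this
      linear_combination this - c1.2
    · have := c3.1
      rw [t2, ht (i + 1) (i + 1) i] at this
      linear_combination c2.2 - this
  -- If the claim failed at `v`, it would fail nearby by continuity, so `f_ik` and `f_jk` would
  -- vanish near `v`, and with them both off-diagonal minors.
  by_contra hne
  have hfv := hf.contDiffAt (hD.mem_nhds hv)
  have hcont : ContinuousAt (fun w => pd i (pd i f) w * pd (i + 1) (offMinor f (i + 1)) w -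
      pd (i + 1) (pd (i + 1) f) w * pd i (offMinor f i) w) v := by
    have c1 := fun j l => (hfv.pd_pd (m := 0) (by norm_num) j l).continuousAt
    have c2 := fun j l => ((contDiffAt_offMinor hfv j).pd (m := 0) (by norm_num) l).continuousAt
    exact ((c1 _ _).mul (c2 _ _)).sub ((c1 _ _).mul (c2 _ _))
  have hev : ∀ᶠ w in 𝓝 v, pd i (pd (i + 2) f) w = 0 ∧ pd (i + 1) (pd (i + 2) f) w = 0 := by
    filter_upwards [hD.mem_nhds hv, hcont.eventually_ne (sub_ne_zero.2 hne)] with w hw hw'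
    obtain ⟨k1, k2⟩ := key w hw
    exact ⟨(mul_eq_zero.1 k1).resolve_right hw', (mul_eq_zero.1 k2).resolve_right hw'⟩
  have z1 : offMinor f i =ᶠ[𝓝 v] fun _ => 0 := by
    filter_upwards [hev] with w hw
    simp [offMinor_eq, hw.1, hw.2]
  have z2 : offMinor f (i + 1) =ᶠ[𝓝 v] fun _ => 0 := by
    filter_upwards [hev, hD.mem_nhds hv] with w hw hwD
    have := pd_pd_comm ((hf.contDiffAt (hD.mem_nhds hwD)).of_le (by norm_num)) (i + 2) i
    simp only [offMinor_eq, h1, h2, hw.1, hw.2, this]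
    ring
  exact hne (by rw [pd_congr z1, pd_congr z2, pd_const, pd_const]; ring)

theorem HasMinors.det_mul_hess_diag (h : HasMinors D f a p) (hD : IsOpen D)
    (hf : ContDiffOn 𝕜 3 f D) (hv : v ∈ D) (i : Fin 3) :
    (hess f v).det * hess f v i i = a (i + 1) * a (i + 2) - p i (v i) ^ 2 := by
  rw [hess_apply, det_mul_pd_pd ((hf.contDiffAt (hD.mem_nhds hv)).of_le (by norm_num)) i,
    (h v hv _).1, (h v hv _).1, (h v hv _).2]

/-- The preceding relation multiplied by `det F`, which turns `f_ii` into `a_j a_k - p_i ^ 2`. Each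
side is now a product of one-variable functions. -/
theorem HasMinors.riccati_comm (h : HasMinors D f a p) (hD : IsOpen D)
    (hf : ContDiffOn 𝕜 3 f D) (hdet : ∀ v ∈ D, (hess f v).det ≠ 0) (hv : v ∈ D) (i j : Fin 3) :
    (p i (v i) ^ 2 - a (i + 1) * a (i + 2)) * deriv (p j) (v j) =
      (p j (v j) ^ 2 - a (j + 1) * a (j + 2)) * deriv (p i) (v i) := by
  have succ : ∀ i, (p i (v i) ^ 2 - a (i + 1) * a (i + 2)) * deriv (p (i + 1)) (v (i + 1)) =
      (p (i + 1) (v (i + 1)) ^ 2 - a (i + 1 + 1) * a (i + 1 + 2)) * deriv (p i) (v i) := by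
    intro i
    have e := h.pd_pd_mul_pd_offMinor hD hf hdet hv i
    rw [← (h.hasDerivAt hD hf hv _).deriv, ← (h.hasDerivAt hD hf hv _).deriv] at e
    have e1 := h.det_mul_hess_diag hD hf hv i
    have e2 := h.det_mul_hess_diag hD hf hv (i + 1)
    rw [hess_apply] at e1 e2
    linear_combination -(hess f v).det * e + deriv (p (i + 1)) (v (i + 1)) * e1 -
      deriv (p i) (v i) * e2
  have : j = i ∨ j = i + 1 ∨ i = j + 1 := by revert i j; decide
  rcases this with rfl | rfl | rfl
  · rfl
  · exact succ i
  · exact (succ j).symm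

/-- Separation of variables. On a product the arguments `t` and `s` of different indices are
independent, so the ratio of `p_l'` to `p_l ^ 2 - a a` can be compared with its value at one fixed
point. -/
theorem riccati {I : Fin 3 → Set 𝕜} (hI : ∀ i, IsOpen (I i))
    (hf : ContDiffOn 𝕜 3 f (Set.univ.pi I)) (h : HasMinors (Set.univ.pi I) f a p)
    (hdet : ∀ v ∈ Set.univ.pi I, (hess f v).det ≠ 0)
    (hdiag : ∀ i j, i ≠ j → ∃ v ∈ Set.univ.pi I, hess f v i i ≠ 0 ∨ hess f v j j ≠ 0) :
    ∃ c : 𝕜, ∀ i, ∀ t ∈ I i, HasDerivAt (p i) (c * (p i t ^ 2 - a (i + 1) * a (i + 2))) t := by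
  have hD : IsOpen (Set.univ.pi I) := isOpen_set_pi Set.finite_univ fun i _ => hI i
  obtain ⟨b, hb, -⟩ := hdiag 0 1 (by decide)
  have hmem : ∀ v ∈ Set.univ.pi I, ∀ i, ∀ t ∈ I i, Function.update v i t ∈ Set.univ.pi I := by
    intro v hv i t ht k _
    by_cases hk : k = i
    · subst hk; simpa using ht
    · simpa [hk] using hv k trivial
  have hcomm : ∀ i j, i ≠ j → ∀ t ∈ I i, ∀ s ∈ I j,
      (p i t ^ 2 - a (i + 1) * a (i + 2)) * deriv (p j) s =
      (p j s ^ 2 - a (j + 1) * a (j + 2)) * deriv (p i) t := by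
    intro i j hij t ht s hs
    have := h.riccati_comm hD hf hdet (hmem _ (hmem b hb i t ht) j s hs) i j
    simpa [hij] using this
  have hS : ∀ i j, i ≠ j → (∃ t ∈ I i, p i t ^ 2 - a (i + 1) * a (i + 2) ≠ 0) ∨
      ∃ t ∈ I j, p j t ^ 2 - a (j + 1) * a (j + 2) ≠ 0 := by
    intro i j hij
    obtain ⟨v, hv, h'⟩ := hdiag i j hij
    refine h'.imp (fun h' => ⟨v i, hv i trivial, fun h0 => ?_⟩)
      (fun h' => ⟨v j, hv j trivial, fun h0 => ?_⟩)
    · have := h.det_mul_hess_diag hD hf hv i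
      exact mul_ne_zero (hdet v hv) h' (by linear_combination this - h0)
    · have := h.det_mul_hess_diag hD hf hv j
      exact mul_ne_zero (hdet v hv) h' (by linear_combination this - h0)
  -- At most one of the three functions `p_l ^ 2 - a a` vanishes identically. Two indices are
  -- needed: `i` serves to compare with all `l ≠ i`, and `j` to treat `l = i`.
  obtain ⟨i, j, hij, ⟨t, ht, hPt⟩, s, hs, hPs⟩ : ∃ i j, i ≠ j ∧
      (∃ t ∈ I i, p i t ^ 2 - a (i + 1) * a (i + 2) ≠ 0) ∧
      ∃ t ∈ I j, p j t ^ 2 - a (j + 1) * a (j + 2) ≠ 0 := by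
    rcases hS 0 1 (by decide) with h0 | h0
    · rcases hS 1 2 (by decide) with h1 | h1
      · exact ⟨0, 1, by decide, h0, h1⟩
      · exact ⟨0, 2, by decide, h0, h1⟩
    · rcases hS 0 2 (by decide) with h1 | h1
      · exact ⟨1, 0, by decide, h0, h1⟩
      · exact ⟨1, 2, by decide, h0, h1⟩
  have hc : ∀ l, l ≠ i → ∀ r ∈ I l, deriv (p l) r =
      deriv (p i) t / (p i t ^ 2 - a (i + 1) * a (i + 2)) *
        (p l r ^ 2 - a (l + 1) * a (l + 2)) := by
    intro l hl r hr
    have := hcomm i l hl.symm t ht r hr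
    field_simp
    linear_combination this
  refine ⟨deriv (p i) t / (p i t ^ 2 - a (i + 1) * a (i + 2)), fun l r hr => ?_⟩
  have hd : HasDerivAt (p l) (deriv (p l) r) r := by
    have := (h.hasDerivAt hD hf (hmem b hb l r hr) l).differentiableAt
    simpa using this.hasDerivAt
  convert hd using 1
  by_cases hl : l = i
  · subst hl
    have h1 := hcomm l j hij r hr s hs
    have h2 := hc j hij.symm s hs
    rw [h2] at h1
    apply mul_left_cancel₀ hPs
    linear_combination h1
  · exact (hc l hl r hr).symm

end Riccati


/-! ### Tools for verifying normal forms; the square root and the first arctangent density. -/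

section Realizations

variable {𝕜 : Type*} [RCLike 𝕜] {V : Set (Fin 3 → 𝕜)}

theorem forall_fin_three_of (i : Fin 3) {P : Fin 3 → Prop} (h0 : P i) (h1 : P (i + 1))
    (h2 : P (i + 2)) (l : Fin 3) : P l := by
  have : l = i ∨ l = i + 1 ∨ l = i + 2 := by clear * -; revert i l; decide
  rcases this with rfl | rfl | rfl <;> assumption

theorem fin_three_add (i : Fin 3) :
    i + 1 + 1 = i + 2 ∧ i + 1 + 2 = i ∧ i + 2 + 1 = i ∧ i + 2 + 2 = i + 1 := by
  revert i; decide

/-- `(det F) ^ 2 = det (adj F)` for a symmetric matrix with diagonal `x, y, z` and off-diagonal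
entries `p, q, r`. It lets nondegeneracy be checked on the minors. -/
theorem sq_det_of_minors {R : Type*} [CommRing R] (x y z p q r : R) :
    (x * y * z + 2 * p * q * r - x * p ^ 2 - y * q ^ 2 - z * r ^ 2) ^ 2 =
      (y * z - p ^ 2) * (z * x - q ^ 2) * (x * y - r ^ 2) +
      2 * (r * q - x * p) * (p * r - y * q) * (q * p - z * r) -
      (y * z - p ^ 2) * (r * q - x * p) ^ 2 - (z * x - q ^ 2) * (p * r - y * q) ^ 2 -
      (x * y - r ^ 2) * (q * p - z * r) ^ 2 := by
  ring

theorem contDiffOn_of_pd (hV : IsOpen V) {f : (Fin 3 → 𝕜) → 𝕜} {n : ℕ}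
    (hf : DifferentiableOn 𝕜 f V) (h : ∀ j, ContDiffOn 𝕜 n (pd j f) V) :
    ContDiffOn 𝕜 (n + 1 : ℕ) f V := by
  push_cast
  rw [contDiffOn_succ_iff_fderiv_of_isOpen hV]
  refine ⟨hf, by simp, ?_⟩
  rw [show fderiv 𝕜 f = fun v => ∑ i, pd i f v • ContinuousLinearMap.proj (R := 𝕜) i from
    funext fun v => fderiv_eq_sum_pd f v]
  exact ContDiffOn.sum fun i _ => (h i).smul contDiffOn_const

theorem contDiffOn_of_pd_eq (hV : IsOpen V) {f : (Fin 3 → 𝕜) → 𝕜} {g : Fin 3 → (Fin 3 → 𝕜) → 𝕜}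
    {n : ℕ} (hf : DifferentiableOn 𝕜 f V) (hfg : ∀ v ∈ V, ∀ j, pd j f v = g j v)
    (h : ∀ j, ContDiffOn 𝕜 n (g j) V) : ContDiffOn 𝕜 (n + 1 : ℕ) f V :=
  contDiffOn_of_pd hV hf fun j => (h j).congr fun v hv => hfg v hv j

/-- A density is identified by its first and second partial derivatives. -/
theorem realizes_of_pd (hV : IsOpen V) (i : Fin 3) {f gi gj gk : (Fin 3 → 𝕜) → 𝕜}
    {x y z p q r : (Fin 3 → 𝕜) → 𝕜} {a : Fin 3 → 𝕜} {P : Fin 3 → 𝕜 → 𝕜}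
    (hf : ContDiffOn 𝕜 3 f V) (hi : ∀ v ∈ V, pd i f v = gi v) (hj : ∀ v ∈ V, pd (i + 1) f v = gj v)
    (hk : ∀ v ∈ V, pd (i + 2) f v = gk v)
    (hii : ∀ v ∈ V, pd i gi v = x v) (hij : ∀ v ∈ V, pd i gj v = r v)
    (hik : ∀ v ∈ V, pd i gk v = q v) (hjj : ∀ v ∈ V, pd (i + 1) gj v = y v)
    (hjk : ∀ v ∈ V, pd (i + 1) gk v = p v) (hkk : ∀ v ∈ V, pd (i + 2) gk v = z v)
    (hm : ∀ v ∈ V, y v * z v - p v ^ 2 = a i ∧ z v * x v - q v ^ 2 = a (i + 1) ∧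
      x v * y v - r v ^ 2 = a (i + 2))
    (hn : ∀ v ∈ V, r v * q v - x v * p v = P i (v i) ∧
      p v * r v - y v * q v = P (i + 1) (v (i + 1)) ∧
      q v * p v - z v * r v = P (i + 2) (v (i + 2)))
    (hd : ∀ v ∈ V, x v ≠ 0 ∧ y v ≠ 0 ∧ z v ≠ 0)
    (hΔ : ∀ v ∈ V, a i * a (i + 1) * a (i + 2) +
      2 * P i (v i) * P (i + 1) (v (i + 1)) * P (i + 2) (v (i + 2)) - a i * P i (v i) ^ 2 -
      a (i + 1) * P (i + 1) (v (i + 1)) ^ 2 - a (i + 2) * P (i + 2) (v (i + 2)) ^ 2 ≠ 0) :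
    Realizes V f a P := by
  obtain ⟨h1, h2, h3, h4⟩ := fin_three_add i
  have hf2 : ∀ v ∈ V, ContDiffAt 𝕜 2 f v := fun v hv =>
    (hf.contDiffAt (hV.mem_nhds hv)).of_le (by norm_num)
  have ev : ∀ {l g}, (∀ v ∈ V, pd l f v = g v) → ∀ v ∈ V, ∀ m, pd m (pd l f) v = pd m g v :=
    fun h v hv m => pd_congr (by filter_upwards [hV.mem_nhds hv] with w hw using h w hw) m
  have hess_eq : ∀ v ∈ V, pd i (pd i f) v = x v ∧ pd i (pd (i + 1) f) v = r v ∧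
      pd i (pd (i + 2) f) v = q v ∧ pd (i + 1) (pd (i + 1) f) v = y v ∧
      pd (i + 1) (pd (i + 2) f) v = p v ∧ pd (i + 2) (pd (i + 2) f) v = z v ∧
      pd (i + 1) (pd i f) v = r v ∧ pd (i + 2) (pd i f) v = q v ∧
      pd (i + 2) (pd (i + 1) f) v = p v := by
    intro v hv
    rw [pd_pd_comm (hf2 v hv) (i + 1) i, pd_pd_comm (hf2 v hv) (i + 2) i,
      pd_pd_comm (hf2 v hv) (i + 2) (i + 1), ev hi v hv, ev hj v hv, ev hj v hv, ev hk v hv,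
      ev hk v hv, ev hk v hv]
    exact ⟨hii v hv, hij v hv, hik v hv, hjj v hv, hjk v hv, hkk v hv, hij v hv, hik v hv,
      hjk v hv⟩
  have hmin : HasMinors V f a P := by
    intro v hv
    obtain ⟨e1, e2, e3, e4, e5, e6, e7, e8, e9⟩ := hess_eq v hv
    obtain ⟨m1, m2, m3⟩ := hm v hv
    obtain ⟨n1, n2, n3⟩ := hn v hv
    refine forall_fin_three_of i ⟨?_, ?_⟩ ⟨?_, ?_⟩ ⟨?_, ?_⟩ <;>
      simp only [diagMinor_eq, offMinor_eq, h1, h2, h3, h4, e1, e2, e3, e4, e5, e6, e7, e8, e9]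
    all_goals assumption
  refine ⟨hf, (isIntegrable_iff_pd hV hf).2 fun v hv => hmin.pd_eq_zero hV hf hv, hmin,
    fun v hv h0 => hΔ v hv ?_, fun v hv => ?_⟩
  · obtain ⟨e1, e2, e3, e4, e5, e6, e7, e8, e9⟩ := hess_eq v hv
    obtain ⟨m1, m2, m3⟩ := hm v hv
    obtain ⟨n1, n2, n3⟩ := hn v hv
    rw [det_hess (hf2 v hv) i, e1, e2, e3, e4, e5, e6] at h0
    rw [← m1, ← m2, ← m3, ← n1, ← n2, ← n3, ← sq_det_of_minors, h0]
    ring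
  · obtain ⟨e1, e2, e3, e4, e5, e6, e7, e8, e9⟩ := hess_eq v hv
    obtain ⟨d1, d2, d3⟩ := hd v hv
    refine forall_fin_three_of i ?_ ?_ ?_ <;> rw [hess_apply]
    · rwa [e1]
    · rwa [e4]
    · rwa [e6]

variable {R rad X Y T Φ : (Fin 3 → 𝕜) → 𝕜}

theorem pd_of_sq_eq (hV : IsOpen V) (hR : DifferentiableOn 𝕜 R V)
    (hsq : ∀ w ∈ V, R w ^ 2 = rad w) {v : Fin 3 → 𝕜} (hv : v ∈ V) (l : Fin 3) :
    2 * R v * pd l R v = pd l rad v := by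
  rw [← pd_sq (hR.differentiableAt (hV.mem_nhds hv))]
  exact pd_congr (by filter_upwards [hV.mem_nhds hv] with w hw using hsq w hw) l

/-- Bootstrapping in `2 R dR = d rad`: if `R` is of class `C^n`, then so is `dR`. The argument is
the same over `ℝ` and `ℂ`. -/
theorem contDiffOn_of_sq_eq (hV : IsOpen V) (hR : DifferentiableOn 𝕜 R V)
    (hsq : ∀ w ∈ V, R w ^ 2 = rad w) (hne : ∀ w ∈ V, R w ≠ 0)
    (hrad : ContDiffOn 𝕜 (⊤ : ℕ∞) rad V) (n : ℕ) : ContDiffOn 𝕜 n R V := by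
  induction n with
  | zero => exact contDiffOn_zero.2 hR.continuousOn
  | succ n ih =>
    refine contDiffOn_of_pd_eq hV hR (g := fun j v => pd j rad v / (2 * R v))
      (fun v hv j => ?_) fun j => ?_
    · have := pd_of_sq_eq hV hR hsq hv j
      rw [← this]
      field_simp [hne v hv]
    · refine ContDiffOn.div (fun v hv => ?_) (contDiffOn_const.mul ih)
        fun v hv => mul_ne_zero two_ne_zero (hne v hv)
      exact ((hrad.contDiffAt (hV.mem_nhds hv)).pd (m := n) (by exact_mod_cast le_top)
        j).contDiffWithinAt

/-- `hpd` is the derivative of `arctan (Y / X)` with denominators cleared. It makes sense at `X =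
0`, and it is all that is needed to know about `T`. -/
theorem contDiffOn_of_arctan_pd (hV : IsOpen V) (hT : DifferentiableOn 𝕜 T V)
    (hne : ∀ w ∈ V, X w ^ 2 + Y w ^ 2 ≠ 0) (hpd : ∀ w ∈ V, ∀ l,
      (X w ^ 2 + Y w ^ 2) * pd l T w = X w * pd l Y w - Y w * pd l X w)
    (hX : ∀ n : ℕ, ContDiffOn 𝕜 n X V) (hY : ∀ n : ℕ, ContDiffOn 𝕜 n Y V) (n : ℕ) :
    ContDiffOn 𝕜 (n + 1 : ℕ) T V := by
  refine contDiffOn_of_pd_eq hV hT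
    (g := fun j v => (X v * pd j Y v - Y v * pd j X v) / (X v ^ 2 + Y v ^ 2))
    (fun v hv j => ?_) fun j => ?_
  · have := hpd v hv j
    rw [← this, mul_div_cancel_left₀ _ (hne v hv)]
  · have hX' : ContDiffOn 𝕜 n (pd j X) V := fun v hv =>
      (((hX (n + 1)).contDiffAt (hV.mem_nhds hv)).pd (by norm_cast) j).contDiffWithinAt
    have hY' : ContDiffOn 𝕜 n (pd j Y) V := fun v hv =>
      (((hY (n + 1)).contDiffAt (hV.mem_nhds hv)).pd (by norm_cast) j).contDiffWithinAt
    exact (((hX n).mul hY').sub ((hY n).mul hX')).div (((hX n).pow 2).add ((hY n).pow 2)) hne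

theorem contDiff_coord (i : Fin 3) {n : WithTop ℕ∞} :
    ContDiff 𝕜 n (fun w : Fin 3 → 𝕜 => w i) := contDiff_apply 𝕜 𝕜 i

/-- The gradient is `Φ / (2 w_l)`, so every second derivative is again `Φ` times a rational
function, and the minors contain `Φ` only through `Φ ^ 2 = w_0 w_1 w_2`. -/
theorem realizes_of_sqrt (hV : IsOpen V) (hΦ : DifferentiableOn 𝕜 Φ V)
    (hsq : ∀ w ∈ V, Φ w ^ 2 = w 0 * w 1 * w 2) (hne : ∀ w ∈ V, Φ w ≠ 0) :
    Realizes V Φ 0 (fun _ t => 1 / (8 * t)) := by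
  have hw : ∀ w ∈ V, w 0 ≠ 0 ∧ w 1 ≠ 0 ∧ w 2 ≠ 0 := fun w hw => by
    have := pow_ne_zero 2 (hne w hw)
    rw [hsq w hw] at this
    simpa [and_assoc] using this
  have hd : ∀ v ∈ V, DifferentiableAt 𝕜 Φ v := fun v hv => hΦ.differentiableAt (hV.mem_nhds hv)
  have hpd : ∀ v ∈ V, ∀ l, 2 * Φ v * pd l Φ v = pd l (fun w => w 0 * w 1 * w 2) v :=
    fun v hv l => pd_of_sq_eq hV hΦ hsq hv l
  have hrad : ContDiff 𝕜 (⊤ : ℕ∞) (fun w : Fin 3 → 𝕜 => w 0 * w 1 * w 2) :=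
    ((contDiff_coord 0).mul (contDiff_coord 1)).mul (contDiff_coord 2)
  have hg : ∀ l : Fin 3, ∀ v ∈ V, pd l Φ v = Φ v / (2 * v l) := by
    intro l v hv
    obtain ⟨h0, h1, h2⟩ := hw v hv
    have e := hpd v hv l
    have e2 := hsq v hv
    have e3 := hne v hv
    simp (disch := fun_prop) only [pd_mul, pd_coord] at e
    fin_cases l <;> simp at e ⊢ <;> field_simp <;> apply mul_left_cancel₀ e3
    · linear_combination v 0 * e - e2
    · linear_combination v 1 * e - e2
    · linear_combination v 2 * e - e2
  have hH : ∀ l m : Fin 3, ∀ v ∈ V, pd l (fun w => Φ w / (2 * w m)) v =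
      if m = l then -Φ v / (4 * v l ^ 2) else Φ v / (4 * v l * v m) := by
    intro l m v hv
    obtain ⟨h0, h1, h2⟩ := hw v hv
    have hm : ∀ m, v m ≠ 0 := fun m => by fin_cases m <;> assumption
    have hml := hm l
    have hmm := hm m
    rw [pd_div (hd v hv) (by fun_prop) (mul_ne_zero two_ne_zero hmm),
      pd_const_mul _ (by fun_prop), pd_coord, hg l v hv]
    split_ifs with h
    · subst h; field_simp; ring
    · field_simp; ring
  refine realizes_of_pd hV 0 (contDiffOn_of_sq_eq hV hΦ hsq hne hrad.contDiffOn 3) (hg _) (hg _)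
    (hg _) (hH _ _) (hH _ _) (hH _ _) (hH _ _) (hH _ _) (hH _ _) ?_ ?_ ?_ ?_ <;>
  · intro v hv
    obtain ⟨h0, h1, h2⟩ := hw v hv
    have e2 := hsq v hv
    have e3 := hne v hv
    simp
    try field_simp
    try norm_num [*]
    try ring

/-- The gradient is `(-2 T, R / w_j, R / w_k)`: the derivatives of `R` and `T` in direction `i`
cancel, leaving only the explicit factor in front of `T`. The Hessian is rational in `w` and `R`. -/
theorem realizes_of_arctanA (hV : IsOpen V) (i : Fin 3) (hR : DifferentiableOn 𝕜 R V)
    (hT : DifferentiableOn 𝕜 T V)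
    (hsq : ∀ w ∈ V, R w ^ 2 = w (i + 1) * w (i + 2) * (2 * w i - w (i + 1) * w (i + 2)))
    (hne : ∀ w ∈ V, R w ≠ 0) (hne' : ∀ w ∈ V, (w (i + 1) * w (i + 2)) ^ 2 + R w ^ 2 ≠ 0)
    (hpd : ∀ w ∈ V, ∀ l, ((w (i + 1) * w (i + 2)) ^ 2 + R w ^ 2) * pd l T w =
      w (i + 1) * w (i + 2) * pd l R w - R w * pd l (fun w => w (i + 1) * w (i + 2)) w)
    (hΦ : ∀ w ∈ V, Φ w = R w - 2 * w i * T w) :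
    Realizes V Φ (Pi.single i 1) (fun _ t => 1 / t) := by
  have hw : ∀ w ∈ V, w i ≠ 0 ∧ w (i + 1) ≠ 0 ∧ w (i + 2) ≠ 0 ∧
      2 * w i - w (i + 1) * w (i + 2) ≠ 0 := fun w hw => by
    have h1 := pow_ne_zero 2 (hne w hw)
    have h2 := hne' w hw
    rw [hsq w hw] at h1 h2
    -- This is the quantity in `hne'`, since `(w_j w_k) ^ 2 + R ^ 2 = 2 w_i w_j w_k`. Regularity of
    -- the arctangent thus excludes `w_i = 0`.
    have h3 : w (i + 1) * w (i + 2) * (2 * w i) ≠ 0 := by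
      intro h; apply h2; linear_combination h
    simp only [ne_eq, mul_eq_zero, not_or] at h1 h3
    tauto
  have hRd : ∀ v ∈ V, DifferentiableAt 𝕜 R v := fun v hv => hR.differentiableAt (hV.mem_nhds hv)
  have hTd : ∀ v ∈ V, DifferentiableAt 𝕜 T v := fun v hv => hT.differentiableAt (hV.mem_nhds hv)
  have hX : ContDiff 𝕜 (⊤ : ℕ∞) (fun w : Fin 3 → 𝕜 => w (i + 1) * w (i + 2)) :=
    (contDiff_coord _).mul (contDiff_coord _)
  have hrad : ContDiff 𝕜 (⊤ : ℕ∞)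
      (fun w : Fin 3 → 𝕜 => w (i + 1) * w (i + 2) * (2 * w i - w (i + 1) * w (i + 2))) :=
    hX.mul ((contDiff_const.mul (contDiff_coord i)).sub hX)
  have hRc := contDiffOn_of_sq_eq hV hR hsq hne hrad.contDiffOn
  have hTc := contDiffOn_of_arctan_pd hV hT hne' hpd
    (fun n => (hX.of_le (by exact_mod_cast le_top)).contDiffOn) hRc
  have hR' : ∀ v ∈ V, R v * pd i R v = v (i + 1) * v (i + 2) ∧
      R v * pd (i + 1) R v = v (i + 2) * (v i - v (i + 1) * v (i + 2)) ∧
      R v * pd (i + 2) R v = v (i + 1) * (v i - v (i + 1) * v (i + 2)) := by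
    intro v hv
    have e := pd_of_sq_eq hV hR hsq hv
    simp (disch := fun_prop) only [pd_mul, pd_sub, pd_const, pd_coord] at e
    have e0 := e i
    have e1 := e (i + 1)
    have e2 := e (i + 2)
    simp at e0 e1 e2
    refine ⟨?_, ?_, ?_⟩
    · linear_combination (1 / 2 : 𝕜) * e0
    · linear_combination (1 / 2 : 𝕜) * e1
    · linear_combination (1 / 2 : 𝕜) * e2
  have hT' : ∀ v ∈ V, 2 * v i * R v * pd i T v = v (i + 1) * v (i + 2) ∧
      2 * v i * v (i + 1) * pd (i + 1) T v = v (i + 1) * pd (i + 1) R v - R v ∧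
      2 * v i * v (i + 2) * pd (i + 2) T v = v (i + 2) * pd (i + 2) R v - R v := by
    intro v hv
    obtain ⟨h0, h1, h2, h3⟩ := hw v hv
    have e := hpd v hv
    simp (disch := fun_prop) only [pd_mul, pd_coord] at e
    have e0 := e i
    have e1 := e (i + 1)
    have e2 := e (i + 2)
    simp only [hsq v hv] at e0 e1 e2
    simp at e0 e1 e2
    refine ⟨?_, ?_, ?_⟩
    · apply mul_left_cancel₀ (mul_ne_zero h1 h2)
      linear_combination R v * e0 + v (i + 1) * v (i + 2) * (hR' v hv).1
    · apply mul_left_cancel₀ h2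
      linear_combination e1
    · apply mul_left_cancel₀ h1
      linear_combination e2
  have hΦ' : ∀ v ∈ V, ∀ l, pd l Φ v =
      pd l R v - (2 * v i * pd l T v + T v * (2 * if i = l then 1 else 0)) := by
    intro v hv l
    have := hRd v hv
    have := hTd v hv
    rw [pd_congr (by filter_upwards [hV.mem_nhds hv] with w hw using hΦ w hw) l,
      pd_sub (by fun_prop) (by fun_prop), pd_mul (by fun_prop) (by fun_prop),
      pd_const_mul _ (by fun_prop), pd_coord]
  have hΦc : ContDiffOn 𝕜 3 Φ V := by
    refine ContDiffOn.congr ?_ hΦ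
    exact (hRc 3).sub ((contDiffOn_const.mul (contDiff_coord i).contDiffOn).mul (hTc 2))
  have hdiv : ∀ v ∈ V, ∀ l m, v m ≠ 0 → pd l (fun w => R w / w m) v =
      (pd l R v * v m - R v * if m = l then 1 else 0) / v m ^ 2 := by
    intro v hv l m hm
    rw [pd_div (hRd v hv) (by fun_prop) hm, pd_coord]
  refine realizes_of_pd hV i hΦc (gi := fun v => -2 * T v) (gj := fun v => R v / v (i + 1))
    (gk := fun v => R v / v (i + 2)) (x := fun v => -(v (i + 1) * v (i + 2)) / (v i * R v))
    (r := fun v => v (i + 2) / R v) (q := fun v => v (i + 1) / R v)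
    (y := fun v => -(v i * v (i + 2)) / (R v * v (i + 1)))
    (p := fun v => (v i - v (i + 1) * v (i + 2)) / R v)
    (z := fun v => -(v i * v (i + 1)) / (R v * v (i + 2))) ?_ ?_ ?_ ?_ ?_ ?_ ?_ ?_ ?_ ?_ ?_ ?_ ?_ <;>
  intro v hv <;>
  obtain ⟨h0, h1, h2, h3⟩ := hw v hv <;>
  obtain ⟨r0, r1, r2⟩ := hR' v hv <;>
  obtain ⟨t0, t1, t2⟩ := hT' v hv <;>
  have hR0 := hne v hv <;>
  have e2 := hsq v hv
  · rw [hΦ' v hv]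
    apply mul_left_cancel₀ hR0
    simp
    linear_combination r0 - t0
  · rw [hΦ' v hv]
    simp
    field_simp
    linear_combination -t1
  · rw [hΦ' v hv]
    simp
    field_simp
    linear_combination -t2
  · rw [pd_const_mul _ (hTd v hv)]
    field_simp
    linear_combination -t0
  · rw [hdiv v hv _ _ h1]
    simp
    field_simp
    linear_combination r0
  · rw [hdiv v hv _ _ h2]
    simp
    field_simp
    linear_combination r0
  · rw [hdiv v hv _ _ h1]
    simp
    field_simp
    linear_combination v (i + 1) * r1 - e2
  · rw [hdiv v hv _ _ h2]
    simp
    field_simp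
    linear_combination r1
  · rw [hdiv v hv _ _ h2]
    simp
    field_simp
    linear_combination v (i + 2) * r2 - e2
  · simp
    refine ⟨?_, ?_, ?_⟩ <;> field_simp
    · linear_combination -e2
    · ring
    · ring
  · refine ⟨?_, ?_, ?_⟩ <;> field_simp
    · linear_combination -e2
    · linear_combination -e2
    · linear_combination -e2
  · simp [h0, h1, h2, hR0]
  · simp
    field_simp
    intro h
    apply h3
    linear_combination h

end Realizations


/-! ### The second arctangent density and the Hessian of the generic density. -/

section Realizations

variable {𝕜 : Type*} [RCLike 𝕜] {V : Set (Fin 3 → 𝕜)} {S T₁ T₂ R Φ : (Fin 3 → 𝕜) → 𝕜}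

/-- The gradient is `(S, T₁ - T₂, -T₁ - T₂)`, with entries in the order `i, j, k`. Of `coth` only
the equation `cth' = 1 - cth ^ 2` matters. The two regularity conditions exclude `cth = 1` and `cth
= -1`, because `(w_j ∓ w_k) ^ 2 + S ^ 2 = 2 w_j w_k (cth ∓ 1)`. -/
theorem realizes_of_arctanB (hV : IsOpen V) (i : Fin 3) {cth : 𝕜 → 𝕜}
    (hc : ∀ w ∈ V, HasDerivAt cth (1 - cth (w i) ^ 2) (w i))
    (hcs : ContDiffOn 𝕜 (⊤ : ℕ∞) (fun w : Fin 3 → 𝕜 => cth (w i)) V)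
    (hS : DifferentiableOn 𝕜 S V) (hT₁ : DifferentiableOn 𝕜 T₁ V) (hT₂ : DifferentiableOn 𝕜 T₂ V)
    (hsq : ∀ w ∈ V, S w ^ 2 = 2 * w (i + 1) * w (i + 2) * cth (w i) - w (i + 1) ^ 2
      - w (i + 2) ^ 2)
    (hne : ∀ w ∈ V, S w ≠ 0) (hne₁ : ∀ w ∈ V, (w (i + 1) - w (i + 2)) ^ 2 + S w ^ 2 ≠ 0)
    (hne₂ : ∀ w ∈ V, (w (i + 1) + w (i + 2)) ^ 2 + S w ^ 2 ≠ 0)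
    (hpd₁ : ∀ w ∈ V, ∀ l, ((w (i + 1) - w (i + 2)) ^ 2 + S w ^ 2) * pd l T₁ w =
      (w (i + 1) - w (i + 2)) * pd l S w - S w * pd l (fun w => w (i + 1) - w (i + 2)) w)
    (hpd₂ : ∀ w ∈ V, ∀ l, ((w (i + 1) + w (i + 2)) ^ 2 + S w ^ 2) * pd l T₂ w =
      (w (i + 1) + w (i + 2)) * pd l S w - S w * pd l (fun w => w (i + 1) + w (i + 2)) w)
    (hΦ : ∀ w ∈ V, Φ w = (w (i + 1) - w (i + 2)) * T₁ w - (w (i + 1) + w (i + 2)) * T₂ w) :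
    Realizes V Φ (1 - Pi.single i 1) (fun j t => if j = i then cth t else 1 / t) := by
  have hw : ∀ w ∈ V, w (i + 1) ≠ 0 ∧ w (i + 2) ≠ 0 ∧ cth (w i) - 1 ≠ 0 ∧ cth (w i) + 1 ≠ 0 :=
    fun w hw => by
    have h1 := hne₁ w hw
    have h2 := hne₂ w hw
    rw [hsq w hw] at h1 h2
    have h3 : w (i + 1) * w (i + 2) * (cth (w i) - 1) ≠ 0 := by
      intro h; apply h1; linear_combination 2 * h
    have h4 : w (i + 1) * w (i + 2) * (cth (w i) + 1) ≠ 0 := by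
      intro h; apply h2; linear_combination 2 * h
    simp only [ne_eq, mul_eq_zero, not_or] at h3 h4
    tauto
  have hSd : ∀ v ∈ V, DifferentiableAt 𝕜 S v := fun v hv => hS.differentiableAt (hV.mem_nhds hv)
  have hd₁ : ∀ v ∈ V, DifferentiableAt 𝕜 T₁ v := fun v hv =>
    hT₁.differentiableAt (hV.mem_nhds hv)
  have hd₂ : ∀ v ∈ V, DifferentiableAt 𝕜 T₂ v := fun v hv =>
    hT₂.differentiableAt (hV.mem_nhds hv)
  have hX₁ : ContDiff 𝕜 (⊤ : ℕ∞) (fun w : Fin 3 → 𝕜 => w (i + 1) - w (i + 2)) :=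
    (contDiff_coord _).sub (contDiff_coord _)
  have hX₂ : ContDiff 𝕜 (⊤ : ℕ∞) (fun w : Fin 3 → 𝕜 => w (i + 1) + w (i + 2)) :=
    (contDiff_coord _).add (contDiff_coord _)
  have hrad : ContDiffOn 𝕜 (⊤ : ℕ∞) (fun w : Fin 3 → 𝕜 =>
      2 * w (i + 1) * w (i + 2) * cth (w i) - w (i + 1) ^ 2 - w (i + 2) ^ 2) V :=
    ((((contDiff_const.mul (contDiff_coord _)).mul (contDiff_coord _)).contDiffOn.mul hcs).sub
      ((contDiff_coord _).pow 2).contDiffOn).sub ((contDiff_coord _).pow 2).contDiffOn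
  have hSc := contDiffOn_of_sq_eq hV hS hsq hne hrad
  have hTc₁ := contDiffOn_of_arctan_pd hV hT₁ hne₁ hpd₁
    (fun n => (hX₁.of_le (by exact_mod_cast le_top)).contDiffOn) hSc
  have hTc₂ := contDiffOn_of_arctan_pd hV hT₂ hne₂ hpd₂
    (fun n => (hX₂.of_le (by exact_mod_cast le_top)).contDiffOn) hSc
  have hS' : ∀ v ∈ V,
      S v * pd i S v = v (i + 1) * v (i + 2) * (1 - cth (v i) ^ 2) ∧
      S v * pd (i + 1) S v = v (i + 2) * cth (v i) - v (i + 1) ∧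
      S v * pd (i + 2) S v = v (i + 1) * cth (v i) - v (i + 2) := by
    intro v hv
    have e := pd_of_sq_eq hV hS hsq hv
    have hcd : DifferentiableAt 𝕜 (fun w : Fin 3 → 𝕜 => cth (w i)) v :=
      (hc v hv).differentiableAt.comp (f := fun w : Fin 3 → 𝕜 => w i) v (by fun_prop)
    have hcp : ∀ l, pd l (fun w : Fin 3 → 𝕜 => cth (w i)) v =
        (1 - cth (v i) ^ 2) * if i = l then 1 else 0 := fun l => by
      rw [pd_scomp (f := fun w : Fin 3 → 𝕜 => w i) (hc v hv) (by fun_prop), pd_coord]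
    have hm : DifferentiableAt 𝕜 (fun w : Fin 3 → 𝕜 => 2 * w (i + 1) * w (i + 2)) v := by fun_prop
    have hr := fun l => pd_sub (((hm.fun_mul hcd).fun_sub (by fun_prop :
      DifferentiableAt 𝕜 (fun w : Fin 3 → 𝕜 => w (i + 1) ^ 2) v))) (by fun_prop :
      DifferentiableAt 𝕜 (fun w : Fin 3 → 𝕜 => w (i + 2) ^ 2) v) l
    have hr' := fun l => pd_sub (hm.fun_mul hcd) (by fun_prop :
      DifferentiableAt 𝕜 (fun w : Fin 3 → 𝕜 => w (i + 1) ^ 2) v) l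
    simp only [hr, hr', pd_mul hm hcd, hcp] at e
    simp (disch := fun_prop) only [pd_mul, pd_const, pd_coord, pd_sq] at e
    have e0 := e i
    have e1 := e (i + 1)
    have e2 := e (i + 2)
    simp at e0 e1 e2
    refine ⟨?_, ?_, ?_⟩
    · linear_combination (1 / 2 : 𝕜) * e0
    · linear_combination (1 / 2 : 𝕜) * e1
    · linear_combination (1 / 2 : 𝕜) * e2
  have hT₁' : ∀ v ∈ V,
      2 * S v * pd i T₁ v = -(v (i + 1) - v (i + 2)) * (1 + cth (v i)) ∧
      2 * v (i + 1) * S v * pd (i + 1) T₁ v = -(v (i + 1) + v (i + 2)) ∧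
      2 * v (i + 2) * S v * pd (i + 2) T₁ v = v (i + 1) + v (i + 2) := by
    intro v hv
    obtain ⟨h1, h2, h3, h4⟩ := hw v hv
    obtain ⟨s0, s1, s2⟩ := hS' v hv
    have hs := hsq v hv
    have e := hpd₁ v hv
    simp (disch := fun_prop) only [pd_sub, pd_coord] at e
    have e0 := e i
    have e1 := e (i + 1)
    have e2 := e (i + 2)
    simp at e0 e1 e2
    refine ⟨?_, ?_, ?_⟩ <;> apply mul_left_cancel₀ h3
    · apply mul_left_cancel₀ (mul_ne_zero h1 h2)
      linear_combination S v * e0 + (v (i + 1) - v (i + 2)) * s0 - S v * pd i T₁ v * hs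
    · apply mul_left_cancel₀ h2
      linear_combination S v * e1 + (v (i + 1) - v (i + 2)) * s1 - hs -
        S v * pd (i + 1) T₁ v * hs
    · apply mul_left_cancel₀ h1
      linear_combination S v * e2 + (v (i + 1) - v (i + 2)) * s2 + hs -
        S v * pd (i + 2) T₁ v * hs
  have hT₂' : ∀ v ∈ V,
      2 * S v * pd i T₂ v = (v (i + 1) + v (i + 2)) * (1 - cth (v i)) ∧
      2 * v (i + 1) * S v * pd (i + 1) T₂ v = -(v (i + 1) - v (i + 2)) ∧
      2 * v (i + 2) * S v * pd (i + 2) T₂ v = v (i + 1) - v (i + 2) := by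
    intro v hv
    obtain ⟨h1, h2, h3, h4⟩ := hw v hv
    obtain ⟨s0, s1, s2⟩ := hS' v hv
    have hs := hsq v hv
    have e := hpd₂ v hv
    simp (disch := fun_prop) only [pd_add, pd_coord] at e
    have e0 := e i
    have e1 := e (i + 1)
    have e2 := e (i + 2)
    simp at e0 e1 e2
    refine ⟨?_, ?_, ?_⟩ <;> apply mul_left_cancel₀ h4
    · apply mul_left_cancel₀ (mul_ne_zero h1 h2)
      linear_combination S v * e0 + (v (i + 1) + v (i + 2)) * s0 - S v * pd i T₂ v * hs
    · apply mul_left_cancel₀ h2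
      linear_combination S v * e1 + (v (i + 1) + v (i + 2)) * s1 - hs -
        S v * pd (i + 1) T₂ v * hs
    · apply mul_left_cancel₀ h1
      linear_combination S v * e2 + (v (i + 1) + v (i + 2)) * s2 - hs -
        S v * pd (i + 2) T₂ v * hs
  have hΦ' : ∀ v ∈ V, ∀ l, pd l Φ v =
      ((v (i + 1) - v (i + 2)) * pd l T₁ v +
        T₁ v * ((if i + 1 = l then 1 else 0) - if i + 2 = l then 1 else 0)) -
      ((v (i + 1) + v (i + 2)) * pd l T₂ v +
        T₂ v * ((if i + 1 = l then 1 else 0) + if i + 2 = l then 1 else 0)) := by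
    intro v hv l
    have := hd₁ v hv
    have := hd₂ v hv
    rw [pd_congr (by filter_upwards [hV.mem_nhds hv] with w hw using hΦ w hw) l]
    simp (disch := fun_prop) only [pd_mul, pd_sub, pd_add, pd_coord]
  have hΦc : ContDiffOn 𝕜 3 Φ V := by
    refine ContDiffOn.congr ?_ hΦ
    exact (((contDiff_coord _).sub (contDiff_coord _)).contDiffOn.mul (hTc₁ 2)).sub
      (((contDiff_coord _).add (contDiff_coord _)).contDiffOn.mul (hTc₂ 2))
  have hg : ∀ v ∈ V, ∀ l, pd l (fun w => T₁ w - T₂ w) v = pd l T₁ v - pd l T₂ v :=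
    fun v hv l => pd_sub (hd₁ v hv) (hd₂ v hv) l
  have hg' : ∀ v ∈ V, ∀ l, pd l (fun w => -1 * T₁ w - T₂ w) v = -1 * pd l T₁ v - pd l T₂ v :=
    fun v hv l => by
      rw [pd_sub ((hd₁ v hv).const_mul _) (hd₂ v hv) l, pd_const_mul _ (hd₁ v hv)]
  refine realizes_of_pd hV i hΦc (gi := S) (gj := fun v => T₁ v - T₂ v)
    (gk := fun v => -1 * T₁ v - T₂ v)
    (x := fun v => v (i + 1) * v (i + 2) * (1 - cth (v i) ^ 2) / S v)
    (r := fun v => (v (i + 2) * cth (v i) - v (i + 1)) / S v)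
    (q := fun v => (v (i + 1) * cth (v i) - v (i + 2)) / S v)
    (y := fun v => -v (i + 2) / (v (i + 1) * S v)) (p := fun v => 1 / S v)
    (z := fun v => -v (i + 1) / (v (i + 2) * S v)) ?_ ?_ ?_ ?_ ?_ ?_ ?_ ?_ ?_ ?_ ?_ ?_ ?_ <;>
  intro v hv <;>
  obtain ⟨h1, h2, h3, h4⟩ := hw v hv <;>
  obtain ⟨s0, s1, s2⟩ := hS' v hv <;>
  obtain ⟨t0, t1, t2⟩ := hT₁' v hv <;>
  obtain ⟨u0, u1, u2⟩ := hT₂' v hv <;>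
  have hS0 := hne v hv <;>
  have hs := hsq v hv
  · rw [hΦ' v hv]
    have h5 : (i + 1 = i) = False := by simp
    have h6 : (i + 2 = i) = False := by simp
    apply mul_left_cancel₀ (mul_ne_zero two_ne_zero hS0)
    simp only [h5, h6, if_false]
    linear_combination (v (i + 1) - v (i + 2)) * t0 - (v (i + 1) + v (i + 2)) * u0 - 2 * hs
  · rw [hΦ' v hv]
    have : (i + 2 = i + 1) = False := by simp
    apply mul_left_cancel₀ (mul_ne_zero (mul_ne_zero two_ne_zero h1) hS0)
    simp only [this, if_true, if_false]
    linear_combination (v (i + 1) - v (i + 2)) * t1 - (v (i + 1) + v (i + 2)) * u1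
  · rw [hΦ' v hv]
    have : (i + 1 = i + 2) = False := by simp
    apply mul_left_cancel₀ (mul_ne_zero (mul_ne_zero two_ne_zero h2) hS0)
    simp only [this, if_true, if_false]
    linear_combination (v (i + 1) - v (i + 2)) * t2 - (v (i + 1) + v (i + 2)) * u2
  · field_simp
    linear_combination s0
  · rw [hg v hv]
    field_simp
    linear_combination (1 / 2 : 𝕜) * t0 - (1 / 2 : 𝕜) * u0
  · rw [hg' v hv]
    field_simp
    linear_combination -(1 / 2 : 𝕜) * t0 - (1 / 2 : 𝕜) * u0
  · rw [hg v hv]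
    field_simp
    linear_combination (1 / 2 : 𝕜) * t1 - (1 / 2 : 𝕜) * u1
  · rw [hg' v hv]
    rw [eq_div_iff hS0]
    apply mul_left_cancel₀ (mul_ne_zero two_ne_zero h1)
    linear_combination -t1 - u1
  · rw [hg' v hv]
    field_simp
    linear_combination -(1 / 2 : 𝕜) * t2 - (1 / 2 : 𝕜) * u2
  · simp
    refine ⟨?_, ?_, ?_⟩ <;> field_simp
    · ring
    · linear_combination -hs
    · linear_combination -hs
  · simp
    refine ⟨?_, ?_, ?_⟩ <;> field_simp
    · linear_combination -cth (v i) * hs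
    · linear_combination -hs
    · linear_combination -hs
  · have h5 : 1 - cth (v i) ^ 2 ≠ 0 := by
      rw [show 1 - cth (v i) ^ 2 = -((cth (v i) - 1) * (cth (v i) + 1)) by ring]
      exact neg_ne_zero.2 (mul_ne_zero h3 h4)
    simp [h1, h2, hS0, h5]
  · simp
    have h5 := pow_ne_zero 2 hS0
    rw [hs] at h5
    field_simp
    intro h
    apply h5
    linear_combination h

/-- Let `M` be the symmetric matrix with unit diagonal and `th (w_k)` at place `(i, j)`. Then `det M
= R ^ 2` and the Hessian is `adj M / R`, whose adjugate is `M` itself. The functions `G l` are the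
components of the gradient. -/
theorem realizes_of_angles (hV : IsOpen V) {th : 𝕜 → 𝕜} {G : Fin 3 → (Fin 3 → 𝕜) → 𝕜}
    (hts : ∀ l, ContDiffOn 𝕜 (⊤ : ℕ∞) (fun w : Fin 3 → 𝕜 => th (w l)) V)
    (ht : ∀ w ∈ V, ∀ l, th (w l) ^ 2 ≠ 1) (hR : DifferentiableOn 𝕜 R V)
    (hne : ∀ w ∈ V, R w ≠ 0)
    (hsq : ∀ w ∈ V, R w ^ 2 = 1 - ∑ l, th (w l) ^ 2 + 2 * ∏ l, th (w l))
    (hΦ : DifferentiableOn 𝕜 Φ V) (hΦG : ∀ w ∈ V, ∀ l, pd l Φ w = G l w)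
    (hG : ∀ l, DifferentiableOn 𝕜 (G l) V)
    (h0 : ∀ w ∈ V, ∀ l, pd l (G l) w = (1 - th (w l) ^ 2) / R w)
    (h1 : ∀ w ∈ V, ∀ l, pd l (G (l + 1)) w =
      (th (w l) * th (w (l + 1)) - th (w (l + 2))) / R w)
    (h2 : ∀ w ∈ V, ∀ l, pd l (G (l + 2)) w =
      (th (w l) * th (w (l + 2)) - th (w (l + 1))) / R w) :
    Realizes V Φ 1 (fun _ => th) := by
  have hrad : ContDiffOn 𝕜 (⊤ : ℕ∞)
      (fun w : Fin 3 → 𝕜 => 1 - ∑ l, th (w l) ^ 2 + 2 * ∏ l, th (w l)) V :=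
    (contDiffOn_const.sub (ContDiffOn.sum fun l _ => (hts l).pow 2)).add
      (contDiffOn_const.mul (contDiffOn_prod fun l _ => hts l))
  have hRc := contDiffOn_of_sq_eq hV hR hsq hne hrad
  have hts' : ∀ (n : ℕ) l, ContDiffOn 𝕜 n (fun w : Fin 3 → 𝕜 => th (w l)) V :=
    fun n l => (hts l).of_le (by exact_mod_cast le_top)
  have hGc : ∀ l, ContDiffOn 𝕜 (1 + 1 : ℕ) (G l) V := by
    intro l
    refine contDiffOn_of_pd hV (hG l) (forall_fin_three_of l ?_ ?_ ?_)
    · exact ((contDiffOn_const.sub ((hts' 1 l).pow 2)).div (hRc 1) hne).congr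
        fun w hw => h0 w hw l
    · obtain ⟨e'', e', -, -⟩ := fin_three_add l
      refine ((((hts' 1 (l + 1)).mul (hts' 1 l)).sub (hts' 1 (l + 2))).div (hRc 1) hne).congr
        fun w hw => ?_
      have := h2 w hw (l + 1)
      rwa [e', e''] at this
    · obtain ⟨-, -, e, e'⟩ := fin_three_add l
      refine ((((hts' 1 (l + 2)).mul (hts' 1 l)).sub (hts' 1 (l + 1))).div (hRc 1) hne).congr
        fun w hw => ?_
      have := h1 w hw (l + 2)
      rwa [e, e'] at this
  have hΦc : ContDiffOn 𝕜 (2 + 1 : ℕ) Φ V := contDiffOn_of_pd_eq hV hΦ hΦG hGc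
  refine realizes_of_pd hV 0 hΦc (fun v hv => hΦG v hv _) (fun v hv => hΦG v hv _)
    (fun v hv => hΦG v hv _) (fun v hv => h0 v hv _) (fun v hv => h1 v hv _)
    (fun v hv => h2 v hv _) (fun v hv => h0 v hv _) (fun v hv => h1 v hv (0 + 1))
    (fun v hv => h0 v hv _) ?_ ?_ ?_ ?_ <;>
  intro v hv <;>
  have hR0 := hne v hv <;>
  have hs := hsq v hv <;>
  simp [Fin.sum_univ_three, Fin.prod_univ_three] at hs ⊢
  · refine ⟨?_, ?_, ?_⟩ <;> field_simp <;> linear_combination -hs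
  · refine ⟨?_, ?_, ?_⟩ <;> field_simp
    · linear_combination -th (v 0) * hs
    · linear_combination -th (v 1) * hs
    · linear_combination -th (v 2) * hs
  · have := fun l => sub_ne_zero.2 (ht v hv l).symm
    exact ⟨⟨this 0, hR0⟩, ⟨this 1, hR0⟩, this 2, hR0⟩
  · have h5 := pow_ne_zero 2 hR0
    rw [hs] at h5
    intro h
    apply h5
    linear_combination h

end Realizations


/-! ### The gradient of the generic density. -/

section Trigonometric

variable {𝕜 : Type*} [RCLike 𝕜] {V : Set (Fin 3 → 𝕜)} {R Φ : (Fin 3 → 𝕜) → 𝕜}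

/-- Differentiation of the first spherical cosine law. -/
theorem pd_angle {ch sh th sn cs : 𝕜 → 𝕜} {A : (Fin 3 → 𝕜) → 𝕜} {i : Fin 3} {v : Fin 3 → 𝕜} {ρ : 𝕜}
    (hch : ∀ l, HasDerivAt ch (sh (v l)) (v l)) (hsh : ∀ l, HasDerivAt sh (ch (v l)) (v l))
    (hth : ∀ l, HasDerivAt th (1 - th (v l) ^ 2) (v l)) (hcs : HasDerivAt cs (-sn (A v)) (A v))
    (htc : ∀ l, th (v l) * ch (v l) = sh (v l)) (hc0 : ∀ l, ch (v l) ≠ 0) (hρ : ρ ≠ 0)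
    (hA : DifferentiableAt 𝕜 A v) (hcos : ∀ᶠ w in 𝓝 v, cs (A w) =
      ch (w (i + 1)) * ch (w (i + 2)) * th (w i) - sh (w (i + 1)) * sh (w (i + 2)))
    (hsin : sn (A v) = ρ * ch (v (i + 1)) * ch (v (i + 2))) :
    -pd i A v = (1 - th (v i) ^ 2) / ρ ∧
    -pd (i + 1) A v = (th (v (i + 1)) * th (v i) - th (v (i + 2))) / ρ ∧
    -pd (i + 2) A v = (th (v (i + 2)) * th (v i) - th (v (i + 1))) / ρ := by
  have hd : ∀ {φ : 𝕜 → 𝕜} {φ' : Fin 3 → 𝕜}, (∀ l, HasDerivAt φ (φ' l) (v l)) → ∀ m,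
      DifferentiableAt 𝕜 (fun w : Fin 3 → 𝕜 => φ (w m)) v ∧ ∀ l,
      pd l (fun w : Fin 3 → 𝕜 => φ (w m)) v = φ' m * if m = l then 1 else 0 := fun h m =>
    ⟨(h m).differentiableAt.comp (f := fun w : Fin 3 → 𝕜 => w m) v (by fun_prop), fun l => by
      rw [pd_scomp (f := fun w : Fin 3 → 𝕜 => w m) (h m) (by fun_prop), pd_coord]⟩
  have e : ∀ l, _ := fun l => pd_congr hcos l
  simp only [pd_scomp hcs hA, pd_sub (((hd hch (i + 1)).1.fun_mul (hd hch (i + 2)).1).fun_mul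
    (hd hth i).1) ((hd hsh (i + 1)).1.fun_mul (hd hsh (i + 2)).1),
    pd_mul ((hd hch (i + 1)).1.fun_mul (hd hch (i + 2)).1) (hd hth i).1,
    pd_mul (hd hch (i + 1)).1 (hd hch (i + 2)).1, pd_mul (hd hsh (i + 1)).1 (hd hsh (i + 2)).1,
    (hd hch _).2, (hd hsh _).2, (hd hth _).2, hsin, ← htc (i + 1), ← htc (i + 2)] at e
  have e0 := e i
  have e1 := e (i + 1)
  have e2 := e (i + 2)
  simp at e0 e1 e2
  have c1 := hc0 (i + 1)
  have c2 := hc0 (i + 2)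
  refine ⟨?_, ?_, ?_⟩ <;> rw [eq_div_iff hρ] <;> apply mul_left_cancel₀ (mul_ne_zero c1 c2)
  · linear_combination e0
  · linear_combination e1
  · linear_combination e2

/-- In `dΦ` the coefficient of `dA_i` is `-w_i - (ℓ₀ + ℓ_i - ℓ_j - ℓ_k) / 2`, which vanishes by
`hℓ`. Hence `∂_i Φ = π₀ / 2 - A_i`, and the cosine law gives the Hessian. The functions `ch`, `sh`,
`th`, `sn`, `cs` are abstract so that the real and the complex case are treated at once. -/
theorem realizes_of_lobachevsky (hV : IsOpen V) {ch sh th sn cs : 𝕜 → 𝕜}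
    (hch : ∀ x, HasDerivAt ch (sh x) x) (hsh : ∀ x, HasDerivAt sh (ch x) x)
    (hth : ∀ x, ch x ≠ 0 → HasDerivAt th (1 - th x ^ 2) x) (hcs : ∀ x, HasDerivAt cs (-sn x) x)
    (htc : ∀ x, ch x ≠ 0 → th x * ch x = sh x) (hone : ∀ x, ch x ^ 2 - sh x ^ 2 = 1)
    (hts : ∀ l, ContDiffOn 𝕜 (⊤ : ℕ∞) (fun w : Fin 3 → 𝕜 => th (w l)) V) (π₀ : 𝕜)
    {A ℓ M : Fin 3 → (Fin 3 → 𝕜) → 𝕜} {ℓ₀ M₀ : (Fin 3 → 𝕜) → 𝕜}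
    (hA : ∀ i, DifferentiableOn 𝕜 (A i) V) (hc0 : ∀ w ∈ V, ∀ i, ch (w i) ≠ 0)
    (hcos : ∀ w ∈ V, ∀ i, cs (A i w) =
      ch (w (i + 1)) * ch (w (i + 2)) * th (w i) - sh (w (i + 1)) * sh (w (i + 2)))
    (hR : DifferentiableOn 𝕜 R V) (hR0 : ∀ w ∈ V, R w ≠ 0)
    (hsq : ∀ w ∈ V, R w ^ 2 = 1 - ∑ l, th (w l) ^ 2 + 2 * ∏ l, th (w l))
    (hsin : ∀ w ∈ V, ∀ i, sn (A i w) = R w * ch (w (i + 1)) * ch (w (i + 2)))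
    (hM₀ : DifferentiableOn 𝕜 M₀ V) (hM : ∀ i, DifferentiableOn 𝕜 (M i) V)
    (dM₀ : ∀ w ∈ V, ∀ l, pd l M₀ w =
      -(ℓ₀ w) * pd l (fun w => (2 * π₀ - A 0 w - A 1 w - A 2 w) / 2) w)
    (dM : ∀ w ∈ V, ∀ i l, pd l (M i) w =
      -(ℓ i w) * pd l (fun w => (A (i + 1) w + A (i + 2) w - A i w) / 2) w)
    (hℓ : ∀ w ∈ V, ∀ i, ℓ₀ w + ℓ i w - ℓ (i + 1) w - ℓ (i + 2) w = -2 * w i)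
    (hΦ : ∀ w ∈ V, Φ w = π₀ / 2 * ∑ i, w i - ∑ i, A i w * w i - M₀ w - ∑ i, M i w) :
    Realizes V Φ 1 (fun _ => th) := by
  have hAd : ∀ v ∈ V, ∀ i, DifferentiableAt 𝕜 (A i) v := fun v hv i =>
    (hA i).differentiableAt (hV.mem_nhds hv)
  have key : ∀ w ∈ V, ∀ i, _ := fun w hw i => pd_angle (fun l => hch (w l)) (fun l => hsh (w l))
    (fun l => hth (w l) (hc0 w hw l)) (hcs (A i w)) (fun l => htc (w l) (hc0 w hw l)) (hc0 w hw)
    (hR0 w hw) (hAd w hw i) (by filter_upwards [hV.mem_nhds hw] with x hx using hcos x hx i)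
    (hsin w hw i)
  have hG : ∀ w ∈ V, ∀ i l, pd l (fun w => π₀ / 2 - A i w) w = -pd l (A i) w := fun w hw i l => by
    rw [pd_sub (by fun_prop) (hAd w hw i), pd_const, zero_sub]
  have hΦd : DifferentiableOn 𝕜 Φ V := by
    refine DifferentiableOn.congr ?_ hΦ
    have := hA 0; have := hA 1; have := hA 2
    have := hM 0; have := hM 1; have := hM 2
    simp only [Fin.sum_univ_three]
    fun_prop
  refine realizes_of_angles hV hts (fun w hw l h => ?_) hR hR0 hsq hΦd
    (G := fun l w => π₀ / 2 - A l w) (fun w hw l => ?_)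
    (fun l => (hA l).const_sub _) (fun w hw l => ?_) (fun w hw l => ?_) (fun w hw l => ?_)
  · have := hone (w l)
    rw [← htc _ (hc0 w hw l), mul_pow, h] at this
    simp at this
  · have a0 := hAd w hw 0
    have a1 := hAd w hw 1
    have a2 := hAd w hw 2
    have m0 := fun i => (hM i).differentiableAt (hV.mem_nhds hw)
    have m1 := m0 0
    have m2 := m0 1
    have m3 := m0 2
    have m4 := hM₀.differentiableAt (hV.mem_nhds hw)
    rw [pd_congr (by filter_upwards [hV.mem_nhds hw] with w hw using hΦ w hw) l]
    have d0 := dM₀ w hw l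
    have d1 := dM w hw 0 l
    have d2 := dM w hw 1 l
    have d3 := dM w hw 2 l
    have l0 := hℓ w hw 0
    have l1 := hℓ w hw 1
    have l2 := hℓ w hw 2
    simp only [Fin.isValue, Fin.reduceAdd, zero_add] at d1 d2 d3 l0 l1 l2
    simp only [div_eq_mul_inv] at d0 d1 d2 d3
    simp (disch := fun_prop) only [pd_mul, pd_sub, pd_add, pd_const] at d0 d1 d2 d3
    simp only [Fin.sum_univ_three]
    simp (disch := fun_prop) only [pd_mul, pd_sub, pd_add, pd_const, pd_coord, d0, d1, d2, d3]
    fin_cases l <;> simp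
    · linear_combination -(1 / 2 : 𝕜) * (pd 0 (A 0) w * l0 + pd 0 (A 1) w * l1 + pd 0 (A 2) w * l2)
    · linear_combination -(1 / 2 : 𝕜) * (pd 1 (A 0) w * l0 + pd 1 (A 1) w * l1 + pd 1 (A 2) w * l2)
    · linear_combination -(1 / 2 : 𝕜) * (pd 2 (A 0) w * l0 + pd 2 (A 1) w * l1 + pd 2 (A 2) w * l2)
  · rw [hG w hw, (key w hw l).1]
  · obtain ⟨e1, e2, -, -⟩ := fin_three_add l
    have := (key w hw (l + 1)).2.2
    rw [e1, e2] at this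
    rw [hG w hw, this]
  · obtain ⟨-, -, e1, e2⟩ := fin_three_add l
    have := (key w hw (l + 2)).2.1
    rw [e1, e2] at this
    rw [hG w hw, this]

end Trigonometric


/-! ### Holomorphic branches realize the claimed minors. -/

section ComplexDensities

variable {V : Set (Fin 3 → ℂ)} {X Y T Φ : (Fin 3 → ℂ) → ℂ}

theorem SqrtDensity.realizes (hV : IsOpen V) (h : SqrtDensity V Φ) :
    Realizes V Φ 0 (fun _ t => 1 / (8 * t)) :=
  realizes_of_sqrt hV h.holo h.sq h.ne

/-- Differentiate `X sin T = Y cos T` and multiply by `X cos T + Y sin T`; division by `X` or by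
`cos T` is avoided, so points with `X = 0` are included. -/
theorem ArctanBranch.mul_pd (h : ArctanBranch V X Y T) (hV : IsOpen V) {w : Fin 3 → ℂ}
    (hw : w ∈ V) (hX : DifferentiableAt ℂ X w) (hY : DifferentiableAt ℂ Y w) (l : Fin 3) :
    (X w ^ 2 + Y w ^ 2) * pd l T w = X w * pd l Y w - Y w * pd l X w := by
  have hT := h.holo.differentiableAt (hV.mem_nhds hw)
  have e := pd_congr (f := fun w => X w * Complex.sin (T w)) (g := fun w => Y w * Complex.cos (T w))
    (by filter_upwards [hV.mem_nhds hw] with x hx using h.tan_eq x hx) l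
  rw [pd_mul hX hT.csin, pd_mul hY hT.ccos, pd_scomp (Complex.hasDerivAt_sin _) hT,
    pd_scomp (Complex.hasDerivAt_cos _) hT] at e
  have h1 := h.tan_eq w hw
  have h2 := Complex.sin_sq_add_cos_sq (T w)
  linear_combination (X w * Complex.cos (T w) + Y w * Complex.sin (T w)) * e +
    ((X w * Complex.sin (T w) - Y w * Complex.cos (T w)) * pd l T w -
      Complex.sin (T w) * pd l Y w - Complex.cos (T w) * pd l X w) * h1 +
    (-(X w ^ 2 + Y w ^ 2) * pd l T w + X w * pd l Y w - Y w * pd l X w) * h2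

theorem ArctanDensityA.realizes (hV : IsOpen V) {i : Fin 3} (h : ArctanDensityA i V Φ) :
    Realizes V Φ (Pi.single i 1) (fun _ t => 1 / t) := by
  obtain ⟨R, T, hR, hsq, hT, hΦ⟩ := h
  exact realizes_of_arctanA hV i hR hT.holo (fun w hw => (hsq w hw).1) (fun w hw => (hsq w hw).2)
    hT.ne (fun w hw => hT.mul_pd hV hw (by fun_prop) (hR.differentiableAt (hV.mem_nhds hw))) hΦ

theorem hasDerivAt_complex_coth {x : ℂ} (h : Complex.sinh x ≠ 0) :
    HasDerivAt (fun x => Complex.cosh x / Complex.sinh x)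
      (1 - (Complex.cosh x / Complex.sinh x) ^ 2) x := by
  refine ((Complex.hasDerivAt_cosh x).fun_div (Complex.hasDerivAt_sinh x) h).congr_deriv ?_
  field_simp

theorem hasDerivAt_complex_tanh {x : ℂ} (h : Complex.cosh x ≠ 0) :
    HasDerivAt Complex.tanh (1 - Complex.tanh x ^ 2) x := by
  rw [show Complex.tanh = fun x => Complex.sinh x / Complex.cosh x from
    funext Complex.tanh_eq_sinh_div_cosh]
  refine ((Complex.hasDerivAt_sinh x).fun_div (Complex.hasDerivAt_cosh x) h).congr_deriv ?_
  field_simp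

theorem ArctanDensityB.realizes (hV : IsOpen V) {i : Fin 3} (h : ArctanDensityB i V Φ) :
    Realizes V Φ (1 - Pi.single i 1)
      (fun j t => if j = i then Complex.cosh t / Complex.sinh t else 1 / t) := by
  obtain ⟨S, T₁, T₂, hS, hsq, hT₁, hT₂, hΦ⟩ := h
  have hSd := fun w hw => hS.differentiableAt (hV.mem_nhds (x := w) hw)
  refine realizes_of_arctanB hV i (cth := fun t => Complex.cosh t / Complex.sinh t)
    (fun w hw => hasDerivAt_complex_coth (hsq w hw).1) ?_ hS hT₁.holo hT₂.holo
    (fun w hw => (hsq w hw).2.1) (fun w hw => (hsq w hw).2.2) hT₁.ne hT₂.ne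
    (fun w hw => hT₁.mul_pd hV hw (by fun_prop) (hSd w hw))
    (fun w hw => hT₂.mul_pd hV hw (by fun_prop) (hSd w hw)) hΦ
  exact (Complex.contDiff_cosh.comp (contDiff_coord i)).contDiffOn.div
    (Complex.contDiff_sinh.comp (contDiff_coord i)).contDiffOn fun w hw => (hsq w hw).1

theorem LobachevskyBranch.pd_eq {σ ℓ M : (Fin 3 → ℂ) → ℂ} (h : LobachevskyBranch V σ ℓ M)
    {w : Fin 3 → ℂ} (hw : w ∈ V) (l : Fin 3) : pd l M w = -(ℓ w) * pd l σ w := by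
  simp [pd, h.fderiv_eq w hw]

theorem LobachevskyDensity.realizes (hV : IsOpen V) (h : LobachevskyDensity V Φ) :
    Realizes V Φ 1 (fun _ t => Complex.tanh t) := by
  obtain ⟨A, ℓ₀, M₀, ℓ, M, hA, h₀, hM, hℓ, hΦ⟩ := h
  -- `SphericalAngles` provides `R` only pointwise. The formula `sin A_0 / (cosh w_1 cosh w_2)`
  -- recovers it as a holomorphic function.
  have hs : ∀ w ∈ V, ∃ R : ℂ, R ≠ 0 ∧
      R ^ 2 = 1 - ∑ i, Complex.tanh (w i) ^ 2 + 2 * ∏ i, Complex.tanh (w i) ∧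
      (∀ i, Complex.sin (A i w) = R * Complex.cosh (w (i + 1)) * Complex.cosh (w (i + 2))) ∧
      Complex.sin (A 0 w) / (Complex.cosh (w 1) * Complex.cosh (w 2)) = R := fun w hw => by
    obtain ⟨R, h1, h2, h3⟩ := hA.sin_eq w hw
    refine ⟨R, h1, h2, h3, ?_⟩
    have := h3 0
    have c1 := hA.cosh_ne w hw 1
    have c2 := hA.cosh_ne w hw 2
    simp only [Fin.isValue, zero_add] at this
    rw [this]
    field_simp
  refine realizes_of_lobachevsky hV Complex.hasDerivAt_cosh Complex.hasDerivAt_sinh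
    (fun x hx => hasDerivAt_complex_tanh hx) Complex.hasDerivAt_cos
    (fun x hx => by rw [Complex.tanh_eq_sinh_div_cosh, div_mul_cancel₀ _ hx])
    Complex.cosh_sq_sub_sinh_sq (fun l => ?_) Real.pi hA.holo hA.cosh_ne hA.cos_eq
    (R := fun w => Complex.sin (A 0 w) / (Complex.cosh (w 1) * Complex.cosh (w 2)))
    ?_ ?_ ?_ ?_ h₀.holo (fun i => (hM i).holo) (fun w hw l => h₀.pd_eq hw l)
    (fun w hw i l => (hM i).pd_eq hw l) hℓ hΦ
  · simp only [Complex.tanh_eq_sinh_div_cosh]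
    exact (Complex.contDiff_sinh.comp (contDiff_coord l)).contDiffOn.div
      (Complex.contDiff_cosh.comp (contDiff_coord l)).contDiffOn fun w hw => hA.cosh_ne w hw l
  · have hd : DifferentiableOn ℂ (fun w : Fin 3 → ℂ => Complex.cosh (w 1) * Complex.cosh (w 2)) V := by
      fun_prop
    simp only [div_eq_mul_inv]
    refine (hA.holo 0).csin.mul (hd.inv fun w hw => mul_ne_zero ?_ ?_)
    · exact hA.cosh_ne w hw 1
    · exact hA.cosh_ne w hw 2
  all_goals
    intro w hw
    obtain ⟨R, h1, h2, h3, h4⟩ := hs w hw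
    simp only [h4]
    assumption

end ComplexDensities

/-! ### Half-angle formulas of spherical trigonometry. -/

section Consistency

/-- The polynomial identity behind the half-angle formulas of spherical trigonometry, with `t` the
cosines of the sides. -/
theorem half_angle_identity {K : Type*} [CommRing K] (t₁ t₂ t₃ : K) :
    (1 - t₁ ^ 2) * (1 - t₂ ^ 2) * (1 - t₃ ^ 2) + (t₁ - t₂ * t₃) * (t₂ - t₃ * t₁) * (t₃ - t₁ * t₂) -
      (1 - t₁ ^ 2 - t₂ ^ 2 - t₃ ^ 2 + 2 * t₁ * t₂ * t₃) *
        ((t₁ - t₂ * t₃) + (t₂ - t₃ * t₁) + (t₃ - t₁ * t₂)) =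
      (1 - t₁ ^ 2 - t₂ ^ 2 - t₃ ^ 2 + 2 * t₁ * t₂ * t₃) * ((1 - t₁) * (1 - t₂) * (1 - t₃)) := by
  ring

-- With `s = (A₁ + A₂ + A₃) / 2`, the cosine law expresses `2 cos s cos (s - A₃)` and `2 cos ^ 2 s`
-- through `tanh w_i`; their quotient is `-exp (w₁ + w₂)`, and `cos (π - s) = -cos s`. This formula
-- makes the prescribed choice of logarithms possible.
open Complex in
theorem cos_half_angle {A₁ A₂ A₃ w₁ w₂ w₃ R : ℂ} (h₁ : cosh w₁ ≠ 0) (h₂ : cosh w₂ ≠ 0)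
    (h₃ : cosh w₃ ≠ 0) (hR : R ≠ 0)
    (hR2 : R ^ 2 = 1 - tanh w₁ ^ 2 - tanh w₂ ^ 2 - tanh w₃ ^ 2 + 2 * tanh w₁ * tanh w₂ * tanh w₃)
    (c₁ : cos A₁ = cosh w₂ * cosh w₃ * tanh w₁ - sinh w₂ * sinh w₃)
    (c₂ : cos A₂ = cosh w₃ * cosh w₁ * tanh w₂ - sinh w₃ * sinh w₁)
    (c₃ : cos A₃ = cosh w₁ * cosh w₂ * tanh w₃ - sinh w₁ * sinh w₂)
    (s₁ : sin A₁ = R * cosh w₂ * cosh w₃) (s₂ : sin A₂ = R * cosh w₃ * cosh w₁)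
    (s₃ : sin A₃ = R * cosh w₁ * cosh w₂) :
    cos ((2 * Real.pi - A₁ - A₂ - A₃) / 2) ≠ 0 ∧
    cos ((2 * Real.pi - A₁ - A₂ - A₃) / 2) * exp (w₁ + w₂) = cos ((A₁ + A₂ - A₃) / 2) := by
  have hS : ∀ {w : ℂ}, cosh w ≠ 0 → sinh w = tanh w * cosh w := fun h => by
    rw [tanh_eq_sinh_div_cosh, div_mul_cancel₀ _ h]
  have hg : ∀ {w : ℂ}, cosh w ≠ 0 → cosh w ^ 2 * (1 - tanh w ^ 2) = 1 := fun {w} h => by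
    linear_combination cosh_sq_sub_sinh_sq w - (sinh w + tanh w * cosh w) * (hS h).symm
  have g₁ := hg h₁
  have g₂ := hg h₂
  have g₃ := hg h₃
  have ht : 1 - tanh w₃ ≠ 0 := fun h => by
    rw [show tanh w₃ = 1 by linear_combination -h] at g₃
    simp at g₃
  rw [hS h₁, hS h₂] at c₃
  rw [hS h₂, hS h₃] at c₁
  rw [hS h₃, hS h₁] at c₂
  have x0 : cos ((2 * Real.pi - A₁ - A₂ - A₃) / 2) = -cos ((A₁ + A₂ + A₃) / 2) := by
    rw [← Complex.cos_pi_sub]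
    congr 1
    ring
  have e1 : 2 * (cos ((A₁ + A₂ + A₃) / 2) * cos ((A₁ + A₂ - A₃) / 2)) =
      -(R ^ 2 * cosh w₁ * cosh w₂ * cosh w₃ ^ 2 * (1 - tanh w₃)) := by
    have : 2 * (cos ((A₁ + A₂ + A₃) / 2) * cos ((A₁ + A₂ - A₃) / 2)) =
        cos (A₁ + A₂) + cos A₃ := by
      rw [cos_add_cos]
      ring_nf
    rw [this, cos_add, c₁, c₂, c₃, s₁, s₂]
    linear_combination (-cosh w₁ * cosh w₂ * (tanh w₃ - tanh w₁ * tanh w₂)) * g₃ -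
      cosh w₁ * cosh w₂ * cosh w₃ ^ 2 * tanh w₃ * hR2
  have e2 : 2 * cos ((A₁ + A₂ + A₃) / 2) ^ 2 =
      cosh w₁ ^ 2 * cosh w₂ ^ 2 * cosh w₃ ^ 2 * R ^ 2 *
        ((1 - tanh w₁) * (1 - tanh w₂) * (1 - tanh w₃)) := by
    have : 2 * cos ((A₁ + A₂ + A₃) / 2) ^ 2 = 1 + cos (A₁ + A₂ + A₃) := by
      rw [cos_sq]
      ring_nf
    rw [this, cos_add, cos_add, sin_add, c₁, c₂, c₃, s₁, s₂, s₃]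
    have h1 : cosh w₁ ^ 2 * (1 - tanh w₁ ^ 2) * (cosh w₂ ^ 2 * (1 - tanh w₂ ^ 2)) *
        (cosh w₃ ^ 2 * (1 - tanh w₃ ^ 2)) = 1 := by rw [g₁, g₂, g₃]; ring
    have h2 := half_angle_identity (tanh w₁) (tanh w₂) (tanh w₃)
    rw [← hR2] at h2
    linear_combination cosh w₁ ^ 2 * cosh w₂ ^ 2 * cosh w₃ ^ 2 * h2 - h1
  have hE : exp (w₁ + w₂) = cosh w₁ * cosh w₂ * ((1 + tanh w₁) * (1 + tanh w₂)) := by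
    rw [exp_add, ← cosh_add_sinh, ← cosh_add_sinh, hS h₁, hS h₂]
    ring
  -- Nonvanishing comes from the product formula `e1`, whose right side is nonzero because `R ≠ 0`
  -- and `tanh w₃ ≠ 1`.
  have hne : cos ((A₁ + A₂ + A₃) / 2) ≠ 0 := fun h => by
    rw [h, zero_mul, mul_zero] at e1
    have : R ^ 2 * cosh w₁ * cosh w₂ * cosh w₃ ^ 2 * (1 - tanh w₃) ≠ 0 := by positivity
    exact this (by linear_combination e1)
  refine ⟨by rwa [x0, neg_ne_zero], ?_⟩
  rw [x0]
  apply mul_left_cancel₀ (mul_ne_zero two_ne_zero hne)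
  rw [hE]
  have h3 : cosh w₁ ^ 2 * (1 - tanh w₁ ^ 2) * (cosh w₂ ^ 2 * (1 - tanh w₂ ^ 2)) = 1 := by
    rw [g₁, g₂]; ring
  linear_combination -(cosh w₁ * cosh w₂ * ((1 + tanh w₁) * (1 + tanh w₂))) * e2 - e1 -
    (R ^ 2 * cosh w₁ * cosh w₂ * cosh w₃ ^ 2 * (1 - tanh w₃)) * h3

end Consistency


/-! ### The real densities with principal values. -/

section RealDensities

theorem realizes_sqrtReal :
    Realizes {v : Fin 3 → ℝ | 0 < v 0 * v 1 * v 2} sqrtReal 0 (fun _ t => 1 / (8 * t)) := by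
  refine realizes_of_sqrt (isOpen_lt (by fun_prop) (by fun_prop)) (fun w hw => ?_)
    (fun w hw => Real.sq_sqrt (le_of_lt hw)) (fun w hw => (Real.sqrt_pos.2 hw).ne')
  have hd : DifferentiableAt ℝ (fun v : Fin 3 → ℝ => v 0 * v 1 * v 2) w := by fun_prop
  exact (hd.sqrt (ne_of_gt hw)).differentiableWithinAt

theorem mul_pd_arctan_div {V : Set (Fin 3 → ℝ)} (hV : IsOpen V) {X Y T : (Fin 3 → ℝ) → ℝ}
    (hT : ∀ w ∈ V, T w = Real.arctan (Y w / X w)) {w : Fin 3 → ℝ} (hw : w ∈ V)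
    (hX : DifferentiableAt ℝ X w) (hY : DifferentiableAt ℝ Y w) (hne : X w ≠ 0) (l : Fin 3) :
    (X w ^ 2 + Y w ^ 2) * pd l T w = X w * pd l Y w - Y w * pd l X w := by
  have hd : DifferentiableAt ℝ (fun w => Y w / X w) w := by
    simp only [div_eq_mul_inv]
    exact hY.mul (hX.inv hne)
  rw [pd_congr (by filter_upwards [hV.mem_nhds hw] with x hx using hT x hx) l,
    pd_scomp (f := fun w => Y w / X w) (Real.hasDerivAt_arctan _) hd, pd_div hY hX hne]
  have : X w ^ 2 + Y w ^ 2 ≠ 0 := by positivity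
  field_simp

theorem realizes_arctanRealA :
    Realizes {v : Fin 3 → ℝ | 0 < v 2 * v 1 ∧ v 2 * v 1 < 2 * v 0} arctanRealA (Pi.single 0 1)
      (fun _ t => 1 / t) := by
  set V := {v : Fin 3 → ℝ | 0 < v 2 * v 1 ∧ v 2 * v 1 < 2 * v 0} with hVdef
  have hV : IsOpen V := by
    have c1 : Continuous (fun v : Fin 3 → ℝ => v 2 * v 1) := by fun_prop
    have c2 : Continuous (fun v : Fin 3 → ℝ => 2 * v 0) := by fun_prop
    exact (isOpen_lt continuous_const c1).inter (isOpen_lt c1 c2)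
  set R : (Fin 3 → ℝ) → ℝ := fun v => Real.sqrt (v 2 * v 1 * (2 * v 0 - v 2 * v 1)) with hR
  set T : (Fin 3 → ℝ) → ℝ := fun v => Real.arctan (Real.sqrt (2 * v 0 / (v 2 * v 1) - 1)) with hT
  have hpos : ∀ w ∈ V, 0 < w 2 * w 1 * (2 * w 0 - w 2 * w 1) := fun w hw =>
    mul_pos hw.1 (sub_pos.2 hw.2)
  have hRd : ∀ w ∈ V, DifferentiableAt ℝ R w := fun w hw =>
    DifferentiableAt.sqrt (by fun_prop) (hpos w hw).ne'
  -- The positive factor `w 2 * w 1` can be moved out of the square root, which brings `T` to the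
  -- form `arctan (Y / X)` with `Y = R`.
  have hT' : ∀ w ∈ V, T w = Real.arctan (R w / (w (0 + 1) * w (0 + 2))) := fun w hw => by
    have h1 : 0 < w 2 * w 1 := hw.1
    simp only [hT, hR, Fin.isValue, zero_add]
    congr 1
    rw [show 2 * w 0 / (w 2 * w 1) - 1 =
        w 2 * w 1 * (2 * w 0 - w 2 * w 1) / (w 2 * w 1) ^ 2 by
        rw [sq, mul_div_mul_left _ _ h1.ne', sub_div, div_self h1.ne'],
      Real.sqrt_div' _ (sq_nonneg _), Real.sqrt_sq h1.le, mul_comm (w 1)]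
  have hX : ∀ w ∈ V, w (0 + 1) * w (0 + 2) ≠ 0 := fun w hw => by
    have := hw.1.ne'
    rwa [mul_comm] at this
  refine realizes_of_arctanA (R := R) (T := T) hV 0
    (fun w hw => (hRd w hw).differentiableWithinAt) (fun w hw => ?_) (fun w hw => ?_)
    (fun w hw => (Real.sqrt_pos.2 (hpos w hw)).ne') (fun w hw => ?_)
    (fun w hw => mul_pd_arctan_div hV hT' hw (by fun_prop) (hRd w hw) (hX w hw)) (fun w hw => rfl)
  · have h1 : 0 < w 2 * w 1 := hw.1
    have h2 : w 2 * w 1 < 2 * w 0 := hw.2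
    refine (DifferentiableAt.arctan (DifferentiableAt.sqrt ?_ ?_)).differentiableWithinAt
    · have := h1.ne'
      fun_prop (disch := assumption)
    · rw [sub_ne_zero]
      exact ((one_lt_div h1).2 h2).ne'
  · simp only [hR, Real.sq_sqrt (hpos w hw).le]
    simp
    ring
  · have := hX w hw
    positivity

theorem hasDerivAt_real_coth {x : ℝ} (h : Real.sinh x ≠ 0) :
    HasDerivAt (fun x => Real.cosh x / Real.sinh x) (1 - (Real.cosh x / Real.sinh x) ^ 2) x := by
  refine ((Real.hasDerivAt_cosh x).fun_div (Real.hasDerivAt_sinh x) h).congr_deriv ?_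
  field_simp

theorem hasDerivAt_real_tanh (x : ℝ) : HasDerivAt Real.tanh (1 - Real.tanh x ^ 2) x := by
  have h := (Real.cosh_pos x).ne'
  rw [show Real.tanh = fun x => Real.sinh x / Real.cosh x from funext Real.tanh_eq_sinh_div_cosh]
  refine ((Real.hasDerivAt_sinh x).fun_div (Real.hasDerivAt_cosh x) h).congr_deriv ?_
  field_simp

theorem realizes_arctanRealB :
    Realizes {v : Fin 3 → ℝ | v 0 ≠ 0 ∧ v 1 ≠ v 2 ∧ v 1 ≠ -v 2 ∧ 0 < radicandB v}
      arctanRealB (1 - Pi.single 0 1)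
      (fun j t => if j = 0 then Real.cosh t / Real.sinh t else 1 / t) := by
  set V := {v : Fin 3 → ℝ | v 0 ≠ 0 ∧ v 1 ≠ v 2 ∧ v 1 ≠ -v 2 ∧ 0 < radicandB v} with hVdef
  have hsinh : ∀ {x : ℝ}, x ≠ 0 → Real.sinh x ≠ 0 := fun h => by rwa [ne_eq, Real.sinh_eq_zero]
  have hrc : ∀ w : Fin 3 → ℝ, w 0 ≠ 0 → DifferentiableAt ℝ radicandB w := fun w hw => by
    have := hsinh hw
    unfold radicandB
    fun_prop (disch := assumption)
  have hV : IsOpen V := by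
    rw [isOpen_iff_mem_nhds]
    rintro w ⟨h0, h1, h2, h3⟩
    have c0 : ContinuousAt (fun w : Fin 3 → ℝ => w 0) w := (continuous_apply 0).continuousAt
    have c1 : ContinuousAt (fun w : Fin 3 → ℝ => w 1 - w 2) w := by fun_prop
    have c2 : ContinuousAt (fun w : Fin 3 → ℝ => w 1 - -w 2) w := by fun_prop
    filter_upwards [c0.eventually_ne h0, c1.eventually_ne (sub_ne_zero.2 h1),
      c2.eventually_ne (sub_ne_zero.2 h2), (hrc w h0).continuousAt.eventually_const_lt h3]
      with x x0 x1 x2 x3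
    exact ⟨x0, sub_ne_zero.1 x1, sub_ne_zero.1 x2, x3⟩
  set S : (Fin 3 → ℝ) → ℝ := fun v => Real.sqrt (radicandB v) with hS
  have hSd : ∀ w ∈ V, DifferentiableAt ℝ S w := fun w hw =>
    DifferentiableAt.sqrt (hrc w hw.1) hw.2.2.2.ne'
  have hX₁ : ∀ w ∈ V, w (0 + 1) - w (0 + 2) ≠ 0 := fun w hw => sub_ne_zero.2 hw.2.1
  have hX₂ : ∀ w ∈ V, w (0 + 1) + w (0 + 2) ≠ 0 := fun w hw h =>
    hw.2.2.1 (eq_neg_of_add_eq_zero_left h)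
  have hTd : ∀ {X : (Fin 3 → ℝ) → ℝ}, Differentiable ℝ X → (∀ w ∈ V, X w ≠ 0) →
      DifferentiableOn ℝ (fun w => Real.arctan (S w / X w)) V := fun hX h w hw => by
    refine (DifferentiableAt.arctan ?_).differentiableWithinAt
    simp only [div_eq_mul_inv]
    exact (hSd w hw).mul ((hX w).inv (h w hw))
  refine realizes_of_arctanB (S := S) (T₁ := fun v => Real.arctan (S v / (v (0 + 1) - v (0 + 2))))
    (T₂ := fun v => Real.arctan (S v / (v (0 + 1) + v (0 + 2))))
    hV 0 (cth := fun t => Real.cosh t / Real.sinh t)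
    (fun w hw => hasDerivAt_real_coth (hsinh hw.1)) ?_
    (fun w hw => (hSd w hw).differentiableWithinAt) (hTd (by fun_prop) hX₁)
    (hTd (by fun_prop) hX₂) (fun w hw => Real.sq_sqrt hw.2.2.2.le)
    (fun w hw => (Real.sqrt_pos.2 hw.2.2.2).ne') (fun w hw => ?_) (fun w hw => ?_)
    (fun w hw => mul_pd_arctan_div (X := fun v => v (0 + 1) - v (0 + 2)) hV (fun _ _ => rfl) hw
      (by fun_prop) (hSd w hw) (hX₁ w hw))
    (fun w hw => mul_pd_arctan_div (X := fun v => v (0 + 1) + v (0 + 2)) hV (fun _ _ => rfl) hw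
      (by fun_prop) (hSd w hw) (hX₂ w hw))
    (fun w hw => rfl)
  · exact (Real.contDiff_cosh.comp (contDiff_coord 0)).contDiffOn.div
      (Real.contDiff_sinh.comp (contDiff_coord 0)).contDiffOn fun w hw => hsinh hw.1
  · have := hX₁ w hw
    positivity
  · have := hX₂ w hw
    positivity

/-- `Real.log` is the logarithm of the absolute value, so the singularities at zeros of the cosine
are integrable and the formula holds wherever `cos s ≠ 0`, also beyond them. -/
theorem hasDerivAt_lobachevsky {s : ℝ} (hs : Real.cos s ≠ 0) :
    HasDerivAt lobachevsky (-Real.log (Real.cos s)) s := by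
  have hc : ContinuousAt (fun ξ => Real.log (Real.cos ξ)) s :=
    Real.continuous_cos.continuousAt.log hs
  refine HasDerivAt.neg (intervalIntegral.integral_hasDerivAt_right intervalIntegrable_log_cos
    ?_ hc)
  exact (Real.measurable_log.comp Real.measurable_cos).stronglyMeasurable.stronglyMeasurableAtFilter

/-- The sine of the angle of a spherical triangle. -/
theorem one_sub_sq_cosine_law {K : Type*} [CommRing K] {c₁ c₂ s₁ s₂ t t₁ t₂ : K}
    (h₁ : c₁ ^ 2 - s₁ ^ 2 = 1) (h₂ : c₂ ^ 2 - s₂ ^ 2 = 1) (e₁ : t₁ * c₁ = s₁) (e₂ : t₂ * c₂ = s₂) :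
    1 - (c₁ * c₂ * t - s₁ * s₂) ^ 2 =
      (1 - (t ^ 2 + t₁ ^ 2 + t₂ ^ 2) + 2 * (t * t₁ * t₂)) * (c₁ * c₂) ^ 2 := by
  subst e₁ e₂
  linear_combination (-c₂ ^ 2 * (1 - t₂ ^ 2)) * h₁ - h₂

theorem realizes_lobachevskyReal :
    Realizes triangleDomain lobachevskyReal 1 (fun _ t => Real.tanh t) := by
  have hcosh : ∀ x, Real.cosh x ≠ 0 := fun x => (Real.cosh_pos x).ne'
  have htc : ∀ x, Real.tanh x * Real.cosh x = Real.sinh x := fun x => by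
    rw [Real.tanh_eq_sinh_div_cosh, div_mul_cancel₀ _ (hcosh x)]
  have hth : Differentiable ℝ Real.tanh := fun x => (hasDerivAt_real_tanh x).differentiableAt
  set Δ : (Fin 3 → ℝ) → ℝ := fun v => 1 - ∑ i, Real.tanh (v i) ^ 2 + 2 * ∏ i, Real.tanh (v i)
    with hΔ
  have hΔd : Differentiable ℝ Δ := by
    simp only [hΔ, Fin.sum_univ_three, Fin.prod_univ_three]
    have := fun i : Fin 3 => hth.comp (differentiable_apply (𝕜 := ℝ) (F' := fun _ => ℝ) i)
    simp only [Function.comp_def] at this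
    have h0 := this 0; have h1 := this 1; have h2 := this 2
    fun_prop
  have hV : IsOpen triangleDomain := isOpen_lt continuous_const hΔd.continuous
  have hΔi : ∀ v i, Δ v = 1 - (Real.tanh (v i) ^ 2 + Real.tanh (v (i + 1)) ^ 2 +
      Real.tanh (v (i + 2)) ^ 2) +
      2 * (Real.tanh (v i) * Real.tanh (v (i + 1)) * Real.tanh (v (i + 2))) := fun v i => by
    simp only [hΔ, Fin.sum_univ_three, Fin.prod_univ_three]
    fin_cases i <;> simp <;> ring
  set C : Fin 3 → (Fin 3 → ℝ) → ℝ := fun i v => Real.cosh (v (i + 1)) * Real.cosh (v (i + 2)) *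
    Real.tanh (v i) - Real.sinh (v (i + 1)) * Real.sinh (v (i + 2)) with hC
  have hCsq : ∀ v i, 1 - C i v ^ 2 = Δ v * (Real.cosh (v (i + 1)) * Real.cosh (v (i + 2))) ^ 2 :=
    fun v i => by
      rw [hΔi v i]
      exact one_sub_sq_cosine_law (Real.cosh_sq_sub_sinh_sq _) (Real.cosh_sq_sub_sinh_sq _)
        (htc _) (htc _)
  -- Since `1 - C ^ 2` equals `Δ` times a positive square, `Δ > 0` keeps `arccos` away from its
  -- singular points `±1`.
  have hC1 : ∀ v ∈ triangleDomain, ∀ i, -1 < C i v ∧ C i v < 1 := fun v hv i => by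
    have h1 : 0 < Δ v := hv
    have h2 := hCsq v i
    have h3 := hcosh (v (i + 1))
    have h4 := hcosh (v (i + 2))
    have h5 : 0 < 1 - C i v ^ 2 := by rw [h2]; positivity
    exact abs_lt.1 ((sq_lt_one_iff_abs_lt_one _).1 (by linarith))
  have hAd : ∀ i, DifferentiableOn ℝ (sphericalAngle i) triangleDomain := fun i v hv => by
    have hCd : DifferentiableAt ℝ (C i) v := by
      have := hth.comp (differentiable_apply (𝕜 := ℝ) (F' := fun _ : Fin 3 => ℝ) i)
      simp only [Function.comp_def] at this
      fun_prop
    exact ((Real.differentiableAt_arccos.2 ⟨(hC1 v hv i).1.ne', (hC1 v hv i).2.ne⟩).comp v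
      hCd).differentiableWithinAt
  have hsinA : ∀ v i, Real.sin (sphericalAngle i v) =
      Real.sqrt (Δ v) * Real.cosh (v (i + 1)) * Real.cosh (v (i + 2)) := fun v i => by
    have : Real.sin (sphericalAngle i v) = Real.sqrt (1 - C i v ^ 2) := Real.sin_arccos _
    rw [this, hCsq, Real.sqrt_mul' _ (sq_nonneg _), Real.sqrt_sq (mul_pos (Real.cosh_pos _)
      (Real.cosh_pos _)).le, mul_assoc]
  have hcosA : ∀ v ∈ triangleDomain, ∀ i, Real.cos (sphericalAngle i v) = C i v := fun v hv i =>
    Real.cos_arccos (hC1 v hv i).1.le (hC1 v hv i).2.le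
  have hhalf : ∀ v ∈ triangleDomain, ∀ i,
      Real.cos ((2 * Real.pi - sphericalAngle 0 v - sphericalAngle 1 v - sphericalAngle 2 v) / 2) ≠
        0 ∧
      Real.cos ((2 * Real.pi - sphericalAngle 0 v - sphericalAngle 1 v - sphericalAngle 2 v) / 2) *
        Real.exp (v (i + 1) + v (i + 2)) =
      Real.cos ((sphericalAngle (i + 1) v + sphericalAngle (i + 2) v - sphericalAngle i v) / 2) := by
    intro v hv i
    obtain ⟨i1, i2, i3, i4⟩ := fin_three_add i
    have hc := fun l => Complex.ofReal_inj.2 (hcosA v hv l)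
    have hs := fun l => Complex.ofReal_inj.2 (hsinA v l)
    simp only [hC] at hc
    push_cast at hc hs
    have c1 := hc (i + 1)
    have c2 := hc (i + 2)
    have s1 := hs (i + 1)
    have s2 := hs (i + 2)
    rw [i1, i2] at c1 s1
    rw [i3, i4] at c2 s2
    have key := cos_half_angle (by exact_mod_cast hcosh (v (i + 1)))
      (by exact_mod_cast hcosh (v (i + 2))) (by exact_mod_cast hcosh (v i))
      (by exact_mod_cast (Real.sqrt_pos.2 hv).ne') (by
        have h := hΔi v i
        have h2 : Real.sqrt (Δ v) ^ 2 = 1 - Real.tanh (v (i + 1)) ^ 2 -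
          Real.tanh (v (i + 2)) ^ 2 - Real.tanh (v i) ^ 2 +
          2 * Real.tanh (v (i + 1)) * Real.tanh (v (i + 2)) * Real.tanh (v i) := by
            rw [show Real.sqrt (Δ v) ^ 2 = Δ v from Real.sq_sqrt (le_of_lt hv), h]; ring
        exact_mod_cast congrArg Complex.ofReal h2) c1 c2 (hc i) s1 s2 (hs i)
    have hsum : sphericalAngle 0 v + sphericalAngle 1 v + sphericalAngle 2 v =
        sphericalAngle (i + 1) v + sphericalAngle (i + 2) v + sphericalAngle i v := by
      fin_cases i <;> simp <;> ring
    have hsum' : 2 * Real.pi - sphericalAngle 0 v - sphericalAngle 1 v - sphericalAngle 2 v =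
        2 * Real.pi - sphericalAngle (i + 1) v - sphericalAngle (i + 2) v - sphericalAngle i v := by
      linarith
    rw [hsum']
    exact_mod_cast key
  have hcosi : ∀ v ∈ triangleDomain, ∀ i, Real.cos ((sphericalAngle (i + 1) v +
      sphericalAngle (i + 2) v - sphericalAngle i v) / 2) ≠ 0 := fun v hv i => by
    rw [← (hhalf v hv i).2]
    exact mul_ne_zero (hhalf v hv i).1 (Real.exp_ne_zero _)
  have hσ : ∀ v ∈ triangleDomain, ∀ i, DifferentiableAt ℝ (sphericalAngle i) v := fun v hv i =>
    (hAd i).differentiableAt (hV.mem_nhds hv)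
  have hσ₀ : ∀ v ∈ triangleDomain, DifferentiableAt ℝ (fun v =>
      (2 * Real.pi - sphericalAngle 0 v - sphericalAngle 1 v - sphericalAngle 2 v) / 2) v :=
    fun v hv => by
      have := hσ v hv 0; have := hσ v hv 1; have := hσ v hv 2
      fun_prop
  have hσi : ∀ v ∈ triangleDomain, ∀ i, DifferentiableAt ℝ (fun v =>
      (sphericalAngle (i + 1) v + sphericalAngle (i + 2) v - sphericalAngle i v) / 2) v :=
    fun v hv i => by
      have := hσ v hv (i + 1); have := hσ v hv (i + 2); have := hσ v hv i
      fun_prop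
  refine realizes_of_lobachevsky hV Real.hasDerivAt_cosh Real.hasDerivAt_sinh
    (fun x _ => hasDerivAt_real_tanh x) Real.hasDerivAt_cos (fun x _ => htc x)
    Real.cosh_sq_sub_sinh_sq (fun l => ?_) Real.pi hAd (fun _ _ i => hcosh _) hcosA
    (R := fun v => Real.sqrt (Δ v))
    (ℓ₀ := fun v => Real.log (Real.cos
      ((2 * Real.pi - sphericalAngle 0 v - sphericalAngle 1 v - sphericalAngle 2 v) / 2)))
    (ℓ := fun i v => Real.log (Real.cos
      ((sphericalAngle (i + 1) v + sphericalAngle (i + 2) v - sphericalAngle i v) / 2)))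
    (M₀ := fun v => lobachevsky
      ((2 * Real.pi - sphericalAngle 0 v - sphericalAngle 1 v - sphericalAngle 2 v) / 2))
    (M := fun i v => lobachevsky
      ((sphericalAngle (i + 1) v + sphericalAngle (i + 2) v - sphericalAngle i v) / 2))
    (fun v hv => ((hΔd v).sqrt (ne_of_gt hv)).differentiableWithinAt)
    (fun v hv => (Real.sqrt_pos.2 hv).ne') (fun v hv => Real.sq_sqrt (le_of_lt hv))
    (fun v _ i => hsinA v i)
    (fun v hv => ?_) (fun i v hv => ?_) (fun v hv l => ?_) (fun v hv i l => ?_) (fun v hv i => ?_)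
    (fun v hv => rfl)
  · simp only [Real.tanh_eq_sinh_div_cosh]
    exact (Real.contDiff_sinh.comp (contDiff_coord l)).contDiffOn.div
      (Real.contDiff_cosh.comp (contDiff_coord l)).contDiffOn fun w _ => hcosh _
  · exact ((hasDerivAt_lobachevsky (hhalf v hv 0).1).differentiableAt.fun_comp' v
      (hσ₀ v hv)).differentiableWithinAt
  · exact ((hasDerivAt_lobachevsky (hcosi v hv i)).differentiableAt.fun_comp' v
      (hσi v hv i)).differentiableWithinAt
  · exact pd_scomp (f := fun v =>
      (2 * Real.pi - sphericalAngle 0 v - sphericalAngle 1 v - sphericalAngle 2 v) / 2)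
      (hasDerivAt_lobachevsky (hhalf v hv 0).1) (hσ₀ v hv) l
  · exact pd_scomp (f := fun v =>
      (sphericalAngle (i + 1) v + sphericalAngle (i + 2) v - sphericalAngle i v) / 2)
      (hasDerivAt_lobachevsky (hcosi v hv i)) (hσi v hv i) l
  · have hlog : ∀ i, Real.log (Real.cos ((sphericalAngle (i + 1) v + sphericalAngle (i + 2) v -
        sphericalAngle i v) / 2)) = Real.log (Real.cos ((2 * Real.pi - sphericalAngle 0 v -
        sphericalAngle 1 v - sphericalAngle 2 v) / 2)) + (v (i + 1) + v (i + 2)) := fun i => by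
      rw [← (hhalf v hv i).2, Real.log_mul (hhalf v hv i).1 (Real.exp_ne_zero _), Real.log_exp]
    obtain ⟨i1, i2, i3, i4⟩ := fin_three_add i
    have l0 := hlog i
    have l1 := hlog (i + 1)
    have l2 := hlog (i + 2)
    simp only [i1, i2, i3, i4] at l0 l1 l2 ⊢
    linear_combination l0 - l1 - l2

end RealDensities


/-- A symmetric matrix is determined by its adjugate up to a sign. -/
theorem eq_of_minors_eq {K : Type*} [Field K] {x y z p q r x' y' z' p' q' r' δ δ' : K}
    (hδ : δ = x * y * z + 2 * p * q * r - x * p ^ 2 - y * q ^ 2 - z * r ^ 2)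
    (hδ' : δ' = x' * y' * z' + 2 * p' * q' * r' - x' * p' ^ 2 - y' * q' ^ 2 - z' * r' ^ 2)
    (m₁ : y * z - p ^ 2 = y' * z' - p' ^ 2) (m₂ : z * x - q ^ 2 = z' * x' - q' ^ 2)
    (m₃ : x * y - r ^ 2 = x' * y' - r' ^ 2) (n₁ : r * q - x * p = r' * q' - x' * p')
    (n₂ : p * r - y * q = p' * r' - y' * q') (n₃ : q * p - z * r = q' * p' - z' * r') :
    δ ^ 2 = δ' ^ 2 ∧ δ * x = δ' * x' ∧ δ * y = δ' * y' ∧ δ * z = δ' * z' ∧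
      δ * p = δ' * p' ∧ δ * q = δ' * q' ∧ δ * r = δ' * r' := by
  have diag : ∀ x y z p q r : K,
      (x * y * z + 2 * p * q * r - x * p ^ 2 - y * q ^ 2 - z * r ^ 2) * x =
      (z * x - q ^ 2) * (x * y - r ^ 2) - (r * q - x * p) ^ 2 := fun x y z p q r => by ring
  have off : ∀ x y z p q r : K,
      (x * y * z + 2 * p * q * r - x * p ^ 2 - y * q ^ 2 - z * r ^ 2) * p =
      (p * r - y * q) * (q * p - z * r) - (y * z - p ^ 2) * (r * q - x * p) :=
    fun x y z p q r => by ring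
  have rot : ∀ x y z p q r : K,
      x * y * z + 2 * p * q * r - x * p ^ 2 - y * q ^ 2 - z * r ^ 2 =
      y * z * x + 2 * q * r * p - y * q ^ 2 - z * r ^ 2 - x * p ^ 2 := fun x y z p q r => by ring
  refine ⟨?_, ?_, ?_, ?_, ?_, ?_, ?_⟩
  · rw [hδ, hδ', sq_det_of_minors, sq_det_of_minors, m₁, m₂, m₃, n₁, n₂, n₃]
  · rw [hδ, hδ', diag, diag, m₂, m₃, n₁]
  · rw [hδ, hδ', rot x, rot x', diag, diag, m₃, m₁, n₂]
  · rw [hδ, hδ', rot x, rot x', rot y, rot y', diag, diag, m₁, m₂, n₃]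
  · rw [hδ, hδ', off, off, n₂, n₃, m₁, n₁]
  · rw [hδ, hδ', rot x, rot x', off, off, n₃, n₁, m₂, n₂]
  · rw [hδ, hδ', rot x, rot x', rot y, rot y', off, off, n₁, n₂, m₃, n₃]

/-! ### Densities with the same minors coincide up to equivalence. -/

section Matching

variable {𝕜 : Type*} [RCLike 𝕜] [NormedAlgebra 𝕜 ℂ]

/-- The affine substitution of an equivalence transformation. -/
noncomputable def affineMap (μ ν : Fin 3 → ℂ) (v : Fin 3 → 𝕜) : Fin 3 → ℂ :=
  fun i => μ i * algebraMap 𝕜 ℂ (v i) + ν i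

theorem hasFDerivAt_algebraMap_sub {f : (Fin 3 → 𝕜) → 𝕜} {Φ : (Fin 3 → ℂ) → ℂ} (c : ℂ)
    {μ ν : Fin 3 → ℂ} {v : Fin 3 → 𝕜} (hf : DifferentiableAt 𝕜 f v)
    (hΦ : DifferentiableAt ℂ Φ (affineMap μ ν v)) :
    HasFDerivAt (fun v => algebraMap 𝕜 ℂ (f v) - c * Φ (affineMap μ ν v))
      (∑ i, (algebraMap 𝕜 ℂ (pd i f v) - c * μ i * pd i Φ (affineMap μ ν v)) •
        ((algebraMapCLM 𝕜 ℂ).comp (ContinuousLinearMap.proj (R := 𝕜) (φ := fun _ => 𝕜) i))) v := by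
  have h1 : HasFDerivAt (fun v => algebraMap 𝕜 ℂ (f v))
      ((algebraMapCLM 𝕜 ℂ).comp (fderiv 𝕜 f v)) v :=
    (algebraMapCLM 𝕜 ℂ).hasFDerivAt.comp v hf.hasFDerivAt
  have h2 : HasFDerivAt (affineMap (𝕜 := 𝕜) μ ν) (ContinuousLinearMap.pi fun i =>
      μ i • (algebraMapCLM 𝕜 ℂ).comp
        (ContinuousLinearMap.proj (R := 𝕜) (φ := fun _ : Fin 3 => 𝕜) i)) v := by
    refine hasFDerivAt_pi.2 fun i => ?_
    exact (((algebraMapCLM 𝕜 ℂ).comp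
      (ContinuousLinearMap.proj (R := 𝕜) (φ := fun _ : Fin 3 => 𝕜) i)).hasFDerivAt.const_mul
        (μ i)).add_const (ν i)
  have h3 := (hΦ.hasFDerivAt.restrictScalars 𝕜).comp v h2
  refine (h1.sub (h3.const_mul c)).congr_fderiv ?_
  ext1 x
  simp [fderiv_apply_eq_sum_pd, Fin.sum_univ_three]
  ring

theorem continuous_affineMap (μ ν : Fin 3 → ℂ) : Continuous (affineMap (𝕜 := 𝕜) μ ν) :=
  continuous_pi fun i => (continuous_const.mul
    ((algebraMapCLM 𝕜 ℂ).continuous.comp (continuous_apply i))).add continuous_const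

theorem eventually_const_of_hasFDerivAt_zero {h : (Fin 3 → 𝕜) → ℂ} {v₀ : Fin 3 → 𝕜}
    (hh : ∀ᶠ v in 𝓝 v₀, HasFDerivAt h (0 : (Fin 3 → 𝕜) →L[𝕜] ℂ) v) : ∀ᶠ v in 𝓝 v₀, h v = h v₀ := by
  obtain ⟨r, hr, hb⟩ := Metric.eventually_nhds_iff_ball.1 hh
  filter_upwards [Metric.ball_mem_nhds v₀ hr] with v hv
  exact Metric.isOpen_ball.is_const_of_fderiv_eq_zero (𝕜 := 𝕜) (convex_ball v₀ r).isPreconnected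
    (fun x hx => (hb x hx).differentiableAt.differentiableWithinAt)
    (fun x hx => (hb x hx).fderiv) hv (Metric.mem_ball_self hr)

/-- Integrate twice: equal Hessians make the difference of the gradients a constant `β`, and then
the difference of the functions is affine. -/
theorem equivNear_of_hess_eq {D : Set (Fin 3 → 𝕜)} {f : (Fin 3 → 𝕜) → 𝕜} {v₀ : Fin 3 → 𝕜}
    {V : Set (Fin 3 → ℂ)} {Φ : (Fin 3 → ℂ) → ℂ} {P : Set (Fin 3 → ℂ) → ((Fin 3 → ℂ) → ℂ) → Prop}
    {κ : ℂ} {μ ν : Fin 3 → ℂ} (hD : IsOpen D) (hf : ContDiffOn 𝕜 3 f D) (hv₀ : v₀ ∈ D)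
    (hV : IsOpen V) (hΦ : ContDiffOn ℂ 3 Φ V) (hP : P V Φ) (hw : affineMap μ ν v₀ ∈ V)
    (hκ : κ ≠ 0) (hμ : ∀ i, μ i ≠ 0)
    (hess_eq : ∀ᶠ v in 𝓝 v₀, ∀ i j, algebraMap 𝕜 ℂ (pd i (pd j f) v) =
      κ * μ j * μ i * pd i (pd j Φ) (affineMap μ ν v)) : EquivNear f v₀ P := by
  have evD : ∀ᶠ v in 𝓝 v₀, v ∈ D := hD.mem_nhds hv₀
  have evV : ∀ᶠ v in 𝓝 v₀, affineMap μ ν v ∈ V :=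
    (continuous_affineMap μ ν).continuousAt.eventually (hV.mem_nhds hw)
  set β : Fin 3 → ℂ := fun i => algebraMap 𝕜 ℂ (pd i f v₀) -
    κ * μ i * pd i Φ (affineMap μ ν v₀) with hβ
  have h1 : ∀ i, ∀ᶠ v in 𝓝 v₀, algebraMap 𝕜 ℂ (pd i f v) -
      κ * μ i * pd i Φ (affineMap μ ν v) = β i := by
    intro i
    refine eventually_const_of_hasFDerivAt_zero (h := fun v => algebraMap 𝕜 ℂ (pd i f v) -
      κ * μ i * pd i Φ (affineMap μ ν v)) ?_
    filter_upwards [evD, evV, hess_eq] with v hv hv' he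
    have d1 := ((hf.contDiffAt (hD.mem_nhds hv)).pd (m := 2) (by norm_num) i).differentiableAt
      two_ne_zero
    have d2 := ((hΦ.contDiffAt (hV.mem_nhds hv')).pd (m := 2) (by norm_num) i).differentiableAt
      two_ne_zero
    refine (hasFDerivAt_algebraMap_sub (κ * μ i) d1 d2).congr_fderiv ?_
    ext1 x
    simp [he]
  have h2 : ∀ᶠ v in 𝓝 v₀, (fun v => algebraMap 𝕜 ℂ (f v) - κ * Φ (affineMap μ ν v) -
      ∑ i, β i * algebraMap 𝕜 ℂ (v i)) v = (fun v => algebraMap 𝕜 ℂ (f v) -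
      κ * Φ (affineMap μ ν v) - ∑ i, β i * algebraMap 𝕜 ℂ (v i)) v₀ := by
    refine eventually_const_of_hasFDerivAt_zero ?_
    filter_upwards [evD, evV, h1 0, h1 1, h1 2] with v hv hv' e0 e1 e2
    have d1 := (hf.contDiffAt (hD.mem_nhds hv)).differentiableAt (by simp)
    have d2 := (hΦ.contDiffAt (hV.mem_nhds hv')).differentiableAt (by simp)
    have d3 : HasFDerivAt (fun v : Fin 3 → 𝕜 => ∑ i, β i * algebraMap 𝕜 ℂ (v i))
        (∑ i, β i • (algebraMapCLM 𝕜 ℂ).comp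
          (ContinuousLinearMap.proj (R := 𝕜) (φ := fun _ : Fin 3 => 𝕜) i)) v := by
      refine HasFDerivAt.fun_sum fun i _ => ?_
      exact ((algebraMapCLM 𝕜 ℂ).comp (ContinuousLinearMap.proj (R := 𝕜)
        (φ := fun _ : Fin 3 => 𝕜) i)).hasFDerivAt.const_mul (β i)
    refine ((hasFDerivAt_algebraMap_sub κ d1 d2).sub d3).congr_fderiv ?_
    simp [Fin.sum_univ_three, e0, e1, e2]
  refine ⟨V, Φ, hV, hP, κ, algebraMap 𝕜 ℂ (f v₀) -
      κ * Φ (affineMap μ ν v₀) - ∑ i, β i * algebraMap 𝕜 ℂ (v₀ i), μ, ν, β, hκ, hμ, ?_⟩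
  filter_upwards [evV, h2] with v hv e
  refine ⟨hv, ?_⟩
  change _ = κ * Φ (affineMap μ ν v) + _ + _
  linear_combination e

/-- `ha` and `hp` say that the Hessians of `f` and of `κ Φ` after the affine substitution have the
same adjugate, so they agree up to a sign. The sign `ε` is locally constant and is absorbed into
`κ`. -/
theorem equivNear_of_minors_eq {D : Set (Fin 3 → 𝕜)} {f : (Fin 3 → 𝕜) → 𝕜} {v₀ : Fin 3 → 𝕜}
    {a : Fin 3 → 𝕜} {p : Fin 3 → 𝕜 → 𝕜} {A : Fin 3 → ℂ} {Q : Fin 3 → ℂ → ℂ}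
    {V : Set (Fin 3 → ℂ)} {Φ : (Fin 3 → ℂ) → ℂ} {P : Set (Fin 3 → ℂ) → ((Fin 3 → ℂ) → ℂ) → Prop}
    {κ : ℂ} {μ ν : Fin 3 → ℂ} (hD : IsOpen D) (hf : ContDiffOn 𝕜 3 f D) (hv₀ : v₀ ∈ D)
    (hm : HasMinors D f a p) (hdet : (hess f v₀).det ≠ 0)
    (hV : IsOpen V) (hΦ : Realizes V Φ A Q) (hP : P V Φ) (hw : affineMap μ ν v₀ ∈ V)
    (hκ : κ ≠ 0) (hμ : ∀ i, μ i ≠ 0)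
    (ha : ∀ i, κ ^ 2 * (μ (i + 1) * μ (i + 2)) ^ 2 * A i = algebraMap 𝕜 ℂ (a i))
    (hp : ∀ i, ∀ᶠ t in 𝓝 (v₀ i), κ ^ 2 * (μ 0 * μ 1 * μ 2) * μ i *
      Q i (μ i * algebraMap 𝕜 ℂ t + ν i) = algebraMap 𝕜 ℂ (p i t)) : EquivNear f v₀ P := by
  set σ := algebraMap 𝕜 ℂ with hσ
  have evD : ∀ᶠ v in 𝓝 v₀, v ∈ D := hD.mem_nhds hv₀
  have evV : ∀ᶠ v in 𝓝 v₀, affineMap μ ν v ∈ V :=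
    (continuous_affineMap μ ν).continuousAt.eventually (hV.mem_nhds hw)
  have evp : ∀ᶠ v in 𝓝 v₀, ∀ i, κ ^ 2 * (μ 0 * μ 1 * μ 2) * μ i *
      Q i (affineMap μ ν v i) = σ (p i (v i)) :=
    eventually_all.2 fun i => (continuous_apply i).continuousAt.eventually (hp i)
  set δ : (Fin 3 → 𝕜) → ℂ := fun v => σ (pd 0 (pd 0 f) v) * σ (pd 1 (pd 1 f) v) *
      σ (pd 2 (pd 2 f) v) + 2 * σ (pd 1 (pd 2 f) v) * σ (pd 0 (pd 2 f) v) * σ (pd 0 (pd 1 f) v) -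
    σ (pd 0 (pd 0 f) v) * σ (pd 1 (pd 2 f) v) ^ 2 - σ (pd 1 (pd 1 f) v) * σ (pd 0 (pd 2 f) v) ^ 2 -
    σ (pd 2 (pd 2 f) v) * σ (pd 0 (pd 1 f) v) ^ 2 with hδ
  set N : Fin 3 → Fin 3 → (Fin 3 → 𝕜) → ℂ := fun i j v =>
    κ * μ j * μ i * pd i (pd j Φ) (affineMap μ ν v) with hN
  set δ' : (Fin 3 → 𝕜) → ℂ := fun v => N 0 0 v * N 1 1 v * N 2 2 v +
    2 * N 1 2 v * N 0 2 v * N 0 1 v - N 0 0 v * N 1 2 v ^ 2 - N 1 1 v * N 0 2 v ^ 2 -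
    N 2 2 v * N 0 1 v ^ 2 with hδ'
  have hfv := hf.contDiffAt (hD.mem_nhds hv₀)
  have hfv2 : ContDiffAt 𝕜 2 f v₀ := hfv.of_le (by norm_num)
  have hcf : ∀ i j, ContinuousAt (fun v => σ (pd i (pd j f) v)) v₀ := fun i j =>
    (algebraMapCLM 𝕜 ℂ).continuous.continuousAt.comp
      (hfv.pd_pd (m := 0) (by norm_num) i j).continuousAt
  have hcN : ∀ i j, ContinuousAt (N i j) v₀ := fun i j => by
    have h1 := ((hΦ.smooth.contDiffAt (hV.mem_nhds hw)).pd_pd (m := 0) (by norm_num)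
      i j).continuousAt
    exact continuousAt_const.mul (h1.comp (continuous_affineMap μ ν).continuousAt)
  have hδ0 : δ v₀ ≠ 0 := by
    have : δ v₀ = σ (hess f v₀).det := by
      rw [det_hess hfv2 0, hδ]
      simp [map_ofNat]
    rw [this]
    exact (map_ne_zero σ).2 hdet
  have hδc : ContinuousAt δ v₀ :=
    ((((((hcf 0 0).mul (hcf 1 1)).mul (hcf 2 2)).add
      (((continuousAt_const.mul (hcf 1 2)).mul (hcf 0 2)).mul (hcf 0 1))).sub
      ((hcf 0 0).mul ((hcf 1 2).pow 2))).sub ((hcf 1 1).mul ((hcf 0 2).pow 2))).sub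
      ((hcf 2 2).mul ((hcf 0 1).pow 2))
  have hδc' : ContinuousAt δ' v₀ :=
    ((((((hcN 0 0).mul (hcN 1 1)).mul (hcN 2 2)).add
      (((continuousAt_const.mul (hcN 1 2)).mul (hcN 0 2)).mul (hcN 0 1))).sub
      ((hcN 0 0).mul ((hcN 1 2).pow 2))).sub ((hcN 1 1).mul ((hcN 0 2).pow 2))).sub
      ((hcN 2 2).mul ((hcN 0 1).pow 2))
  have key : ∀ᶠ v in 𝓝 v₀, δ v ^ 2 = δ' v ^ 2 ∧ ∀ i j, δ v * σ (pd i (pd j f) v) =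
      δ' v * N i j v := by
    filter_upwards [evD, evV, evp] with v hv hv' hpv
    have hc := pd_pd_comm ((hf.contDiffAt (hD.mem_nhds hv)).of_le (by norm_num :
      (2 : WithTop ℕ∞) ≤ 3))
    have hc' := pd_pd_comm ((hΦ.smooth.contDiffAt (hV.mem_nhds hv')).of_le (by norm_num :
      (2 : WithTop ℕ∞) ≤ 3))
    have hm0 := hm v hv 0
    have hm1 := hm v hv 1
    have hm2 := hm v hv 2
    have hn0 := hΦ.minors _ hv' 0
    have hn1 := hΦ.minors _ hv' 1
    have hn2 := hΦ.minors _ hv' 2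
    have ha0 := ha 0
    have ha1 := ha 1
    have ha2 := ha 2
    have hp0 := hpv 0
    have hp1 := hpv 1
    have hp2 := hpv 2
    simp only [← (hm v hv _).1, ← (hm v hv _).2, ← (hΦ.minors _ hv' _).1, ← (hΦ.minors _ hv' _).2,
      diagMinor_eq, offMinor_eq, Fin.isValue, Fin.reduceAdd, zero_add, map_sub, map_mul, map_pow,
      hc 1 0, hc 2 0, hc 2 1, hc' 1 0, hc' 2 0, hc' 2 1] at ha0 ha1 ha2 hp0 hp1 hp2
    obtain ⟨r0, r1, r2, r3, r4, r5, r6⟩ := eq_of_minors_eq (δ := δ v) (δ' := δ' v)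
      (x := σ (pd 0 (pd 0 f) v)) (y := σ (pd 1 (pd 1 f) v)) (z := σ (pd 2 (pd 2 f) v))
      (p := σ (pd 1 (pd 2 f) v)) (q := σ (pd 0 (pd 2 f) v)) (r := σ (pd 0 (pd 1 f) v))
      (x' := N 0 0 v) (y' := N 1 1 v) (z' := N 2 2 v) (p' := N 1 2 v) (q' := N 0 2 v)
      (r' := N 0 1 v) rfl rfl
      (by simp only [hN]; linear_combination -ha0) (by simp only [hN]; linear_combination -ha1)
      (by simp only [hN]; linear_combination -ha2) (by simp only [hN]; linear_combination -hp0)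
      (by simp only [hN]; linear_combination -hp1) (by simp only [hN]; linear_combination -hp2)
    have s1 : N 1 0 v = N 0 1 v := by simp only [hN, hc' 1 0]; ring
    have s2 : N 2 0 v = N 0 2 v := by simp only [hN, hc' 2 0]; ring
    have s3 : N 2 1 v = N 1 2 v := by simp only [hN, hc' 2 1]; ring
    refine ⟨r0, fun i j => ?_⟩
    fin_cases i <;> fin_cases j <;>
      simp only [Fin.zero_eta, Fin.mk_one, Fin.reduceFinMk, hc 1 0, hc 2 0, hc 2 1, s1, s2, s3] <;>
      assumption
  set ε := δ' v₀ / δ v₀ with hε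
  have hε2 : ε ^ 2 = 1 := by
    rw [hε, div_pow, ← key.self_of_nhds.1, div_self (pow_ne_zero 2 hδ0)]
  have hε0 : ε ≠ 0 := fun h => by rw [h] at hε2; simp at hε2
  have hsgn : ∀ᶠ v in 𝓝 v₀, δ' v = ε * δ v ∧ δ v ≠ 0 := by
    -- In `(δ' - ε δ) (δ' + ε δ) = 0` the second factor equals `2 δ'` at `v₀`, hence is nonzero
    -- nearby.
    have hne : δ' v₀ + ε * δ v₀ ≠ 0 := by
      rw [hε, div_mul_cancel₀ _ hδ0, ← two_mul]
      refine mul_ne_zero two_ne_zero fun h => hε0 ?_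
      rw [hε, h, zero_div]
    filter_upwards [key, (hδc'.add (hδc.const_mul ε)).eventually_ne hne,
      hδc.eventually_ne hδ0] with v hv h1 h2
    refine ⟨?_, h2⟩
    apply mul_left_cancel₀ h1
    simp only [Pi.add_apply] at *
    linear_combination -hv.1 - δ v ^ 2 * hε2
  refine equivNear_of_hess_eq hD hf hv₀ hV hΦ.smooth hP hw (mul_ne_zero hε0 hκ) hμ ?_
  filter_upwards [key, hsgn] with v hv hs i j
  apply mul_left_cancel₀ hs.2
  have := hv.2 i j
  rw [hs.1] at this
  rw [this]
  simp only [hN]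
  ring

end Matching


/-! ### Local existence of holomorphic branches of the normal forms. -/

section Branches

open Complex

variable {E : Type*} [NormedAddCommGroup E] [NormedSpace ℂ E] {U : Set E} {w₀ : E}

/-- Dividing `g` by its value at `w₀` moves that value to `1`, away from the cut of the principal
logarithm; this also allows the branch to be prescribed by `L₀`. -/
theorem exists_local_log (hU : IsOpen U) (hw : w₀ ∈ U) {g : E → ℂ} (hg : DifferentiableOn ℂ g U)
    {L₀ : ℂ} (h₀ : exp L₀ = g w₀) : ∃ W ⊆ U, IsOpen W ∧ w₀ ∈ W ∧ ∃ L : E → ℂ,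
      DifferentiableOn ℂ L W ∧ (∀ w ∈ W, exp (L w) = g w) ∧ L w₀ = L₀ := by
  have hd : DifferentiableOn ℂ (fun w => g w / exp L₀) U := by
    simpa only [div_eq_mul_inv] using hg.mul_const (exp L₀)⁻¹
  refine ⟨U ∩ (fun w => g w / exp L₀) ⁻¹' slitPlane, Set.inter_subset_left,
    hd.continuousOn.isOpen_inter_preimage hU isOpen_slitPlane, ⟨hw, ?_⟩,
    fun w => L₀ + log (g w / exp L₀), ?_, ?_, ?_⟩
  · simp [← h₀]
  · exact ((hd.mono Set.inter_subset_left).clog fun w hw => hw.2).const_add L₀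
  · intro w hw
    rw [exp_add, exp_log (slitPlane_ne_zero hw.2), mul_div_cancel₀ _ (exp_ne_zero _)]
  · simp [← h₀]

theorem exists_local_sqrt (hU : IsOpen U) (hw : w₀ ∈ U) {g : E → ℂ} (hg : DifferentiableOn ℂ g U)
    (h₀ : g w₀ ≠ 0) : ∃ W ⊆ U, IsOpen W ∧ w₀ ∈ W ∧ ∃ R : E → ℂ,
      DifferentiableOn ℂ R W ∧ ∀ w ∈ W, R w ^ 2 = g w ∧ R w ≠ 0 := by
  obtain ⟨W, hWU, hW, hw, L, hL, he, -⟩ := exists_local_log hU hw hg (exp_log h₀)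
  refine ⟨W, hWU, hW, hw, fun w => exp (L w * (1 / 2)), (hL.mul_const _).cexp, fun w hw =>
    ⟨?_, exp_ne_zero _⟩⟩
  rw [← he w hw, ← exp_nat_mul]
  congr 1
  push_cast
  ring

omit [NormedSpace ℂ E] in
theorem eventually_eq_of_exp_eq {ℓ ℓ' : E → ℂ} (h : ContinuousAt ℓ w₀) (h' : ContinuousAt ℓ' w₀)
    (he : ∀ᶠ w in 𝓝 w₀, exp (ℓ w) = exp (ℓ' w)) (h₀ : ℓ w₀ = ℓ' w₀) :
    ∀ᶠ w in 𝓝 w₀, ℓ w = ℓ' w := by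
  have hc : ContinuousAt (fun w => (ℓ w - ℓ' w).im) w₀ :=
    continuous_im.continuousAt.comp (h.sub h')
  have h0 : (ℓ w₀ - ℓ' w₀).im = 0 := by simp [h₀]
  have h1 := hc.eventually_lt continuousAt_const (by simpa only [h0] using Real.pi_pos :
    (ℓ w₀ - ℓ' w₀).im < Real.pi)
  have h2 := continuousAt_const.eventually_lt hc (by
    simpa only [h0, neg_lt_zero] using Real.pi_pos : -Real.pi < (ℓ w₀ - ℓ' w₀).im)
  filter_upwards [he, h1, h2] with w e l1 l2
  have := log_exp l2 l1.le
  rw [exp_sub, e, div_self (exp_ne_zero _), log_one] at this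
  exact (sub_eq_zero.1 this.symm)

variable {U : Set (Fin 3 → ℂ)} {w₀ : Fin 3 → ℂ}

theorem differentiableOn_coord (i : Fin 3) (U : Set (Fin 3 → ℂ)) :
    DifferentiableOn ℂ (fun w : Fin 3 → ℂ => w i) U :=
  (differentiable_apply i).differentiableOn

theorem exists_sqrtDensity (h : ∀ i, w₀ i ≠ 0) :
    ∃ V, IsOpen V ∧ w₀ ∈ V ∧ ∃ Φ, SqrtDensity V Φ := by
  obtain ⟨V, -, hV, hw, R, hR, h2⟩ := exists_local_sqrt isOpen_univ (Set.mem_univ w₀)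
    (((differentiableOn_coord 0 _).mul (differentiableOn_coord 1 _)).mul
      (differentiableOn_coord 2 _)) (mul_ne_zero (mul_ne_zero (h 0) (h 1)) (h 2))
  exact ⟨V, hV, hw, R, hR, fun w hw => (h2 w hw).1, fun w hw => (h2 w hw).2⟩

theorem ArctanBranch.mono {V W : Set (Fin 3 → ℂ)} {X Y T : (Fin 3 → ℂ) → ℂ}
    (h : ArctanBranch V X Y T) (hW : W ⊆ V) : ArctanBranch W X Y T :=
  ⟨h.holo.mono hW, fun w hw => h.ne w (hW hw), fun w hw => h.tan_eq w (hW hw)⟩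

/-- `T = log ((X + iY) / (X - iY)) / (2i)`, which is meaningful exactly where `X ^ 2 + Y ^ 2 ≠ 0`,
including `X = 0`. -/
theorem exists_arctanBranch (hU : IsOpen U) (hw : w₀ ∈ U) {X Y : (Fin 3 → ℂ) → ℂ}
    (hX : DifferentiableOn ℂ X U) (hY : DifferentiableOn ℂ Y U) (h₀ : X w₀ ^ 2 + Y w₀ ^ 2 ≠ 0) :
    ∃ W ⊆ U, IsOpen W ∧ w₀ ∈ W ∧ ∃ T, ArctanBranch W X Y T := by
  have fac : ∀ w, X w ^ 2 + Y w ^ 2 = (X w + I * Y w) * (X w - I * Y w) := fun w => by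
    linear_combination Y w ^ 2 * I_sq
  have hU' : IsOpen (U ∩ (fun w => X w ^ 2 + Y w ^ 2) ⁻¹' {0}ᶜ) :=
    ((hX.pow 2).add (hY.pow 2)).continuousOn.isOpen_inter_preimage hU isOpen_compl_singleton
  have hne : ∀ w ∈ U ∩ (fun w => X w ^ 2 + Y w ^ 2) ⁻¹' {0}ᶜ,
      X w + I * Y w ≠ 0 ∧ X w - I * Y w ≠ 0 := fun w hw => by
    rw [← mul_ne_zero_iff, ← fac]
    exact hw.2
  have hXU := hX.mono (Set.inter_subset_left (t := (fun w => X w ^ 2 + Y w ^ 2) ⁻¹' {0}ᶜ))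
  have hYU := hY.mono (Set.inter_subset_left (t := (fun w => X w ^ 2 + Y w ^ 2) ⁻¹' {0}ᶜ))
  have hg : DifferentiableOn ℂ (fun w => (X w + I * Y w) * (X w - I * Y w)⁻¹)
      (U ∩ (fun w => X w ^ 2 + Y w ^ 2) ⁻¹' {0}ᶜ) :=
    (hXU.add (hYU.const_mul I)).mul ((hXU.sub (hYU.const_mul I)).inv fun w hw => (hne w hw).2)
  have hw' : w₀ ∈ U ∩ (fun w => X w ^ 2 + Y w ^ 2) ⁻¹' {0}ᶜ := ⟨hw, h₀⟩
  obtain ⟨W, hWU, hW, hwW, L, hL, he, -⟩ := exists_local_log hU' hw' hg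
    (exp_log (mul_ne_zero (hne w₀ hw').1 (inv_ne_zero (hne w₀ hw').2)))
  refine ⟨W, hWU.trans Set.inter_subset_left, hW, hwW, fun w => L w * (2 * I)⁻¹,
    hL.mul_const _, fun w hw => (hWU hw).2, fun w hw => ?_⟩
  have e1 : exp (L w * (2 * I)⁻¹ * I) ^ 2 * (X w - I * Y w) = X w + I * Y w := by
    rw [← exp_nat_mul, show ((2 : ℕ) : ℂ) * (L w * (2 * I)⁻¹ * I) = L w by
      push_cast; field_simp, he w hw, inv_mul_cancel_right₀ (hne w (hWU hw)).2]
  have e2 : exp (-(L w * (2 * I)⁻¹) * I) * exp (L w * (2 * I)⁻¹ * I) = 1 := by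
    rw [← exp_add, ← add_mul, neg_add_cancel, zero_mul, exp_zero]
  rw [sin, cos]
  apply mul_right_cancel₀ (exp_ne_zero (L w * (2 * I)⁻¹ * I))
  linear_combination (-I / 2) * e1 + (X w * I / 2 - Y w / 2) * e2 +
    (-exp (L w * (2 * I)⁻¹ * I) ^ 2 - 1) * Y w / 2 * I_sq

theorem exists_arctanDensityA (i : Fin 3) (h₀ : w₀ i ≠ 0) (h₁ : w₀ (i + 1) ≠ 0)
    (h₂ : w₀ (i + 2) ≠ 0) (h : 2 * w₀ i - w₀ (i + 1) * w₀ (i + 2) ≠ 0) :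
    ∃ V, IsOpen V ∧ w₀ ∈ V ∧ ∃ Φ, ArctanDensityA i V Φ := by
  have hX : ∀ U, DifferentiableOn ℂ (fun w : Fin 3 → ℂ => w (i + 1) * w (i + 2)) U := fun U =>
    (differentiableOn_coord _ _).mul (differentiableOn_coord _ _)
  obtain ⟨W, -, hW, hw, R, hR, h2⟩ := exists_local_sqrt isOpen_univ (Set.mem_univ w₀)
    (((hX Set.univ)).mul (((differentiableOn_coord i Set.univ).const_mul 2).sub (hX Set.univ)))
    (mul_ne_zero (mul_ne_zero h₁ h₂) h)
  obtain ⟨V, hVW, hV, hw, T, hT⟩ := exists_arctanBranch hW hw (hX W) hR (by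
    rw [(h2 w₀ hw).1]
    intro h
    simp only [Pi.mul_apply, Pi.sub_apply] at h
    exact mul_ne_zero (mul_ne_zero (mul_ne_zero two_ne_zero h₀) h₁) h₂ (by linear_combination h))
  exact ⟨V, hV, hw, _, R, T, hR.mono hVW, fun w hw => h2 w (hVW hw), hT, fun w _ => rfl⟩

theorem exists_arctanDensityB (i : Fin 3) (h₀ : sinh (w₀ i) ≠ 0) (h₁ : w₀ (i + 1) ≠ 0)
    (h₂ : w₀ (i + 2) ≠ 0) (h : 2 * w₀ (i + 1) * w₀ (i + 2) * (cosh (w₀ i) / sinh (w₀ i)) -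
      w₀ (i + 1) ^ 2 - w₀ (i + 2) ^ 2 ≠ 0) :
    ∃ V, IsOpen V ∧ w₀ ∈ V ∧ ∃ Φ, ArctanDensityB i V Φ := by
  have d := differentiableOn_coord
  have hU : IsOpen {w : Fin 3 → ℂ | sinh (w i) ≠ 0} :=
    isOpen_compl_singleton.preimage (continuous_sinh.comp (continuous_apply i))
  have hg : DifferentiableOn ℂ (fun w : Fin 3 → ℂ => 2 * w (i + 1) * w (i + 2) *
      (cosh (w i) * (sinh (w i))⁻¹) - w (i + 1) ^ 2 - w (i + 2) ^ 2)
      {w : Fin 3 → ℂ | sinh (w i) ≠ 0} :=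
    ((((((d _ _).const_mul 2).mul (d _ _)).mul ((d _ _).ccosh.mul ((d _ _).csinh.inv
      fun w hw => hw))).sub ((d _ _).pow 2)).sub ((d _ _).pow 2))
  obtain ⟨W₁, hU₁, hW₁, hw₁, S, hS, h2⟩ := exists_local_sqrt hU h₀ hg h
  have hco : cosh (w₀ i) / sinh (w₀ i) * sinh (w₀ i) = cosh (w₀ i) := div_mul_cancel₀ _ h₀
  have hsq := (h2 w₀ hw₁).1
  rw [← div_eq_mul_inv] at hsq
  have hcs := cosh_sq_sub_sinh_sq (w₀ i)
  obtain ⟨W₂, hU₂, hW₂, hw₂, T₁, hT₁⟩ := exists_arctanBranch hW₁ hw₁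
    ((d (i + 1) W₁).sub (d (i + 2) W₁)) hS (by
      change (w₀ (i + 1) - w₀ (i + 2)) ^ 2 + S w₀ ^ 2 ≠ 0
      rw [hsq]
      intro h
      have h3 : cosh (w₀ i) / sinh (w₀ i) = 1 := by
        apply mul_left_cancel₀ (mul_ne_zero (mul_ne_zero two_ne_zero h₁) h₂)
        linear_combination h
      rw [h3] at hco
      rw [← hco] at hcs
      simp at hcs)
  obtain ⟨W₃, hU₃, hW₃, hw₃, T₂, hT₂⟩ := exists_arctanBranch hW₂ hw₂
    ((d (i + 1) W₂).add (d (i + 2) W₂)) (hS.mono hU₂) (by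
      change (w₀ (i + 1) + w₀ (i + 2)) ^ 2 + S w₀ ^ 2 ≠ 0
      rw [hsq]
      intro h
      have h3 : cosh (w₀ i) / sinh (w₀ i) = -1 := by
        apply mul_left_cancel₀ (mul_ne_zero (mul_ne_zero two_ne_zero h₁) h₂)
        linear_combination h
      rw [h3] at hco
      rw [← hco] at hcs
      simp at hcs)
  refine ⟨W₃, hW₃, hw₃, _, S, T₁, T₂, hS.mono (hU₃.trans hU₂), fun w hw => ?_, hT₁.mono hU₃, hT₂,
    fun w _ => rfl⟩
  have := h2 w (hU₂ (hU₃ hw))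
  rw [← div_eq_mul_inv] at this
  exact ⟨hU₁ (hU₂ (hU₃ hw)), this⟩

theorem SphericalAngles.mono {V W : Set (Fin 3 → ℂ)} {A : Fin 3 → (Fin 3 → ℂ) → ℂ}
    (h : SphericalAngles V A) (hW : W ⊆ V) : SphericalAngles W A :=
  ⟨fun i => (h.holo i).mono hW, fun w hw => h.cosh_ne w (hW hw), fun w hw => h.cos_eq w (hW hw),
    fun w hw => h.sin_eq w (hW hw)⟩

theorem LobachevskyBranch.mono {V W : Set (Fin 3 → ℂ)} {σ ℓ M : (Fin 3 → ℂ) → ℂ}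
    (h : LobachevskyBranch V σ ℓ M) (hW : W ⊆ V) : LobachevskyBranch W σ ℓ M :=
  ⟨h.holo_log.mono hW, fun w hw => h.exp_eq w (hW hw), h.holo.mono hW,
    fun w hw => h.fderiv_eq w (hW hw)⟩

/-- On a disc around `σ w₀` a branch of `log cos` has a primitive `Λ`; compose with `σ`. The value
`L₀` leaves the choice of branch to the caller. -/
theorem exists_lobachevskyBranch (hU : IsOpen U) (hw : w₀ ∈ U) {σ : (Fin 3 → ℂ) → ℂ}
    (hσ : DifferentiableOn ℂ σ U) {L₀ : ℂ} (h₀ : exp L₀ = cos (σ w₀)) :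
    ∃ W ⊆ U, IsOpen W ∧ w₀ ∈ W ∧ ∃ ℓ M, LobachevskyBranch W σ ℓ M ∧ ℓ w₀ = L₀ := by
  obtain ⟨N, -, hN, hσN, l, hl, hle, hl₀⟩ := exists_local_log isOpen_univ (Set.mem_univ (σ w₀))
    differentiable_cos.differentiableOn h₀
  obtain ⟨r, hr, hrN⟩ := Metric.isOpen_iff.1 hN _ hσN
  obtain ⟨Λ, hΛ⟩ := (hl.mono hrN).isExactOn_ball
  have hopen : IsOpen (U ∩ σ ⁻¹' Metric.ball (σ w₀) r) :=
    hσ.continuousOn.isOpen_inter_preimage hU Metric.isOpen_ball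
  have hM : ∀ w ∈ U ∩ σ ⁻¹' Metric.ball (σ w₀) r,
      HasFDerivAt (fun w => -Λ (σ w)) (-(l (σ w)) • fderiv ℂ σ w) w := fun w hw => by
    have h1 := (hΛ _ hw.2).comp_hasFDerivAt w
      (hσ.differentiableAt (hU.mem_nhds hw.1)).hasFDerivAt
    exact h1.neg.congr_fderiv (neg_smul _ _).symm
  refine ⟨_, Set.inter_subset_left, hopen, ⟨hw, Metric.mem_ball_self hr⟩, fun w => l (σ w),
    fun w => -Λ (σ w), ⟨?_, fun w hw => hle _ (hrN hw.2),
    fun w hw => (hM w hw).differentiableAt.differentiableWithinAt, fun w hw => (hM w hw).fderiv⟩,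
    hl₀⟩
  exact (hl.mono hrN).comp (hσ.mono Set.inter_subset_left) fun w hw => hw.2

/-- `A = -i log (C + iS)`; here `C + iS` never vanishes, its inverse being `C - iS`. -/
theorem exists_angle (hU : IsOpen U) (hw : w₀ ∈ U) {C S : (Fin 3 → ℂ) → ℂ}
    (hC : DifferentiableOn ℂ C U) (hS : DifferentiableOn ℂ S U)
    (h : ∀ w ∈ U, C w ^ 2 + S w ^ 2 = 1) : ∃ W ⊆ U, IsOpen W ∧ w₀ ∈ W ∧ ∃ A : (Fin 3 → ℂ) → ℂ,
      DifferentiableOn ℂ A W ∧ ∀ w ∈ W, cos (A w) = C w ∧ sin (A w) = S w := by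
  have fac : ∀ w ∈ U, (C w + I * S w) * (C w - I * S w) = 1 := fun w hw => by
    linear_combination h w hw - S w ^ 2 * I_sq
  obtain ⟨W, hWU, hW, hwW, L, hL, he, -⟩ := exists_local_log hU hw (hC.add (hS.const_mul I))
    (exp_log (left_ne_zero_of_mul_eq_one (fac w₀ hw)))
  refine ⟨W, hWU, hW, hwW, fun w => L w * -I, hL.mul_const _, fun w hw => ?_⟩
  have e1 : exp (L w * -I * I) = C w + I * S w := by
    rw [mul_assoc, neg_mul, I_mul_I, neg_neg, mul_one, he w hw]
    rfl
  have e2 : exp (-(L w * -I) * I) = C w - I * S w := by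
    apply mul_left_cancel₀ (left_ne_zero_of_mul_eq_one (fac w (hWU hw)))
    rw [fac w (hWU hw), ← e1, ← exp_add, ← add_mul, add_neg_cancel, zero_mul, exp_zero]
  rw [sin, cos, e1, e2]
  constructor
  · ring
  · linear_combination -S w * I_sq

theorem exists_sphericalAngles (hc : ∀ i, cosh (w₀ i) ≠ 0)
    (h : 1 - ∑ i, tanh (w₀ i) ^ 2 + 2 * ∏ i, tanh (w₀ i) ≠ 0) :
    ∃ V, IsOpen V ∧ w₀ ∈ V ∧ ∃ A, SphericalAngles V A := by
  have d := differentiableOn_coord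
  set U : Set (Fin 3 → ℂ) := {w | ∀ i, cosh (w i) ≠ 0} with hUdef
  have hU : IsOpen U := by
    simp only [hUdef, Set.ofPred_forall]
    exact isOpen_iInter_of_finite fun i =>
      isOpen_compl_singleton.preimage (continuous_cosh.comp (continuous_apply i))
  have htc : ∀ {x : ℂ}, cosh x ≠ 0 → tanh x * cosh x = sinh x := fun hx => by
    rw [tanh_eq_sinh_div_cosh, div_mul_cancel₀ _ hx]
  have dt : ∀ i, DifferentiableOn ℂ (fun w : Fin 3 → ℂ => tanh (w i)) U := fun i => by
    simp only [tanh_eq_sinh_div_cosh, div_eq_mul_inv]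
    exact (d i U).csinh.fun_mul ((d i U).ccosh.fun_inv fun w hw => hw i)
  obtain ⟨W, hWU, hW, hw, R, hR, hR2⟩ := exists_local_sqrt (w₀ := w₀) hU hc
    (g := fun w => 1 - ∑ i, tanh (w i) ^ 2 + 2 * (tanh (w 0) * tanh (w 1) * tanh (w 2)))
    (((DifferentiableOn.fun_sum fun i _ => (dt i).fun_pow 2).const_sub 1).fun_add
      ((((dt 0).fun_mul (dt 1)).fun_mul (dt 2)).const_mul 2)) (by simpa only [Fin.prod_univ_three] using h)
  have hA : ∀ i : Fin 3, ∃ W' ⊆ W, IsOpen W' ∧ w₀ ∈ W' ∧ ∃ A : (Fin 3 → ℂ) → ℂ,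
      DifferentiableOn ℂ A W' ∧ ∀ w ∈ W', cos (A w) = cosh (w (i + 1)) * cosh (w (i + 2)) *
        tanh (w i) - sinh (w (i + 1)) * sinh (w (i + 2)) ∧
        sin (A w) = R w * cosh (w (i + 1)) * cosh (w (i + 2)) := by
    intro i
    have hC : DifferentiableOn ℂ (fun w : Fin 3 → ℂ => cosh (w (i + 1)) * cosh (w (i + 2)) *
        tanh (w i) - sinh (w (i + 1)) * sinh (w (i + 2))) W :=
      (((d _ _).ccosh.fun_mul (d _ _).ccosh).fun_mul ((dt i).mono hWU)).fun_sub
        ((d _ _).csinh.fun_mul (d _ _).csinh)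
    have hS : DifferentiableOn ℂ (fun w : Fin 3 → ℂ => R w * cosh (w (i + 1)) *
        cosh (w (i + 2))) W := (hR.fun_mul (d _ _).ccosh).fun_mul (d _ _).ccosh
    refine exists_angle hW hw hC hS ?_
    intro w hw
    have e := one_sub_sq_cosine_law (t := tanh (w i)) (cosh_sq_sub_sinh_sq (w (i + 1)))
      (cosh_sq_sub_sinh_sq (w (i + 2))) (htc (hWU hw (i + 1)))
      (htc (hWU hw (i + 2)))
    have e2 := (hR2 w hw).1
    have e3 : ∑ i, tanh (w i) ^ 2 = tanh (w i) ^ 2 + tanh (w (i + 1)) ^ 2 +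
        tanh (w (i + 2)) ^ 2 := by
      rw [Fin.sum_univ_three]; fin_cases i <;> simp <;> ring
    have e4 : tanh (w 0) * tanh (w 1) * tanh (w 2) = tanh (w i) * tanh (w (i + 1)) *
        tanh (w (i + 2)) := by
      fin_cases i <;> simp <;> ring
    rw [e3, e4] at e2
    linear_combination (cosh (w (i + 1)) * cosh (w (i + 2))) ^ 2 * e2 - e
  choose W' hW' hop hmem A hA hcs using hA
  refine ⟨⋂ i, W' i, isOpen_iInter_of_finite hop, Set.mem_iInter.2 hmem, A,
    fun i => (hA i).mono (Set.iInter_subset _ i),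
    fun w hw => hWU (hW' 0 (Set.mem_iInter.1 hw 0)),
    fun w hw i => (hcs i w (Set.mem_iInter.1 hw i)).1, fun w hw => ⟨R w, ?_, ?_, fun i =>
      (hcs i w (Set.mem_iInter.1 hw i)).2⟩⟩
  · exact (hR2 w (hW' 0 (Set.mem_iInter.1 hw 0))).2
  · rw [(hR2 w (hW' 0 (Set.mem_iInter.1 hw 0))).1, Fin.prod_univ_three]

/-- The logarithms are fixed at `w₀` by `ℓ_i = ℓ₀ + w_j + w_k`. Both sides have the same exponential
by the half-angle formula, so the relation persists near `w₀`, and it implies the required one. -/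
theorem exists_lobachevskyDensity (hc : ∀ i, cosh (w₀ i) ≠ 0)
    (h : 1 - ∑ i, tanh (w₀ i) ^ 2 + 2 * ∏ i, tanh (w₀ i) ≠ 0) :
    ∃ V, IsOpen V ∧ w₀ ∈ V ∧ ∃ Φ, LobachevskyDensity V Φ := by
  obtain ⟨U, hU, hw, A, hA⟩ := exists_sphericalAngles hc h
  have half : ∀ w ∈ U, ∀ i, cos ((2 * Real.pi - A 0 w - A 1 w - A 2 w) / 2) ≠ 0 ∧
      cos ((2 * Real.pi - A 0 w - A 1 w - A 2 w) / 2) * exp (w (i + 1) + w (i + 2)) =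
        cos ((A (i + 1) w + A (i + 2) w - A i w) / 2) := by
    intro w hw i
    obtain ⟨h1, h2, h3, h4⟩ := fin_three_add i
    obtain ⟨R, hR, hR2, hs⟩ := hA.sin_eq w hw
    have hc' := hA.cos_eq w hw
    have hR2' : R ^ 2 = 1 - tanh (w (i + 1)) ^ 2 - tanh (w (i + 2)) ^ 2 - tanh (w i) ^ 2 +
        2 * tanh (w (i + 1)) * tanh (w (i + 2)) * tanh (w i) := by
      rw [hR2, Fin.sum_univ_three, Fin.prod_univ_three]
      fin_cases i <;> simp <;> ring
    have e1 := hc' (i + 1)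
    have e2 := hc' (i + 2)
    have e3 := hs (i + 1)
    have e4 := hs (i + 2)
    rw [h1, h2] at e1 e3
    rw [h3, h4] at e2 e4
    have e := cos_half_angle (hA.cosh_ne w hw _) (hA.cosh_ne w hw _) (hA.cosh_ne w hw _) hR hR2'
      e1 e2 (hc' i) e3 e4 (hs i)
    have e5 : 2 * (Real.pi : ℂ) - A 0 w - A 1 w - A 2 w =
        2 * Real.pi - A (i + 1) w - A (i + 2) w - A i w := by
      fin_cases i <;> simp <;> ring
    rw [e5]
    exact e
  have hd₀ : DifferentiableOn ℂ (fun w => (2 * Real.pi - A 0 w - A 1 w - A 2 w) / 2) U := by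
    simpa only [div_eq_mul_inv] using! ((((hA.holo 0).const_sub (2 * (Real.pi : ℂ))).fun_sub
      (hA.holo 1)).fun_sub (hA.holo 2)).mul_const 2⁻¹
  have hd : ∀ i, DifferentiableOn ℂ (fun w => (A (i + 1) w + A (i + 2) w - A i w) / 2) U := by
    intro i
    simpa only [div_eq_mul_inv] using! (((hA.holo (i + 1)).fun_add (hA.holo (i + 2))).fun_sub
      (hA.holo i)).mul_const 2⁻¹
  obtain ⟨W₀, hWU₀, hW₀, hw₀, ℓ₀, M₀, hM₀, -⟩ := exists_lobachevskyBranch hU hw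
    (σ := fun w => (2 * Real.pi - A 0 w - A 1 w - A 2 w) / 2) hd₀
    (exp_log (half w₀ hw 0).1)
  have hexp₀ := hM₀.exp_eq w₀ hw₀
  have hi : ∀ i : Fin 3, ∃ W ⊆ W₀, IsOpen W ∧ w₀ ∈ W ∧ ∃ ℓ M, LobachevskyBranch W
      (fun w => (A (i + 1) w + A (i + 2) w - A i w) / 2) ℓ M ∧
      ℓ w₀ = ℓ₀ w₀ + (w₀ (i + 1) + w₀ (i + 2)) := fun i => by
    refine exists_lobachevskyBranch hW₀ hw₀ ((hd i).mono hWU₀) ?_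
    rw [exp_add, hexp₀]
    exact (half w₀ hw i).2
  choose W hWU hW hwW ℓ M hM hℓ using hi
  have hcont : ∀ i, ∀ᶠ w in 𝓝 w₀, ℓ i w = ℓ₀ w + (w (i + 1) + w (i + 2)) := fun i => by
    refine eventually_eq_of_exp_eq
      ((hM i).holo_log.differentiableAt ((hW i).mem_nhds (hwW i))).continuousAt
      ((hM₀.holo_log.differentiableAt (hW₀.mem_nhds hw₀)).continuousAt.add
        (by fun_prop : Continuous fun w : Fin 3 → ℂ => w (i + 1) + w (i + 2)).continuousAt) ?_
      (hℓ i)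
    filter_upwards [(hW i).mem_nhds (hwW i)] with w hw
    rw [(hM i).exp_eq w hw, exp_add, hM₀.exp_eq w (hWU i hw)]
    exact (half w (hWU₀ (hWU i hw)) i).2.symm
  obtain ⟨V, hV, hVo, hwV⟩ := eventually_nhds_iff.1 ((eventually_all.2 hcont).and
    (eventually_all.2 fun i => (hW i).mem_nhds (hwW i)))
  have hVW : ∀ i, V ⊆ W i := fun i w hw => (hV w hw).2 i
  refine ⟨V, hVo, hwV, _, A, ℓ₀, M₀, ℓ, M, hA.mono fun w hw => hWU₀ (hWU 0 (hVW 0 hw)),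
    hM₀.mono fun w hw => hWU 0 (hVW 0 hw), fun i => (hM i).mono (hVW i), fun w hw i => ?_,
    fun w _ => rfl⟩
  obtain ⟨h1, h2, h3, h4⟩ := fin_three_add i
  rw [(hV w hw).1 i, (hV w hw).1 (i + 1), (hV w hw).1 (i + 2), h1, h2, h3, h4]
  ring

theorem exists_exp_eq {z : ℂ} (hz : z ≠ 1) (hz' : z ≠ -1) :
    ∃ w : ℂ, exp w ^ 2 * (1 - z) = 1 + z := by
  have h1 : 1 - z ≠ 0 := sub_ne_zero.2 hz.symm
  have h2 : 1 + z ≠ 0 := fun h => hz' (by linear_combination h)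
  refine ⟨log ((1 + z) / (1 - z)) / 2, ?_⟩
  rw [← exp_nat_mul, show ((2 : ℕ) : ℂ) * (log ((1 + z) / (1 - z)) / 2) =
    log ((1 + z) / (1 - z)) by push_cast; ring, exp_log (div_ne_zero h2 h1), div_mul_cancel₀ _ h1]

theorem exists_tanh_eq {z : ℂ} (hz : z ≠ 1) (hz' : z ≠ -1) : ∃ w, cosh w ≠ 0 ∧ tanh w = z := by
  obtain ⟨w, hw⟩ := exists_exp_eq hz hz'
  have e : exp w * exp (-w) = 1 := by rw [← exp_add, add_neg_cancel, exp_zero]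
  have h1 : 1 - z ≠ 0 := sub_ne_zero.2 hz.symm
  have hc : cosh w ≠ 0 := fun h => by
    rw [cosh, div_eq_zero_iff, or_iff_left two_ne_zero] at h
    apply two_ne_zero (α := ℂ)
    linear_combination (exp w * (1 - z)) * h - (1 - z) * e - hw
  refine ⟨w, hc, ?_⟩
  rw [tanh_eq_sinh_div_cosh, div_eq_iff hc]
  apply mul_left_cancel₀ (exp_ne_zero w)
  rw [sinh, cosh]
  linear_combination hw / 2 - (1 + z) / 2 * e

theorem exists_coth_eq {z : ℂ} (hz : z ≠ 1) (hz' : z ≠ -1) :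
    ∃ w, sinh w ≠ 0 ∧ cosh w / sinh w = z := by
  obtain ⟨w', hw'⟩ := exists_exp_eq hz hz'
  obtain ⟨w, hw⟩ : ∃ w : ℂ, exp w ^ 2 * (z - 1) = z + 1 := by
    -- The shift by `iπ/2` changes the sign of `exp w ^ 2` and so exchanges `tanh` and `coth`.
    refine ⟨w' + Real.pi / 2 * I, ?_⟩
    rw [exp_add, exp_pi_div_two_mul_I]
    linear_combination hw' + exp w' ^ 2 * (z - 1) * I_sq
  have e : exp w * exp (-w) = 1 := by rw [← exp_add, add_neg_cancel, exp_zero]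
  have hc : sinh w ≠ 0 := fun h => by
    rw [sinh, div_eq_zero_iff, or_iff_left two_ne_zero] at h
    apply two_ne_zero (α := ℂ)
    linear_combination (exp w * (z - 1)) * h + (z - 1) * e - hw
  refine ⟨w, hc, ?_⟩
  rw [div_eq_iff hc]
  apply mul_left_cancel₀ (exp_ne_zero w)
  rw [sinh, cosh]
  linear_combination -hw / 2 + (1 + z) / 2 * e

end Branches


/-! ### Uniqueness for linear differential equations over `ℝ` or `ℂ`. -/

section LinearODE

variable {𝕜 : Type*} [RCLike 𝕜]

/-- Solutions of linear equations `h' = g h` that vanish at a point vanish near it. -/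
theorem eventually_eq_zero_of_hasDerivAt_mul {A : Type*} [NormedRing A] [NormedSpace 𝕜 A]
    {h g : 𝕜 → A} {t₀ : 𝕜} (hg : ContinuousAt g t₀) (hh : ∀ᶠ t in 𝓝 t₀, HasDerivAt h (g t * h t) t)
    (h₀ : h t₀ = 0) : ∀ᶠ t in 𝓝 t₀, h t = 0 := by
  have hg' : ∀ᶠ t in 𝓝 t₀, ‖g t‖ < ‖g t₀‖ + 1 :=
    hg.norm.eventually_lt continuousAt_const (lt_add_one _)
  have hh' : ∀ᶠ t in 𝓝 t₀, ‖h t‖ < 1 :=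
    hh.self_of_nhds.continuousAt.norm.eventually_lt continuousAt_const (by simp [h₀])
  obtain ⟨r, hr, hb⟩ := Metric.eventually_nhds_iff_ball.1 (hh.and (hg'.and hh'))
  set K := ‖g t₀‖ + 1 with hK
  have hK0 : 0 < K := by positivity
  set ρ := min r (1 / (2 * K)) with hρ
  have hρ0 : 0 < ρ := lt_min hr (by positivity)
  have hρK : K * ρ ≤ 1 / 2 := by
    calc K * ρ ≤ K * (1 / (2 * K)) := by gcongr; exact min_le_right _ _
      _ = 1 / 2 := by field_simp
  have hsub : Metric.ball t₀ ρ ⊆ Metric.ball t₀ r := Metric.ball_subset_ball (min_le_left _ _)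
  -- On a ball with `K * ρ ≤ 1 / 2` the mean value inequality halves any bound for `h`; iteration
  -- forces `h = 0`.
  have step : ∀ n : ℕ, ∀ t ∈ Metric.ball t₀ ρ, ‖h t‖ ≤ (1 / 2) ^ n := by
    intro n
    induction n with
    | zero => exact fun t ht => by simpa using (hb t (hsub ht)).2.2.le
    | succ n ih =>
      intro t ht
      have := (convex_ball t₀ ρ).norm_image_sub_le_of_norm_hasDerivWithin_le (𝕜 := 𝕜) (f := h)
        (f' := fun t => g t * h t) (C := K * (1 / 2) ^ n)
        (fun s hs => (hb s (hsub hs)).1.hasDerivWithinAt)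
        (fun s hs => (norm_mul_le _ _).trans (mul_le_mul (hb s (hsub hs)).2.1.le (ih s hs)
          (norm_nonneg _) hK0.le)) (Metric.mem_ball_self hρ0) ht
      rw [h₀, sub_zero] at this
      calc ‖h t‖ ≤ K * (1 / 2) ^ n * ‖t - t₀‖ := this
        _ ≤ K * (1 / 2) ^ n * ρ := by gcongr; exact (mem_ball_iff_norm.1 ht).le
        _ = (K * ρ) * (1 / 2) ^ n := by ring
        _ ≤ 1 / 2 * (1 / 2) ^ n := by gcongr
        _ = (1 / 2) ^ (n + 1) := by ring
  filter_upwards [Metric.ball_mem_nhds t₀ hρ0] with t ht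
  rw [← norm_le_zero_iff]
  exact ge_of_tendsto' (tendsto_pow_atTop_nhds_zero_of_lt_one (by norm_num)
    (by norm_num : (1 / 2 : ℝ) < 1)) fun n => step n t ht

/-- The set of points near which `h` vanishes is open, and relatively closed in `I` by local
uniqueness. -/
theorem eq_zero_of_hasDerivAt_mul {I : Set 𝕜} (hI : IsOpen I) (hI' : IsPreconnected I)
    {h g : 𝕜 → 𝕜} (hg : ContinuousOn g I) (hh : ∀ t ∈ I, HasDerivAt h (g t * h t) t) {t₀ : 𝕜}
    (ht₀ : t₀ ∈ I) (h₀ : h t₀ = 0) : ∀ t ∈ I, h t = 0 := by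
  have hopen : IsOpen {t | ∀ᶠ s in 𝓝 t, s ∈ I ∧ h s = 0} := isOpen_setOfPred_eventually_nhds
  have mem : ∀ t ∈ I, h t = 0 → ∀ᶠ s in 𝓝 t, s ∈ I ∧ h s = 0 := fun t ht h0 =>
    (hI.eventually_mem ht).and (eventually_eq_zero_of_hasDerivAt_mul
      (hg.continuousAt (hI.mem_nhds ht)) ((hI.eventually_mem ht).mono hh) h0)
  have := hI'.subset_of_closure_inter_subset hopen ⟨t₀, ht₀, mem t₀ ht₀ h₀⟩ ?_
  · exact fun t ht => (this ht).self_of_nhds.2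
  rintro t ⟨htc, ht⟩
  refine mem t ht ?_
  have h1 : h t ∈ closure (h '' {t | ∀ᶠ s in 𝓝 t, s ∈ I ∧ h s = 0}) :=
    mem_closure_image (hh t ht).continuousAt htc
  have h2 : h '' {t | ∀ᶠ s in 𝓝 t, s ∈ I ∧ h s = 0} ⊆ {0} := by
    rintro _ ⟨s, hs, rfl⟩
    exact hs.self_of_nhds.2
  simpa using closure_mono h2 h1

end LinearODE

/-! ### Nondegeneracy of the Riccati data and matching at one point. -/

section NormalForm

variable {𝕜 : Type*} [RCLike 𝕜] {I : Fin 3 → Set 𝕜} {f : (Fin 3 → 𝕜) → 𝕜} {a : Fin 3 → 𝕜}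
  {p : Fin 3 → 𝕜 → 𝕜} {D : Set (Fin 3 → 𝕜)} {v : Fin 3 → 𝕜}

theorem HasMinors.sq_det (h : HasMinors D f a p) (hD : IsOpen D) (hf : ContDiffOn 𝕜 3 f D)
    (hv : v ∈ D) (i : Fin 3) : (hess f v).det ^ 2 = a i * a (i + 1) * a (i + 2) +
      2 * p i (v i) * p (i + 1) (v (i + 1)) * p (i + 2) (v (i + 2)) - a i * p i (v i) ^ 2 -
      a (i + 1) * p (i + 1) (v (i + 1)) ^ 2 - a (i + 2) * p (i + 2) (v (i + 2)) ^ 2 := by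
  have hf2 : ContDiffAt 𝕜 2 f v := (hf.contDiffAt (hD.mem_nhds hv)).of_le (by norm_num)
  obtain ⟨h1, h2, h3, h4⟩ := fin_three_add i
  rw [det_hess hf2 i, sq_det_of_minors]
  simp only [← (h v hv _).1, ← (h v hv _).2, diagMinor_eq, offMinor_eq, h1, h2, h3, h4,
    pd_pd_comm hf2 (i + 1) i, pd_pd_comm hf2 (i + 2) i, pd_pd_comm hf2 (i + 2) (i + 1)]

/-- For `c = 0` all `p i` are constant, hence so are `adj F` and `det F ^ 2`; connectedness makes
`det F` constant, and then `F = adj (adj F) / det F` is constant too. -/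
theorem riccati_const_ne_zero (hI : ∀ i, IsOpen (I i)) (hI' : ∀ i, IsPreconnected (I i))
    (hf : ContDiffOn 𝕜 3 f (Set.univ.pi I)) (h : HasMinors (Set.univ.pi I) f a p)
    (hdet : ∀ v ∈ Set.univ.pi I, (hess f v).det ≠ 0)
    (hconst : ¬ ∃ H : Matrix (Fin 3) (Fin 3) 𝕜, ∀ v ∈ Set.univ.pi I, hess f v = H)
    (hv : v ∈ Set.univ.pi I) {c : 𝕜}
    (hp : ∀ i, ∀ t ∈ I i, HasDerivAt (p i) (c * (p i t ^ 2 - a (i + 1) * a (i + 2))) t) :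
    c ≠ 0 := by
  rintro rfl
  have hD : IsOpen (Set.univ.pi I) := isOpen_set_pi Set.finite_univ fun i _ => hI i
  have hpc : ∀ w ∈ Set.univ.pi I, ∀ i, p i (w i) = p i (v i) := fun w hw i =>
    (hI i).is_const_of_deriv_eq_zero (hI' i)
      (fun t ht => (hp i t ht).differentiableAt.differentiableWithinAt)
      (fun t ht => by simpa using (hp i t ht).deriv) (hw i trivial) (hv i trivial)
  have hf2 : ∀ w ∈ Set.univ.pi I, ContDiffAt 𝕜 2 f w := fun w hw =>
    (hf.contDiffAt (hD.mem_nhds hw)).of_le (by norm_num)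
  have hcont : ContinuousOn (fun w => (hess f w).det) (Set.univ.pi I) := fun w hw => by
    refine ContinuousAt.continuousWithinAt ?_
    have : ContinuousAt (hess f) w := continuousAt_pi.2 fun i => continuousAt_pi.2 fun j =>
      ((hf2 w hw).pd_pd (m := 0) (by norm_num) i j).continuousAt
    exact (Continuous.matrix_det continuous_id).continuousAt.comp this
  have hdc : ∀ w ∈ Set.univ.pi I, (hess f w).det = (hess f v).det := by
    intro w hw
    refine (isPreconnected_univ_pi hI').eq_of_sq_eq hcont continuousOn_const ?_
      (fun _ => hdet v hv) hv rfl hw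
    intro u hu
    change (hess f u).det ^ 2 = (hess f v).det ^ 2
    rw [h.sq_det hD hf hu 0, h.sq_det hD hf hv 0]
    simp only [hpc u hu]
  refine hconst ⟨hess f v, fun w hw => ?_⟩
  have m : ∀ i, diagMinor f i w = diagMinor f i v ∧ offMinor f i w = offMinor f i v := fun i => by
    rw [(h w hw i).1, (h w hw i).2, (h v hv i).1, (h v hv i).2, hpc w hw]
    exact ⟨rfl, rfl⟩
  have m0 := m 0
  have m1 := m 1
  have m2 := m 2
  have e := hdc w hw
  have c1 := pd_pd_comm (hf2 v hv)
  have c2 := pd_pd_comm (hf2 w hw)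
  simp only [diagMinor_eq, offMinor_eq, Fin.isValue, Fin.reduceAdd, zero_add, c1 1 0, c1 2 0,
    c1 2 1, c2 1 0, c2 2 0, c2 2 1] at m0 m1 m2
  obtain ⟨-, r1, r2, r3, r4, r5, r6⟩ := eq_of_minors_eq (det_hess (hf2 w hw) 0)
    (det_hess (hf2 v hv) 0) m0.1 m1.1 m2.1 m0.2 m1.2 m2.2
  rw [e] at r1 r2 r3 r4 r5 r6
  have hd := hdet v hv
  ext i j
  apply mul_left_cancel₀ hd
  simp only [hess_apply]
  fin_cases i <;> fin_cases j <;>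
    simp only [Fin.zero_eta, Fin.mk_one, Fin.reduceFinMk, c1 1 0, c1 2 0, c1 2 1, c2 1 0,
      c2 2 0, c2 2 1] <;> assumption

/-- The function `h = p_i ^ 2 - a_j a_k` satisfies the linear equation `h' = 2 c p_i h`, so one zero
would make it, and with it `f_ii`, vanish identically. -/
theorem HasMinors.sq_sub_ne_zero (h : HasMinors (Set.univ.pi I) f a p) (hI : ∀ i, IsOpen (I i))
    (hI' : ∀ i, IsPreconnected (I i)) (hf : ContDiffOn 𝕜 3 f (Set.univ.pi I))
    (hdet : ∀ v ∈ Set.univ.pi I, (hess f v).det ≠ 0)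
    (hdiag : ∀ i, ∃ v ∈ Set.univ.pi I, hess f v i i ≠ 0) {c : 𝕜}
    (hp : ∀ i, ∀ t ∈ I i, HasDerivAt (p i) (c * (p i t ^ 2 - a (i + 1) * a (i + 2))) t)
    (i : Fin 3) {t : 𝕜} (ht : t ∈ I i) : p i t ^ 2 - a (i + 1) * a (i + 2) ≠ 0 := by
  intro h0
  have hD : IsOpen (Set.univ.pi I) := isOpen_set_pi Set.finite_univ fun i _ => hI i
  obtain ⟨v, hv, hne⟩ := hdiag i
  have key := eq_zero_of_hasDerivAt_mul (hI i) (hI' i) (g := fun t => 2 * c * p i t)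
    (h := fun t => p i t ^ 2 - a (i + 1) * a (i + 2))
    (fun t ht => ((hp i t ht).continuousAt.const_mul _).continuousWithinAt)
    (fun t ht => ((((hp i t ht).fun_pow 2).sub_const _).congr_deriv (by ring))) ht h0 (v i)
    (hv i trivial)
  refine mul_ne_zero (hdet v hv) hne ?_
  rw [h.det_mul_hess_diag hD hf hv i]
  linear_combination -key

variable [NormedAlgebra 𝕜 ℂ]

/-- The difference of two solutions of one Riccati equation satisfies a linear equation with
coefficient `c` times their sum. `hK` and `hb` say that `K Q`, after the substitution, solves the
equation of `q`. -/
theorem eventually_eq_of_riccati {Q : ℂ → ℂ} {q : 𝕜 → 𝕜} {ρ B K μ ν : ℂ} {c b t₀ : 𝕜}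
    (hQ : ∀ᶠ w in 𝓝 (μ * algebraMap 𝕜 ℂ t₀ + ν), HasDerivAt Q (ρ * (B - Q w ^ 2)) w)
    (hq : ∀ᶠ t in 𝓝 t₀, HasDerivAt q (c * (q t ^ 2 - b)) t)
    (hK : μ * ρ = -(algebraMap 𝕜 ℂ c * K)) (hb : K ^ 2 * B = algebraMap 𝕜 ℂ b)
    (h₀ : K * Q (μ * algebraMap 𝕜 ℂ t₀ + ν) = algebraMap 𝕜 ℂ (q t₀)) :
    ∀ᶠ t in 𝓝 t₀, K * Q (μ * algebraMap 𝕜 ℂ t + ν) = algebraMap 𝕜 ℂ (q t) := by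
  have hs : ∀ t, HasDerivAt (fun t : 𝕜 => μ * algebraMap 𝕜 ℂ t + ν) (μ * 1) t := fun t => by
    have := (algebraMapCLM 𝕜 ℂ).hasDerivAt (x := t)
    simpa using (this.const_mul μ).add_const ν
  have hc : ContinuousAt (fun t : 𝕜 => μ * algebraMap 𝕜 ℂ t + ν) t₀ := (hs t₀).continuousAt
  have hQ' := hc.eventually hQ
  have hd : ∀ᶠ t in 𝓝 t₀, HasDerivAt
      (fun t => K * Q (μ * algebraMap 𝕜 ℂ t + ν) - algebraMap 𝕜 ℂ (q t))
      ((algebraMap 𝕜 ℂ c * (K * Q (μ * algebraMap 𝕜 ℂ t + ν) + algebraMap 𝕜 ℂ (q t))) *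
        (K * Q (μ * algebraMap 𝕜 ℂ t + ν) - algebraMap 𝕜 ℂ (q t))) t := by
    filter_upwards [hQ', hq] with t h1 h2
    have e1 : HasDerivAt (fun t => Q (μ * algebraMap 𝕜 ℂ t + ν)) _ t := h1.comp t (hs t)
    have e2 : HasDerivAt (fun t => algebraMap 𝕜 ℂ (q t)) _ t :=
      (algebraMapCLM 𝕜 ℂ).hasFDerivAt.comp_hasDerivAt t h2
    refine ((e1.const_mul K).fun_sub e2).congr_deriv ?_
    simp only [algebraMapCLM_apply, map_mul, map_sub, map_pow, ← hb]
    linear_combination K * (B - Q (μ * algebraMap 𝕜 ℂ t + ν) ^ 2) * hK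
  have hcg : ContinuousAt (fun t => algebraMap 𝕜 ℂ c *
      (K * Q (μ * algebraMap 𝕜 ℂ t + ν) + algebraMap 𝕜 ℂ (q t))) t₀ := by
    have e1 : ContinuousAt (fun t => Q (μ * algebraMap 𝕜 ℂ t + ν)) t₀ :=
      ContinuousAt.comp (f := fun t => μ * algebraMap 𝕜 ℂ t + ν) hQ.self_of_nhds.continuousAt hc
    have e2 : ContinuousAt (fun t => algebraMap 𝕜 ℂ (q t)) t₀ :=
      (algebraMapCLM 𝕜 ℂ).continuous.continuousAt.comp hq.self_of_nhds.continuousAt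
    exact ((e1.const_mul K).add e2).const_mul _
  filter_upwards [eventually_eq_zero_of_hasDerivAt_mul hcg hd (sub_eq_zero.2 h₀)] with t ht
  exact sub_eq_zero.1 ht

/-- Matching of a density `f` with a normal form `Φ` at one point, with the scaling chosen so that
the Riccati equations agree. -/
theorem equivNear_of_riccati {v₀ : Fin 3 → 𝕜} {A : Fin 3 → ℂ} {Q : Fin 3 → ℂ → ℂ} {c : 𝕜}
    {V : Set (Fin 3 → ℂ)} {Φ : (Fin 3 → ℂ) → ℂ} {P : Set (Fin 3 → ℂ) → ((Fin 3 → ℂ) → ℂ) → Prop}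
    {κ ρ : ℂ} {μ w₀ : Fin 3 → ℂ} (hI : ∀ i, IsOpen (I i))
    (hf : ContDiffOn 𝕜 3 f (Set.univ.pi I)) (hv₀ : v₀ ∈ Set.univ.pi I)
    (hm : HasMinors (Set.univ.pi I) f a p) (hdet : (hess f v₀).det ≠ 0)
    (hric : ∀ i, ∀ t ∈ I i, HasDerivAt (p i) (c * (p i t ^ 2 - a (i + 1) * a (i + 2))) t)
    (hV : IsOpen V) (hw₀ : w₀ ∈ V) (hP : P V Φ) (hΦ : Realizes V Φ A Q)
    (hQ : ∀ i, ∀ᶠ w in 𝓝 (w₀ i),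
      HasDerivAt (Q i) (ρ * (A (i + 1) * A (i + 2) - Q i w ^ 2)) w)
    (hκ : κ ≠ 0) (hμ : ∀ i, μ i ≠ 0) (hρ : ρ = -(algebraMap 𝕜 ℂ c * κ ^ 2 * (μ 0 * μ 1 * μ 2)))
    (ha : ∀ i, κ ^ 2 * (μ (i + 1) * μ (i + 2)) ^ 2 * A i = algebraMap 𝕜 ℂ (a i))
    (h₀ : ∀ i, κ ^ 2 * (μ 0 * μ 1 * μ 2) * μ i * Q i (w₀ i) = algebraMap 𝕜 ℂ (p i (v₀ i))) :
    EquivNear f v₀ P := by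
  have hD : IsOpen (Set.univ.pi I) := isOpen_set_pi Set.finite_univ fun i _ => hI i
  have hw : ∀ i, μ i * algebraMap 𝕜 ℂ (v₀ i) + (w₀ i - μ i * algebraMap 𝕜 ℂ (v₀ i)) = w₀ i :=
    fun i => by ring
  refine equivNear_of_minors_eq (κ := κ) (μ := μ)
    (ν := fun i => w₀ i - μ i * algebraMap 𝕜 ℂ (v₀ i)) hD hf hv₀ hm hdet hV hΦ hP ?_ hκ hμ ha
    fun i => ?_
  · convert hw₀ using 1
    exact funext hw
  · refine eventually_eq_of_riccati (ρ := ρ) (B := A (i + 1) * A (i + 2)) (c := c)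
      (b := a (i + 1) * a (i + 2)) ?_ (((hI i).eventually_mem (hv₀ i trivial)).mono (hric i))
      ?_ ?_ ?_
    · rw [hw]
      exact hQ i
    · rw [hρ]
      ring
    · obtain ⟨h1, h2, h3, h4⟩ := fin_three_add i
      have hm : μ 0 * μ 1 * μ 2 = μ i * μ (i + 1) * μ (i + 2) := by
        fin_cases i <;> simp <;> ring
      rw [map_mul, ← ha (i + 1), ← ha (i + 2), h1, h2, h3, h4, hm]
      ring
    · rw [hw]
      exact h₀ i

end NormalForm


/-- The function with the values `x`, `y`, `z` at `i`, `i + 1`, `i + 2`. -/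
noncomputable def cyclicVec (i : Fin 3) (x y z : ℂ) : Fin 3 → ℂ :=
  fun l => if l = i then x else if l = i + 1 then y else z

theorem fin_three_ne (i : Fin 3) : i + 1 ≠ i ∧ i + 2 ≠ i ∧ i + 2 ≠ i + 1 := by
  revert i; decide

theorem cyclicVec_zero (i : Fin 3) (x y z : ℂ) : cyclicVec i x y z i = x := if_pos rfl

theorem cyclicVec_one (i : Fin 3) (x y z : ℂ) : cyclicVec i x y z (i + 1) = y := by
  simp [cyclicVec, fin_three_ne i]

theorem cyclicVec_two (i : Fin 3) (x y z : ℂ) : cyclicVec i x y z (i + 2) = z := by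
  simp [cyclicVec, fin_three_ne i]

theorem cyclicVec_prod (i : Fin 3) (x y z : ℂ) :
    cyclicVec i x y z 0 * cyclicVec i x y z 1 * cyclicVec i x y z 2 = x * y * z := by
  fin_cases i <;> simp [cyclicVec] <;> ring

theorem hasDerivAt_one_div_mul {k w : ℂ} (hk : k ≠ 0) (hw : w ≠ 0) :
    HasDerivAt (fun t : ℂ => 1 / (k * t)) (k * (0 - (1 / (k * w)) ^ 2)) w := by
  have := ((hasDerivAt_id w).const_mul k).fun_inv (mul_ne_zero hk hw)
  simp only [one_div]
  refine this.congr_deriv ?_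
  simp only [id]
  field_simp
  ring

/-! ### Choice of scales and base points for the four normal forms. -/

section Cases

variable {𝕜 : Type*} [RCLike 𝕜] [NormedAlgebra 𝕜 ℂ] {I : Fin 3 → Set 𝕜} {f : (Fin 3 → 𝕜) → 𝕜}
  {a : Fin 3 → 𝕜} {p : Fin 3 → 𝕜 → 𝕜} {v₀ : Fin 3 → 𝕜} {c : 𝕜}

theorem HasMinors.algebraMap_discr_ne_zero {D : Set (Fin 3 → 𝕜)} (h : HasMinors D f a p)
    (hD : IsOpen D) (hf : ContDiffOn 𝕜 3 f D) (hv₀ : v₀ ∈ D) (hdet : (hess f v₀).det ≠ 0)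
    (i : Fin 3) :
    algebraMap 𝕜 ℂ (a i) * algebraMap 𝕜 ℂ (a (i + 1)) * algebraMap 𝕜 ℂ (a (i + 2)) +
      2 * algebraMap 𝕜 ℂ (p i (v₀ i)) * algebraMap 𝕜 ℂ (p (i + 1) (v₀ (i + 1))) *
        algebraMap 𝕜 ℂ (p (i + 2) (v₀ (i + 2))) -
      algebraMap 𝕜 ℂ (a i) * algebraMap 𝕜 ℂ (p i (v₀ i)) ^ 2 -
      algebraMap 𝕜 ℂ (a (i + 1)) * algebraMap 𝕜 ℂ (p (i + 1) (v₀ (i + 1))) ^ 2 -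
      algebraMap 𝕜 ℂ (a (i + 2)) * algebraMap 𝕜 ℂ (p (i + 2) (v₀ (i + 2))) ^ 2 ≠ 0 := by
  have := (map_ne_zero (algebraMap 𝕜 ℂ)).2 (pow_ne_zero 2 hdet)
  rw [h.sq_det hD hf hv₀ i] at this
  simpa only [map_add, map_sub, map_mul, map_pow, map_ofNat] using this

theorem equivNear_sqrtDensity (hI : ∀ i, IsOpen (I i))
    (hf : ContDiffOn 𝕜 3 f (Set.univ.pi I)) (hv₀ : v₀ ∈ Set.univ.pi I)
    (hm : HasMinors (Set.univ.pi I) f a p) (hdet : (hess f v₀).det ≠ 0) (hc : c ≠ 0)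
    (hric : ∀ i, ∀ t ∈ I i, HasDerivAt (p i) (c * (p i t ^ 2 - a (i + 1) * a (i + 2))) t)
    (hP : ∀ i, p i (v₀ i) ^ 2 - a (i + 1) * a (i + 2) ≠ 0) (ha : ∀ i, a i = 0) :
    EquivNear f v₀ SqrtDensity := by
  have hγ : algebraMap 𝕜 ℂ c ≠ 0 := (map_ne_zero _).2 hc
  have hx : ∀ i, algebraMap 𝕜 ℂ (p i (v₀ i)) ≠ 0 := fun i =>
    (map_ne_zero _).2 fun h => hP i (by simp [ha, h])
  -- With all `μ i = 1` the Riccati constants agree when `8 = -c κ ^ 2`; then `w₀ i` is solved from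
  -- `κ ^ 2 / (8 w) = p i (v₀ i)`.
  obtain ⟨κ, hκ⟩ := IsAlgClosed.exists_pow_nat_eq (-8 / algebraMap 𝕜 ℂ c) two_pos
  have hκ0 : κ ≠ 0 := by
    rintro rfl
    have := div_ne_zero (by norm_num : (-8 : ℂ) ≠ 0) hγ
    exact this (by rw [← hκ]; simp)
  have hw : ∀ i, κ ^ 2 / (8 * algebraMap 𝕜 ℂ (p i (v₀ i))) ≠ 0 := fun i =>
    div_ne_zero (pow_ne_zero 2 hκ0) (mul_ne_zero (by norm_num) (hx i))
  obtain ⟨V, hV, hwV, Φ, hΦ⟩ := exists_sqrtDensity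
    (w₀ := fun i => κ ^ 2 / (8 * algebraMap 𝕜 ℂ (p i (v₀ i)))) hw
  refine equivNear_of_riccati (κ := κ) (ρ := 8) (μ := fun _ => 1) hI hf hv₀ hm hdet hric hV hwV hΦ
    (hΦ.realizes hV) (fun i => ?_) hκ0 (fun _ => one_ne_zero) ?_ (by simp [ha]) fun i => ?_
  · filter_upwards [isOpen_compl_singleton.mem_nhds (hw i)] with w hw
    simpa using hasDerivAt_one_div_mul (by norm_num : (8 : ℂ) ≠ 0) hw
  · rw [hκ]
    field_simp
  · have := hx i
    field_simp

theorem equivNear_arctanDensityA (hI : ∀ i, IsOpen (I i))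
    (hf : ContDiffOn 𝕜 3 f (Set.univ.pi I)) (hv₀ : v₀ ∈ Set.univ.pi I)
    (hm : HasMinors (Set.univ.pi I) f a p) (hdet : (hess f v₀).det ≠ 0) (hc : c ≠ 0)
    (hric : ∀ i, ∀ t ∈ I i, HasDerivAt (p i) (c * (p i t ^ 2 - a (i + 1) * a (i + 2))) t)
    (hP : ∀ i, p i (v₀ i) ^ 2 - a (i + 1) * a (i + 2) ≠ 0) {i : Fin 3} (hi : a i ≠ 0)
    (hj : a (i + 1) = 0) (hk : a (i + 2) = 0) : EquivNear f v₀ (ArctanDensityA i) := by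
  have hD : IsOpen (Set.univ.pi I) := isOpen_set_pi Set.finite_univ fun i _ => hI i
  obtain ⟨h1, h2, h3, h4⟩ := fin_three_add i
  obtain ⟨n1, n2, n3⟩ := fin_three_ne i
  have hΔ := hm.algebraMap_discr_ne_zero hD hf hv₀ hdet i
  have hx : ∀ l, algebraMap 𝕜 ℂ (p l (v₀ l)) ≠ 0 := forall_fin_three_of i
    ((map_ne_zero _).2 fun h => hP i (by simp [hj, h]))
    ((map_ne_zero _).2 fun h => hP (i + 1) (by simp [h1, hk, h]))
    ((map_ne_zero _).2 fun h => hP (i + 2) (by simp [h3, h4, hj, h]))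
  have hxi := hx i
  have hxj := hx (i + 1)
  have hxk := hx (i + 2)
  have hα : algebraMap 𝕜 ℂ (a i) ≠ 0 := (map_ne_zero _).2 hi
  have hαj : algebraMap 𝕜 ℂ (a (i + 1)) = 0 := by rw [hj, map_zero]
  have hαk : algebraMap 𝕜 ℂ (a (i + 2)) = 0 := by rw [hk, map_zero]
  have hγ : algebraMap 𝕜 ℂ c ≠ 0 := (map_ne_zero _).2 hc
  rw [hαj, hαk] at hΔ
  set γ := algebraMap 𝕜 ℂ c with hγdef
  set α := algebraMap 𝕜 ℂ (a i) with hαdef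
  -- With `μ_j = μ_k = 1` the equation for `a i` reads `κ ^ 2 = α`, the Riccati constants then
  -- require `μ_i = -1 / (γ α)`, and the values of `p` determine `w₀`.
  obtain ⟨κ, hκ⟩ := IsAlgClosed.exists_pow_nat_eq α two_pos
  have hκ0 : κ ≠ 0 := by
    rintro rfl
    exact hα (by rw [← hκ]; simp)
  set w₀ : Fin 3 → ℂ := cyclicVec i (1 / (γ ^ 2 * α * algebraMap 𝕜 ℂ (p i (v₀ i))))
    (-1 / (γ * algebraMap 𝕜 ℂ (p (i + 1) (v₀ (i + 1)))))
    (-1 / (γ * algebraMap 𝕜 ℂ (p (i + 2) (v₀ (i + 2))))) with hw₀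
  set μ : Fin 3 → ℂ := cyclicVec i (-1 / (γ * α)) 1 1 with hμ
  have w0 : w₀ i = _ := cyclicVec_zero i _ _ _
  have w1 : w₀ (i + 1) = _ := cyclicVec_one i _ _ _
  have w2 : w₀ (i + 2) = _ := cyclicVec_two i _ _ _
  have μ0 : μ i = _ := cyclicVec_zero i _ _ _
  have μ1 : μ (i + 1) = _ := cyclicVec_one i _ _ _
  have μ2 : μ (i + 2) = _ := cyclicVec_two i _ _ _
  have μp : μ 0 * μ 1 * μ 2 = _ := cyclicVec_prod i _ _ _
  have hw : ∀ l, w₀ l ≠ 0 := by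
    refine forall_fin_three_of i ?_ ?_ ?_
    · rw [w0]; exact one_div_ne_zero (mul_ne_zero (mul_ne_zero (pow_ne_zero 2 hγ) hα) hxi)
    · rw [w1]; exact div_ne_zero (by norm_num) (mul_ne_zero hγ hxj)
    · rw [w2]; exact div_ne_zero (by norm_num) (mul_ne_zero hγ hxk)
  -- At `w₀` the radicand is nonzero because `det F ^ 2`, written in terms of `a` and `p`, is
  -- nonzero. The same argument serves the remaining normal forms.
  obtain ⟨V, hV, hwV, Φ, hΦ⟩ := exists_arctanDensityA i (hw i) (hw (i + 1)) (hw (i + 2)) (by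
    intro h
    rw [w0, w1, w2] at h
    field_simp at h
    apply hΔ
    linear_combination algebraMap 𝕜 ℂ (p i (v₀ i)) * h)
  refine equivNear_of_riccati (κ := κ) (ρ := 1) (μ := μ) hI hf hv₀ hm hdet hric hV hwV hΦ
    (hΦ.realizes hV) (fun l => ?_) hκ0 ?_ ?_ ?_ ?_
  · filter_upwards [isOpen_compl_singleton.mem_nhds (hw l)] with w hw
    have e : (Pi.single i 1 : Fin 3 → ℂ) (l + 1) * (Pi.single i 1 : Fin 3 → ℂ) (l + 2) = 0 := by
      by_cases hl : l + 1 = i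
      · rw [Pi.single_eq_of_ne (M := fun _ => ℂ) (by rw [← hl]; exact (fin_three_ne l).2.2 :
          l + 2 ≠ i), mul_zero]
      · rw [Pi.single_eq_of_ne (M := fun _ => ℂ) hl, zero_mul]
    rw [e]
    simpa using hasDerivAt_one_div_mul one_ne_zero hw
  · refine forall_fin_three_of i ?_ ?_ ?_
    · rw [μ0]; exact div_ne_zero (by norm_num) (mul_ne_zero hγ hα)
    · rw [μ1]; exact one_ne_zero
    · rw [μ2]; exact one_ne_zero
  · rw [μp, hκ]
    field_simp
    rfl
  · refine forall_fin_three_of i ?_ ?_ ?_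
    · rw [μ1, μ2, hκ, Pi.single_eq_same]; ring
    · rw [Pi.single_eq_of_ne n1, hαj, mul_zero]
    · rw [Pi.single_eq_of_ne n2, hαk, mul_zero]
  · rw [μp, hκ]
    refine forall_fin_three_of i ?_ ?_ ?_
    · rw [w0, μ0]; field_simp
    · rw [w1, μ1]; field_simp
    · rw [w2, μ2]; field_simp

theorem equivNear_arctanDensityB (hI : ∀ i, IsOpen (I i))
    (hf : ContDiffOn 𝕜 3 f (Set.univ.pi I)) (hv₀ : v₀ ∈ Set.univ.pi I)
    (hm : HasMinors (Set.univ.pi I) f a p) (hdet : (hess f v₀).det ≠ 0) (hc : c ≠ 0)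
    (hric : ∀ i, ∀ t ∈ I i, HasDerivAt (p i) (c * (p i t ^ 2 - a (i + 1) * a (i + 2))) t)
    (hP : ∀ i, p i (v₀ i) ^ 2 - a (i + 1) * a (i + 2) ≠ 0) {i : Fin 3} (hi : a i = 0)
    (hj : a (i + 1) ≠ 0) (hk : a (i + 2) ≠ 0) : EquivNear f v₀ (ArctanDensityB i) := by
  have hD : IsOpen (Set.univ.pi I) := isOpen_set_pi Set.finite_univ fun i _ => hI i
  obtain ⟨h1, h2, h3, h4⟩ := fin_three_add i
  obtain ⟨n1, n2, n3⟩ := fin_three_ne i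
  have hΔ := hm.algebraMap_discr_ne_zero hD hf hv₀ hdet i
  have hxj : algebraMap 𝕜 ℂ (p (i + 1) (v₀ (i + 1))) ≠ 0 :=
    (map_ne_zero _).2 fun h => hP (i + 1) (by simp [h1, h2, hi, h])
  have hxk : algebraMap 𝕜 ℂ (p (i + 2) (v₀ (i + 2))) ≠ 0 :=
    (map_ne_zero _).2 fun h => hP (i + 2) (by simp [h3, h4, hi, h])
  have hxi : algebraMap 𝕜 ℂ (p i (v₀ i)) ^ 2 -
      algebraMap 𝕜 ℂ (a (i + 1)) * algebraMap 𝕜 ℂ (a (i + 2)) ≠ 0 := by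
    simpa only [map_sub, map_mul, map_pow] using (map_ne_zero (algebraMap 𝕜 ℂ)).2 (hP i)
  have hαi : algebraMap 𝕜 ℂ (a i) = 0 := by rw [hi, map_zero]
  have hγ : algebraMap 𝕜 ℂ c ≠ 0 := (map_ne_zero _).2 hc
  have hαj := (map_ne_zero (algebraMap 𝕜 ℂ)).2 hj
  have hαk := (map_ne_zero (algebraMap 𝕜 ℂ)).2 hk
  obtain ⟨s, hs⟩ := IsAlgClosed.exists_pow_nat_eq (algebraMap 𝕜 ℂ (a (i + 1))) two_pos
  obtain ⟨r, hr⟩ := IsAlgClosed.exists_pow_nat_eq (algebraMap 𝕜 ℂ (a (i + 2))) two_pos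
  rw [hαi, ← hs, ← hr] at hΔ
  rw [← hs, ← hr] at hxi
  have hs0 : s ≠ 0 := by
    rintro rfl
    exact hαj (by rw [← hs]; simp)
  have hr0 : r ≠ 0 := by
    rintro rfl
    exact hαk (by rw [← hr]; simp)
  set γ := algebraMap 𝕜 ℂ c with hγdef
  set x := algebraMap 𝕜 ℂ (p i (v₀ i)) with hxdef
  set y := algebraMap 𝕜 ℂ (p (i + 1) (v₀ (i + 1))) with hydef
  set z := algebraMap 𝕜 ℂ (p (i + 2) (v₀ (i + 2))) with hzdef
  obtain ⟨ω, hω, hcoth⟩ := exists_coth_eq (z := x / (s * r))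
    (fun h => hxi (by rw [div_eq_one_iff_eq (mul_ne_zero hs0 hr0)] at h; rw [h]; ring))
    (fun h => hxi (by rw [div_eq_iff (mul_ne_zero hs0 hr0)] at h; rw [h]; ring))
  set w₀ : Fin 3 → ℂ := cyclicVec i ω (1 / (γ ^ 2 * s * y)) (1 / (γ ^ 2 * r * z)) with hw₀
  -- For `κ = 1` these scales have product `-1 / γ`, as the Riccati constants require, while `(μ_k
  -- μ_i) ^ 2 = s ^ 2` and `(μ_i μ_j) ^ 2 = r ^ 2` are the prescribed minors.
  set μ : Fin 3 → ℂ := cyclicVec i (-(γ * s * r)) (-1 / (γ * s)) (-1 / (γ * r)) with hμ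
  have w0 : w₀ i = _ := cyclicVec_zero i _ _ _
  have w1 : w₀ (i + 1) = _ := cyclicVec_one i _ _ _
  have w2 : w₀ (i + 2) = _ := cyclicVec_two i _ _ _
  have μ0 : μ i = _ := cyclicVec_zero i _ _ _
  have μ1 : μ (i + 1) = _ := cyclicVec_one i _ _ _
  have μ2 : μ (i + 2) = _ := cyclicVec_two i _ _ _
  have μp : μ 0 * μ 1 * μ 2 = _ := cyclicVec_prod i _ _ _
  have hw1 : w₀ (i + 1) ≠ 0 := by
    rw [w1]; exact one_div_ne_zero (mul_ne_zero (mul_ne_zero (pow_ne_zero 2 hγ) hs0) hxj)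
  have hw2 : w₀ (i + 2) ≠ 0 := by
    rw [w2]; exact one_div_ne_zero (mul_ne_zero (mul_ne_zero (pow_ne_zero 2 hγ) hr0) hxk)
  obtain ⟨V, hV, hwV, Φ, hΦ⟩ := exists_arctanDensityB i (by rwa [w0]) hw1 hw2 (by
    intro h
    rw [w0, w1, w2, hcoth] at h
    field_simp at h
    apply hΔ
    linear_combination h)
  have hA : ∀ l, (1 - Pi.single i 1 : Fin 3 → ℂ) l = if l = i then 0 else 1 := fun l => by
    by_cases hl : l = i <;> simp [hl]
  refine equivNear_of_riccati (κ := 1) (ρ := 1) (μ := μ) hI hf hv₀ hm hdet hric hV hwV hΦ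
    (hΦ.realizes hV) ?_ one_ne_zero ?_ ?_ ?_ ?_
  · simp only [hA]
    refine forall_fin_three_of i ?_ ?_ ?_
    · rw [w0]
      filter_upwards [(isOpen_compl_singleton.preimage Complex.continuous_sinh).mem_nhds hω]
        with w hw
      simp only [n1, n2, if_true, if_false]
      refine (hasDerivAt_complex_coth hw).congr_deriv ?_
      ring
    · filter_upwards [isOpen_compl_singleton.mem_nhds hw1] with w hw
      simp only [n1, h1, h2, if_true, if_false]
      simpa using hasDerivAt_one_div_mul one_ne_zero hw
    · filter_upwards [isOpen_compl_singleton.mem_nhds hw2] with w hw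
      simp only [n2, h3, h4, if_true, if_false]
      simpa using hasDerivAt_one_div_mul one_ne_zero hw
  · refine forall_fin_three_of i ?_ ?_ ?_
    · rw [μ0]; exact neg_ne_zero.2 (mul_ne_zero (mul_ne_zero hγ hs0) hr0)
    · rw [μ1]; exact div_ne_zero (by norm_num) (mul_ne_zero hγ hs0)
    · rw [μ2]; exact div_ne_zero (by norm_num) (mul_ne_zero hγ hr0)
  · rw [μp]
    field_simp
    rfl
  · simp only [hA]
    refine forall_fin_three_of i ?_ ?_ ?_
    · rw [if_pos rfl, hαi, mul_zero]
    · rw [h1, h2, μ0, μ2, if_neg n1, ← hs]; field_simp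
    · rw [h3, h4, μ0, μ1, if_neg n2, ← hr]; field_simp
  · rw [μp]
    refine forall_fin_three_of i ?_ ?_ ?_
    · rw [w0, μ0, if_pos rfl, hcoth]; field_simp; rfl
    · rw [w1, μ1, if_neg n1]; field_simp; rfl
    · rw [w2, μ2, if_neg n2]; field_simp; rfl

theorem equivNear_lobachevskyDensity (hI : ∀ i, IsOpen (I i))
    (hf : ContDiffOn 𝕜 3 f (Set.univ.pi I)) (hv₀ : v₀ ∈ Set.univ.pi I)
    (hm : HasMinors (Set.univ.pi I) f a p) (hdet : (hess f v₀).det ≠ 0) (hc : c ≠ 0)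
    (hric : ∀ i, ∀ t ∈ I i, HasDerivAt (p i) (c * (p i t ^ 2 - a (i + 1) * a (i + 2))) t)
    (hP : ∀ i, p i (v₀ i) ^ 2 - a (i + 1) * a (i + 2) ≠ 0) (ha : ∀ i, a i ≠ 0) :
    EquivNear f v₀ LobachevskyDensity := by
  have hD : IsOpen (Set.univ.pi I) := isOpen_set_pi Set.finite_univ fun i _ => hI i
  have hΔ := hm.algebraMap_discr_ne_zero hD hf hv₀ hdet 0
  have hx : ∀ i, algebraMap 𝕜 ℂ (p i (v₀ i)) ^ 2 -
      algebraMap 𝕜 ℂ (a (i + 1)) * algebraMap 𝕜 ℂ (a (i + 2)) ≠ 0 := fun i => by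
    simpa only [map_sub, map_mul, map_pow] using (map_ne_zero (algebraMap 𝕜 ℂ)).2 (hP i)
  have hγ : algebraMap 𝕜 ℂ c ≠ 0 := (map_ne_zero _).2 hc
  set γ := algebraMap 𝕜 ℂ c with hγdef
  have hs : ∀ i, ∃ s : ℂ, s ^ 2 = algebraMap 𝕜 ℂ (a i) := fun i =>
    IsAlgClosed.exists_pow_nat_eq _ two_pos
  choose s hs using hs
  have hs0 : ∀ i, s i ≠ 0 := fun i h => (map_ne_zero (algebraMap 𝕜 ℂ)).2 (ha i) (by
    rw [← hs, h]; simp)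
  simp only [← hs] at hΔ hx
  have ht : ∀ i, ∃ w, Complex.cosh w ≠ 0 ∧
      Complex.tanh w = algebraMap 𝕜 ℂ (p i (v₀ i)) / (s (i + 1) * s (i + 2)) := fun i =>
    exists_tanh_eq
      (fun h => hx i (by
        rw [div_eq_one_iff_eq (mul_ne_zero (hs0 _) (hs0 _))] at h; rw [h]; ring))
      (fun h => hx i (by
        rw [div_eq_iff (mul_ne_zero (hs0 _) (hs0 _))] at h; rw [h]; ring))
  choose w₀ hcosh htanh using ht
  have s0 := hs0 0
  have s1 := hs0 1
  have s2 := hs0 2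
  obtain ⟨V, hV, hwV, Φ, hΦ⟩ := exists_lobachevskyDensity hcosh (by
    intro h
    simp only [Fin.sum_univ_three, Fin.prod_univ_three, htanh, Fin.isValue, Fin.reduceAdd,
      zero_add] at h
    field_simp at h
    apply hΔ
    simp only [Fin.isValue, zero_add]
    linear_combination h)
  have hμp : (-(γ * s (0 + 1) * s (0 + 2))) * (-(γ * s (1 + 1) * s (1 + 2))) *
      (-(γ * s (2 + 1) * s (2 + 2))) = -(γ ^ 3 * (s 0 * s 1 * s 2) ^ 2) := by
    simp only [Fin.isValue, Fin.reduceAdd, zero_add]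
    ring
  -- Here `κ ^ 2 * (μ 0 * μ 1 * μ 2) = -1 / γ`, so the factor multiplying `tanh` in `p i` is `s (i +
  -- 1) * s (i + 2)`; this explains the choice of `w₀`.
  refine equivNear_of_riccati (κ := 1 / (γ ^ 2 * (s 0 * s 1 * s 2))) (ρ := 1)
    (μ := fun i => -(γ * s (i + 1) * s (i + 2))) hI hf hv₀ hm hdet hric hV hwV hΦ
    (hΦ.realizes hV) (fun i => ?_)
    (one_div_ne_zero (mul_ne_zero (pow_ne_zero 2 hγ) (mul_ne_zero (mul_ne_zero s0 s1) s2)))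
    (fun i => neg_ne_zero.2 (mul_ne_zero (mul_ne_zero hγ (hs0 _)) (hs0 _))) ?_ (fun i => ?_)
    fun i => ?_
  · filter_upwards [(isOpen_compl_singleton.preimage Complex.continuous_cosh).mem_nhds (hcosh i)]
      with w hw
    refine (hasDerivAt_complex_tanh hw).congr_deriv ?_
    simp
  · rw [hμp]
    field_simp
    rfl
  · have hsp : s 0 * s 1 * s 2 = s i * s (i + 1) * s (i + 2) := by
      fin_cases i <;> simp <;> ring
    obtain ⟨h1, h2, h3, h4⟩ := fin_three_add i
    have := hs0 i
    have := hs0 (i + 1)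
    have := hs0 (i + 2)
    rw [hsp, h1, h2, h3, h4, ← hs, Pi.one_apply]
    field_simp
  · have := hs0 (i + 1)
    have := hs0 (i + 2)
    rw [hμp, htanh]
    field_simp

/-- Nonconstant, nondegenerate integrable densities are equivalent to the normal forms. -/
theorem equivNear_normalForm (hI : ∀ i, IsOpen (I i)) (hI' : ∀ i, IsPreconnected (I i))
    (hf : ContDiffOn 𝕜 3 f (Set.univ.pi I)) (hm : HasMinors (Set.univ.pi I) f a p)
    (hdet : ∀ v ∈ Set.univ.pi I, (hess f v).det ≠ 0)
    (hdiag : ∀ i, ∃ v ∈ Set.univ.pi I, hess f v i i ≠ 0)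
    (hconst : ¬ ∃ H : Matrix (Fin 3) (Fin 3) 𝕜, ∀ v ∈ Set.univ.pi I, hess f v = H)
    (hv₀ : v₀ ∈ Set.univ.pi I) :
    ((∀ i, a i = 0) → EquivNear f v₀ SqrtDensity) ∧
    (∀ i, a i ≠ 0 → a (i + 1) = 0 → a (i + 2) = 0 → EquivNear f v₀ (ArctanDensityA i)) ∧
    (∀ i, a i = 0 → a (i + 1) ≠ 0 → a (i + 2) ≠ 0 → EquivNear f v₀ (ArctanDensityB i)) ∧
    ((∀ i, a i ≠ 0) → EquivNear f v₀ LobachevskyDensity) := by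
  obtain ⟨c, hric⟩ := riccati hI hf hm hdet fun i j _ =>
    (hdiag i).imp fun v hv => ⟨hv.1, Or.inl hv.2⟩
  have hc := riccati_const_ne_zero hI hI' hf hm hdet hconst hv₀ hric
  have hP : ∀ i, p i (v₀ i) ^ 2 - a (i + 1) * a (i + 2) ≠ 0 := fun i =>
    hm.sq_sub_ne_zero hI hI' hf hdet hdiag hric i (hv₀ i trivial)
  have hd := hdet v₀ hv₀
  exact ⟨equivNear_sqrtDensity hI hf hv₀ hm hd hc hric hP,
    fun i => equivNear_arctanDensityA hI hf hv₀ hm hd hc hric hP,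
    fun i => equivNear_arctanDensityB hI hf hv₀ hm hd hc hric hP,
    equivNear_lobachevskyDensity hI hf hv₀ hm hd hc hric hP⟩

end Cases

end Lagr

theorem mainTheorem6 {𝕜 : Type*} [RCLike 𝕜] [NormedAlgebra 𝕜 ℂ] :
    -- densities on a product of open connected sets
    (∀ (I : Fin 3 → Set 𝕜) (f : (Fin 3 → 𝕜) → 𝕜),
      (∀ i, IsOpen (I i)) → (∀ i, IsPreconnected (I i)) →
      ContDiffOn 𝕜 3 f (Set.univ.pi I) →
      -- integrability in terms of the minors
      (Lagr.IsIntegrable (Set.univ.pi I) f ↔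
        ∃ (a : Fin 3 → 𝕜) (p : Fin 3 → 𝕜 → 𝕜), Lagr.HasMinors (Set.univ.pi I) f a p) ∧
      ∀ (a : Fin 3 → 𝕜) (p : Fin 3 → 𝕜 → 𝕜), Lagr.HasMinors (Set.univ.pi I) f a p →
        (∀ v ∈ Set.univ.pi I, (Lagr.hess f v).det ≠ 0) →
        -- the Riccati equations
        ((∀ i j, i ≠ j → ∃ v ∈ Set.univ.pi I, Lagr.hess f v i i ≠ 0 ∨ Lagr.hess f v j j ≠ 0) →
          ∃ c : 𝕜, ∀ i, ∀ t ∈ I i,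
            HasDerivAt (p i) (c * (p i t ^ 2 - a (i + 1) * a (i + 2))) t) ∧
        -- the normal forms
        ((∀ i, ∃ v ∈ Set.univ.pi I, Lagr.hess f v i i ≠ 0) →
          (¬ ∃ H : Matrix (Fin 3) (Fin 3) 𝕜, ∀ v ∈ Set.univ.pi I, Lagr.hess f v = H) →
          ∀ v₀ ∈ Set.univ.pi I,
            ((∀ i, a i = 0) → Lagr.EquivNear f v₀ Lagr.SqrtDensity) ∧
            (∀ i, a i ≠ 0 → a (i + 1) = 0 → a (i + 2) = 0 →
              Lagr.EquivNear f v₀ (Lagr.ArctanDensityA i)) ∧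
            (∀ i, a i = 0 → a (i + 1) ≠ 0 → a (i + 2) ≠ 0 →
              Lagr.EquivNear f v₀ (Lagr.ArctanDensityB i)) ∧
            ((∀ i, a i ≠ 0) → Lagr.EquivNear f v₀ Lagr.LobachevskyDensity))) ∧
    -- the complex normal forms are integrable
    (∀ (V : Set (Fin 3 → ℂ)) (Φ : (Fin 3 → ℂ) → ℂ), IsOpen V →
      (Lagr.SqrtDensity V Φ → Lagr.Realizes V Φ 0 (fun _ t => 1 / (8 * t))) ∧
      (∀ i, Lagr.ArctanDensityA i V Φ → Lagr.Realizes V Φ (Pi.single i 1) (fun _ t => 1 / t)) ∧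
      (∀ i, Lagr.ArctanDensityB i V Φ → Lagr.Realizes V Φ (1 - Pi.single i 1)
        (fun j t => if j = i then Complex.cosh t / Complex.sinh t else 1 / t)) ∧
      (Lagr.LobachevskyDensity V Φ → Lagr.Realizes V Φ 1 (fun _ t => Complex.tanh t))) ∧
    -- the real densities
    Lagr.Realizes {v : Fin 3 → ℝ | 0 < v 0 * v 1 * v 2} Lagr.sqrtReal 0 (fun _ t => 1 / (8 * t)) ∧
    Lagr.Realizes {v : Fin 3 → ℝ | 0 < v 2 * v 1 ∧ v 2 * v 1 < 2 * v 0} Lagr.arctanRealA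
      (Pi.single 0 1) (fun _ t => 1 / t) ∧
    Lagr.Realizes {v : Fin 3 → ℝ | v 0 ≠ 0 ∧ v 1 ≠ v 2 ∧ v 1 ≠ -v 2 ∧ 0 < Lagr.radicandB v}
      Lagr.arctanRealB (1 - Pi.single 0 1)
      (fun j t => if j = 0 then Real.cosh t / Real.sinh t else 1 / t) ∧
    Lagr.Realizes Lagr.triangleDomain Lagr.lobachevskyReal 1 (fun _ t => Real.tanh t) := by
  refine ⟨fun I f hI hI' hf => ⟨Lagr.isIntegrable_iff_hasMinors hI hI' hf, fun a p hm hdet =>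
    ⟨Lagr.riccati hI hf hm hdet, fun hdiag hconst v₀ hv₀ =>
      Lagr.equivNear_normalForm hI hI' hf hm hdet hdiag hconst hv₀⟩⟩,
    fun V Φ hV => ⟨fun h => h.realizes hV, fun i h => h.realizes hV, fun i h => h.realizes hV,
      fun h => h.realizes hV⟩, Lagr.realizes_sqrtReal, Lagr.realizes_arctanRealA,
    Lagr.realizes_arctanRealB, Lagr.realizes_lobachevskyReal⟩
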